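/- A source generates packets according to a Poisson process of rate $\lambda>0$ and sends them to a single server. The service times $H$ of the packets are i.i.d. exponential with rate $\mu>0$, the vacation times $V$ of the server are i.i.d. exponential with rate $v>0$, and the arrival process, the service times and the vacation times are independent. At time $0$ the system is empty, the server starts a vacation, and the age has some value $a_0\ge 0$. After each completed service the server takes a vacation; if it finds the buffer empty at the end of a vacation it takes another vacation, otherwise it starts serving the packet in the buffer. The buffer holds at most one packet, and a packet entering the buffer replaces the one held there. Packets generated during a vacation enter the buffer. A packet generated during a service * is rejected in the conventional buffer system (CBS); * enters the buffer in the buffer relaxation system (BRS), where the buffer is free again as soon as a service starts; * preempts the packet in service, which is discarded, in the conventional buffer system with preemption (CBS-P). Let $C_{1}<C_2<\dots$ be the completion times of the packets that complete service and $r_1<r_2<\dots$ their generation times, and put $C_0=0$, $r_0=-a_0$. The age is $\Delta(t)=t-\max\{r_l: C_l\le t\}$, and its $l$-th peak is $A_l=C_l-r_{l-1}$, $l\ge1$. The age of information $\mathbf E[\Delta]$ is the common value of $\lim_{T\to\infty}\frac1T\int_0^T\Delta(t)\,dt$ (almost surely) and $\lim_{t\to\infty}\mathbf E[\Delta(t)]$;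 the peak age of information $\mathbf E[A]$ is the common value of $\lim_{k\to\infty}\frac1k\sum_{l=1}^kA_l$ (almost surely) and $\lim_{l\to\infty}\mathbf E[A_l]$; and $\mathrm{Var}(A)=\lim_{l\to\infty}\mathrm{Var}(A_l)$. Then all these limits exist in the following cases (all the random variables whose means or variances are taken being integrable, respectively square integrable), and, with a subscript indicating the system, $$\mathbf E[\Delta_{CBS}]=\frac1\lambda+\frac1v-\frac{\lambda+v+\mu}{v\lambda+\mu\lambda+\mu v}+\frac1{v+\lambda}+\frac2\mu,$$ $$\mathbf E[A_{CBS}]=\frac1\lambda+\frac1v+\frac1{v+\lambda}+\frac2\mu,\qquad \mathrm{Var}(A_{CBS})=\frac1{(\lambda+v)^2}+\frac1{\lambda^2}+\frac1{v^2}+\frac2{\mu^2};$$ $$\mathbf E[\Delta_{BRS}]=\frac{\frac1{v^2}+\frac1{v\mu}+\frac1{\mu^2}+\frac{\mu}{\lambda v(\lambda+\mu)}+\frac{\mu}{\lambda^2(\lambda+\mu)}+\frac{\mu}{\lambda(\lambda+\mu)^2}}{\frac1v+\frac1\mu+\frac{\mu}{\lambda(\lambda+\mu)}}+\frac1{\lambda+v}+\frac{\lambda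 v}{(\lambda+\mu)^2(\lambda+v)}+\frac1\mu,$$ $$\mathbf E[A_{BRS}]=\frac{\mu^2-\mu v+\lambda\mu}{(\lambda+\mu)^2(\lambda+v)}+\frac1v+\frac2\mu+\frac1\lambda;$$ $$\mathbf E[A_{CBS\text{-}P}]=\frac1\lambda+\frac1\mu+\frac1v+\frac{\lambda+\mu+v}{(\lambda+\mu)(\lambda+v)},$$ $$\mathbf E[\Delta_{CBS\text{-}P}]=\frac1v+\frac1\lambda+\frac1\mu-\frac{\mu+v+\lambda}{\lambda\mu+v\mu+\lambda v}+\frac{v+\mu+\lambda}{(\mu+\lambda)(v+\lambda)}.$$ -/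

import Mathlib

open MeasureTheory ProbabilityTheory Filter Topology

namespace VacationQueue

/-- The three buffer policies: the conventional buffer system, the buffer relaxation system, and the
conventional buffer system with preemption in service. -/
inductive Policy where
  | cbs
  | brs
  | cbsp

/-- The generation epoch of packet `n` (packets are numbered from `0`), given the inter-generation
times `T`. -/
def genTime (T : ℕ → ℝ) (n : ℕ) : ℝ := ∑ i ∈ Finset.range (n + 1), T i

/-- The state of the system between two events. -/
structure State where
  /-- The next packet to be generated. -/
  nextPacket : ℕ
  /-- The next vacation to be taken. -/
  nextVacation : ℕ
  /-- The packet in service; `none` means that the server is on vacation. -/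
  server : Option ℕ
  /-- The packet waiting in the buffer, if any. -/
  buffer : Option ℕ
  /-- The scheduled end of the current service or of the current vacation. -/
  phaseEnd : ℝ

/-- At time `0` the system is empty and the server starts its first vacation. -/
def State.init (V : ℕ → ℝ) : State where
  nextPacket := 0
  nextVacation := 1
  server := none
  buffer := none
  phaseEnd := V 0

/-- The next event is the generation of a packet (rather than the end of a service or vacation). -/
def State.ArrivalNext (T : ℕ → ℝ) (s : State) : Prop := genTime T s.nextPacket < s.phaseEnd

/-- A new packet is generated and sent to the server. During a vacation it is put into the buffer,
where it replaces the packet that may be there. During a service it is rejected (CBS), or put into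
the buffer, where it replaces the packet that may be there (BRS), or it preempts the packet in
service, which is discarded (CBS-P). -/
def State.onArrival (π : Policy) (T H : ℕ → ℝ) (s : State) : State :=
  match s.server, π with
  | none, _ =>
      { s with nextPacket := s.nextPacket + 1, buffer := some s.nextPacket }
  | some _, Policy.cbs =>
      { s with nextPacket := s.nextPacket + 1 }
  | some _, Policy.brs =>
      { s with nextPacket := s.nextPacket + 1, buffer := some s.nextPacket }
  | some _, Policy.cbsp =>
      { s with
        nextPacket := s.nextPacket + 1
        server := some s.nextPacket
        phaseEnd := genTime T s.nextPacket + H s.nextPacket }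

/-- The current service or vacation ends. After a service the server takes a vacation. After a
vacation it takes another vacation if the buffer is empty, and otherwise it starts to serve the
packet in the buffer, which leaves the buffer. -/
def State.onPhaseEnd (H V : ℕ → ℝ) (s : State) : State :=
  match s.server, s.buffer with
  | none, some n =>
      { s with server := some n, buffer := none, phaseEnd := s.phaseEnd + H n }
  | _, _ =>
      { s with
        nextVacation := s.nextVacation + 1
        server := none
        phaseEnd := s.phaseEnd + V s.nextVacation }

open Classical in
/-- The state after the next event. -/
noncomputable def State.step (π : Policy) (T H V : ℕ → ℝ) (s : State) : State :=
  if s.ArrivalNext T then s.onArrival π T H else s.onPhaseEnd H V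

/-- The state after `j` events, given the inter-generation times `T`, the service times `H` (`H n`
for packet `n`) and the vacation times `V` (`V k` for the `k`-th vacation). -/
noncomputable def stateAt (π : Policy) (T H V : ℕ → ℝ) (j : ℕ) : State :=
  (State.step π T H V)^[j] (State.init V)

/-- The next event after the first `j` events is the completion of the service of a packet. -/
def IsCompletion (π : Policy) (T H V : ℕ → ℝ) (j : ℕ) : Prop :=
  ¬ (stateAt π T H V j).ArrivalNext T ∧ (stateAt π T H V j).server.isSome

/-- The completion time of the `l`-th informative packet (a packet that completes service). Index
`0` stands for the last packet delivered before the observation starts, completed at time `0`. -/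
noncomputable def complTime (π : Policy) (T H V : ℕ → ℝ) : ℕ → ℝ
  | 0 => 0
  | l + 1 => (stateAt π T H V (Nat.nth (IsCompletion π T H V) l)).phaseEnd

/-- The generation time of the `l`-th informative packet; the age at time `0` is `a₀`. -/
noncomputable def informGenTime (π : Policy) (a₀ : ℝ) (T H V : ℕ → ℝ) : ℕ → ℝ
  | 0 => -a₀
  | l + 1 =>
      genTime T (((stateAt π T H V (Nat.nth (IsCompletion π T H V) l)).server).getD 0)

/-- The age at time `t`: the time elapsed since the generation of the freshest packet that has been
completed by time `t`. -/
noncomputable def age (π : Policy) (a₀ : ℝ) (T H V : ℕ → ℝ) (t : ℝ) : ℝ :=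
  t - sSup {r | ∃ l, complTime π T H V l ≤ t ∧ r = informGenTime π a₀ T H V l}

/-- The peaks of the age process, numbered from `0`: the value of the age just before the completion
of the `(l + 1)`-st informative packet, that is, the time span from the generation of its
predecessor among the informative packets to its completion. -/
noncomputable def peak (π : Policy) (a₀ : ℝ) (T H V : ℕ → ℝ) (l : ℕ) : ℝ :=
  complTime π T H V (l + 1) - informGenTime π a₀ T H V l

variable {Ω : Type*} [MeasurableSpace Ω]

/-- The age process of the random system. -/
noncomputable def ageProc (π : Policy) (a₀ : ℝ) (T H V : ℕ → Ω → ℝ) (t : ℝ) (ω : Ω) : ℝ :=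
  age π a₀ (fun n => T n ω) (fun n => H n ω) (fun n => V n ω) t

/-- The sequence of age peaks of the random system. -/
noncomputable def peakProc (π : Policy) (a₀ : ℝ) (T H V : ℕ → Ω → ℝ) (l : ℕ) (ω : Ω) : ℝ :=
  peak π a₀ (fun n => T n ω) (fun n => H n ω) (fun n => V n ω) l

/-- The primitives of the system with exponential service and vacation times: packets are generated
by a Poisson process of rate `lam`, given by its inter-generation times `T`; the service times `H`
are exponential with rate `mu`, the vacation times `V` are exponential with rate `v`; and all of
these random variables are independent. -/
structure ExpPrimitives (P : Measure Ω) (lam mu v : ℝ) (T H V : ℕ → Ω → ℝ) : Prop where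
  law_T : ∀ n, HasLaw (T n) (expMeasure lam) P
  law_H : ∀ n, HasLaw (H n) (expMeasure mu) P
  law_V : ∀ n, HasLaw (V n) (expMeasure v) P
  indep : iIndepFun (Sum.elim T (Sum.elim H V)) P

/-- The age of information `E[Δ]` of the process `Δ` is `a`: it is the almost sure limit of the time
averages and the limit of the expected age at time `t`. -/
structure HasAoI (P : Measure Ω) (Δ : ℝ → Ω → ℝ) (a : ℝ) : Prop where
  path_integrable : ∀ᵐ ω ∂P, ∀ τ, 0 ≤ τ → IntervalIntegrable (fun t => Δ t ω) volume 0 τ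
  timeAverage : ∀ᵐ ω ∂P, Tendsto (fun τ : ℝ => τ⁻¹ * ∫ t in (0 : ℝ)..τ, Δ t ω) atTop (𝓝 a)
  integrable : ∀ t, 0 ≤ t → Integrable (Δ t) P
  mean : Tendsto (fun t : ℝ => ∫ ω, Δ t ω ∂P) atTop (𝓝 a)

/-- The peak age of information `E[A]` is `a`: it is the almost sure limit of the averages of the
peaks and the limit of the expected peaks. -/
structure HasPAoI (P : Measure Ω) (A : ℕ → Ω → ℝ) (a : ℝ) : Prop where
  average : ∀ᵐ ω ∂P,
    Tendsto (fun k : ℕ => (k : ℝ)⁻¹ * ∑ l ∈ Finset.range k, A l ω) atTop (𝓝 a)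
  integrable : ∀ l, Integrable (A l) P
  mean : Tendsto (fun l : ℕ => ∫ ω, A l ω ∂P) atTop (𝓝 a)

/-- The variance `Var(A)` of the peak age is `a`: it is the limit of the variances of the peaks. -/
structure HasPeakVariance (P : Measure Ω) (A : ℕ → Ω → ℝ) (a : ℝ) : Prop where
  memLp : ∀ l, MemLp (A l) 2 P
  variance : Tendsto (fun l : ℕ => variance (A l) P) atTop (𝓝 a)

end VacationQueue

namespace VacationQueue

open Set
open scoped ENNReal

/-! ### Exponential laws -/

/-! Since all clocks are exponential, the system seen at its events (generation of a packet, end of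
a service or vacation) is a Markov chain. At an event the clock that has not rung starts afresh
(`lintegral_race`), so the state can be split into an observable part `Obs` (a mode out of four and
a few times) and a `Clock` of residual times and unused primitives whose law depends on the mode
only. This gives the Markov property `J_jump`. The chain is tied to the event-by-event system of the
statement by the invariant `Describes` and by counting completions (`Recurrent.exists_index`).

A phase with all its arrivals is described by two independent exponentials: its length and the time
from the last arrival back to its end, cut off at the length. Therefore expectations at the next
start of a service are explicit integrals (`startExp`); they are harmonic for the stopped chain
(`K_startExp`), a start occurs almost surely (`startProb_eq_one`), and the strong Markov property
`J_start` follows. The law of the data of a cycle between two starts does not depend on the state at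
its beginning, so that these data are independent and identically distributed
(`iIndepFun_serviceData`, `map_serviceData`).

From the third peak on, a peak is one fixed function of three consecutive cycle data, and so are the
gap between completions and the area under the age over that gap. Hence the mean and the variance of
the peaks are eventually constant, averages converge by a strong law for overlapping windows
(`tendsto_average_window`), and the time average of the age is mean area over mean gap
(`Deliveries.tendsto_timeAverage`).

For the limit of the expected age, `Δ(t) ≥ x` means that no packet generated after `t - x` is
completed by time `t`. For `x ≤ t` the chain of modes first runs for a time `t - x`; from then on
every newly generated packet counts, and the event is that none is completed within a further time
`x`. As a function of the first duration this probability solves the backward equation of a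
four-state chain with a spectral gap (`exists_gap`), so it converges to the stationary mean of the
probabilities `freshR` (`tendsto_delayedR`). Integration over `x` with dominated convergence gives
the limit of the mean age as the stationary mean of the integrals of `freshR`, which a second set of
linear differential equations determines (`hasMean_of_hasDerivAt`). That this value agrees with mean
area over mean gap is an identity of rational functions, verified separately for each policy. -/

theorem lintegral_expMeasure (r : ℝ) {f : ℝ → ℝ≥0∞} (hf : Measurable f) :
    ∫⁻ x, f x ∂expMeasure r =
      ∫⁻ x in Ioi 0, ENNReal.ofReal (r * Real.exp (-(r * x))) * f x := by
  have hm : Measurable (gammaPDF 1 r) := (measurable_gammaPDFReal 1 r).ennreal_ofReal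
  rw [expMeasure, gammaMeasure, lintegral_withDensity_eq_lintegral_mul _ hm hf,
    ← lintegral_indicator measurableSet_Ioi]
  refine lintegral_congr_ae ?_
  have h0 : ∀ᵐ x : ℝ, x ≠ 0 := by simp [ae_iff]
  filter_upwards [h0] with x hx
  have hpdf := exponentialPDF_eq r x
  rw [exponentialPDF, exponentialPDFReal] at hpdf
  rw [Pi.mul_apply, gammaPDF, hpdf]
  rcases lt_or_gt_of_ne hx with h | h
  · simp [indicator, not_lt.2 h.le, not_le.2 h]
  · simp [indicator, h, h.le]

theorem expMeasure_absolutelyContinuous (r : ℝ) : expMeasure r ≪ volume :=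
  withDensity_absolutelyContinuous _ _

instance instNullSingletonExp (r : ℝ) : NullSingletonClass (expMeasure r) :=
  ⟨fun x => expMeasure_absolutelyContinuous r (by simp)⟩

theorem ae_expMeasure_pos (r : ℝ) : ∀ᵐ x ∂expMeasure r, 0 < x := by
  rw [ae_iff]
  have hs : MeasurableSet {x : ℝ | ¬ 0 < x} := (measurableSet_Ioi (a := (0 : ℝ))).compl
  have hm : Measurable ({x : ℝ | ¬ 0 < x}.indicator (1 : ℝ → ℝ≥0∞)) := measurable_one.indicator hs
  rw [← lintegral_indicator_one hs, lintegral_expMeasure r hm]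
  rw [setLIntegral_congr_fun (g := fun _ => 0) measurableSet_Ioi]
  · simp
  · intro x hx
    simp only [mem_Ioi] at hx
    simp [indicator, hx]

/-- Memorylessness: beyond `x` the exponential density is `exp (-(r * x))` times its translate. -/
theorem lintegral_expMeasure_tail {r x : ℝ} (hx : 0 < x) {f : ℝ → ℝ≥0∞}
    (hf : Measurable f) :
    ∫⁻ y, (Ioi x).indicator f y ∂expMeasure r =
      ENNReal.ofReal (Real.exp (-(r * x))) * ∫⁻ y, f (x + y) ∂expMeasure r := by
  rw [lintegral_expMeasure r (hf.indicator measurableSet_Ioi),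
    lintegral_expMeasure r (f := fun y => f (x + y)) (hf.comp (measurable_const_add x)),
    ← lintegral_indicator measurableSet_Ioi, ← lintegral_indicator measurableSet_Ioi,
    ← lintegral_const_mul]
  · rw [← lintegral_add_left_eq_self _ x]
    refine lintegral_congr fun y => ?_
    by_cases hy : 0 < y
    · have h1 : 0 < x + y := by positivity
      simp only [indicator, mem_Ioi, hy, h1, lt_add_iff_pos_right, if_true]
      rw [← mul_assoc, ← ENNReal.ofReal_mul (by positivity)]
      congr 2
      rw [mul_add, neg_add, Real.exp_add]
      ring
    · simp [indicator, hy]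
  · exact (Measurable.mul (by fun_prop) (hf.comp (measurable_const_add x))).indicator
      measurableSet_Ioi

/-- Half of the race: by memorylessness of the second clock the density of the first is multiplied
by `exp (-(b * x))`, which gives the exponential density of rate `a + b` up to the winning
probability `a / (a + b)`. -/
theorem lintegral_race_lt {a b : ℝ} (ha : 0 < a) (hb : 0 < b) {Φ : ℝ → ℝ → ℝ≥0∞}
    (hΦ : Measurable (Function.uncurry Φ)) :
    ∫⁻ x, ∫⁻ y, (Ioi x).indicator (Φ x) y ∂expMeasure b ∂expMeasure a =
      ENNReal.ofReal (a / (a + b)) *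
        ∫⁻ h, ∫⁻ y, Φ h (h + y) ∂expMeasure b ∂expMeasure (a + b) := by
  have := isProbabilityMeasure_expMeasure hb
  have hK : Measurable fun x => ∫⁻ y, Φ x (x + y) ∂expMeasure b :=
    Measurable.lintegral_prod_right' (f := fun p : ℝ × ℝ => Φ p.1 (p.1 + p.2))
      (hΦ.comp (measurable_fst.prodMk (measurable_fst.add measurable_snd)))
  have h1 : ∀ᵐ x ∂expMeasure a, ∫⁻ y, (Ioi x).indicator (Φ x) y ∂expMeasure b =
      ENNReal.ofReal (Real.exp (-(b * x))) * ∫⁻ y, Φ x (x + y) ∂expMeasure b := by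
    filter_upwards [ae_expMeasure_pos a] with x hx
    exact lintegral_expMeasure_tail hx (hΦ.comp measurable_prodMk_left)
  rw [lintegral_congr_ae h1, lintegral_expMeasure a (by fun_prop), lintegral_expMeasure _ hK,
    ← lintegral_const_mul]
  · refine lintegral_congr fun x => ?_
    rw [← mul_assoc, ← mul_assoc, ← ENNReal.ofReal_mul (by positivity),
      ← ENNReal.ofReal_mul (by positivity)]
    congr 2
    rw [add_mul a b x, neg_add, Real.exp_add]
    field_simp
  · fun_prop

/-- The first of two independent exponential clocks is exponential with the sum of the rates, it is
independent of which clock rings first, and the other clock starts afresh. -/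
theorem lintegral_race {a b : ℝ} (ha : 0 < a) (hb : 0 < b) {Φ : ℝ → ℝ → ℝ≥0∞}
    (hΦ : Measurable (Function.uncurry Φ)) :
    ∫⁻ x, ∫⁻ y, Φ x y ∂expMeasure b ∂expMeasure a =
      ∫⁻ h, (ENNReal.ofReal (a / (a + b)) * ∫⁻ y, Φ h (h + y) ∂expMeasure b +
        ENNReal.ofReal (b / (a + b)) * ∫⁻ x, Φ (h + x) h ∂expMeasure a) ∂expMeasure (a + b) := by
  have := isProbabilityMeasure_expMeasure hb
  have := isProbabilityMeasure_expMeasure ha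
  have hΦ' : Measurable (Function.uncurry fun y x => Φ x y) := hΦ.comp measurable_swap
  have hm1 : Measurable (Function.uncurry fun x y => (Ioi x).indicator (Φ x) y) := by
    have : (Function.uncurry fun x y => (Ioi x).indicator (Φ x) y) =
        {p : ℝ × ℝ | p.1 < p.2}.indicator (Function.uncurry Φ) := by
      ext p; simp [indicator, Function.uncurry]
    rw [this]
    exact hΦ.indicator (measurableSet_lt measurable_fst measurable_snd)
  have hm2 : Measurable (Function.uncurry fun x y => (Ioi y).indicator (fun x => Φ x y) x) := by
    have : (Function.uncurry fun x y => (Ioi y).indicator (fun x => Φ x y) x) =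
        {p : ℝ × ℝ | p.2 < p.1}.indicator (Function.uncurry Φ) := by
      ext p; simp [indicator, Function.uncurry]
    rw [this]
    exact hΦ.indicator (measurableSet_lt measurable_snd measurable_fst)
  have hsplit : ∀ x, ∫⁻ y, Φ x y ∂expMeasure b =
      ∫⁻ y, (Ioi x).indicator (Φ x) y ∂expMeasure b +
        ∫⁻ y, (Ioi y).indicator (fun x => Φ x y) x ∂expMeasure b := by
    intro x
    have hmx : Measurable fun y => (Ioi x).indicator (Φ x) y := hm1.comp measurable_prodMk_left
    -- Ties are null because the exponential law has no atoms.
    rw [← lintegral_add_left hmx]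
    refine lintegral_congr_ae ?_
    have : ∀ᵐ y ∂expMeasure b, y ≠ x := by simp [ae_iff]
    filter_upwards [this] with y hy
    rcases lt_or_gt_of_ne hy with h | h
    · simp [indicator, h, not_lt.2 h.le]
    · simp [indicator, h, not_lt.2 h.le]
  have hswap : ∫⁻ x, ∫⁻ y, (Ioi y).indicator (fun x => Φ x y) x ∂expMeasure b ∂expMeasure a =
      ∫⁻ y, ∫⁻ x, (Ioi y).indicator (fun x => Φ x y) x ∂expMeasure a ∂expMeasure b :=
    lintegral_lintegral_swap hm2.aemeasurable
  have hr := lintegral_race_lt hb ha hΦ'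
  rw [lintegral_congr hsplit, lintegral_add_left, hswap, lintegral_race_lt ha hb hΦ, hr,
    add_comm b a, ← lintegral_const_mul, ← lintegral_const_mul, ← lintegral_add_left]
  · exact Measurable.const_mul (Measurable.lintegral_prod_right'
      (f := fun p : ℝ × ℝ => Φ p.1 (p.1 + p.2))
      (hΦ.comp (measurable_fst.prodMk (measurable_fst.add measurable_snd)))) _
  · exact Measurable.lintegral_prod_right'
      (f := fun p : ℝ × ℝ => Φ (p.1 + p.2) p.1)
      (hΦ.comp ((measurable_fst.add measurable_snd).prodMk measurable_fst))
  · exact Measurable.lintegral_prod_right'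
      (f := fun p : ℝ × ℝ => Φ p.1 (p.1 + p.2))
      (hΦ.comp (measurable_fst.prodMk (measurable_fst.add measurable_snd)))
  · exact Measurable.lintegral_prod_right' hm1

/-! ### Sequences of independent, identically distributed variables -/

/-- The law of a sequence of independent exponential variables. -/
noncomputable def expSeq (r : ℝ) : Measure (ℕ → ℝ) := Measure.infinitePi fun _ => expMeasure r

/-- The sequence without its first term. -/
def shift (x : ℕ → ℝ) : ℕ → ℝ := fun k => x (k + 1)

theorem measurable_shift : Measurable shift :=
  measurable_pi_lambda _ fun _ => measurable_pi_apply _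

theorem isProbabilityMeasure_expSeq {r : ℝ} (hr : 0 < r) : IsProbabilityMeasure (expSeq r) := by
  have := isProbabilityMeasure_expMeasure hr
  unfold expSeq; infer_instance

/-- Prepending an independent term is the inverse operation. That it produces the infinite product
law is checked on finite-dimensional boxes, and the claim follows by inverting. -/
theorem measurePreserving_head_shift {r : ℝ} (hr : 0 < r) :
    MeasurePreserving (fun x : ℕ → ℝ => (x 0, shift x)) (expSeq r)
      ((expMeasure r).prod (expSeq r)) := by
  have := isProbabilityMeasure_expMeasure hr
  have := isProbabilityMeasure_expSeq hr
  have hm : Measurable fun x : ℕ → ℝ => (x 0, shift x) :=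
    (measurable_pi_apply 0).prodMk measurable_shift
  refine ⟨hm, ?_⟩
  have hcons : Measurable fun p : ℝ × (ℕ → ℝ) => (fun n => Nat.casesOn n p.1 p.2 : ℕ → ℝ) := by
    refine measurable_pi_lambda _ fun n => ?_
    cases n with
    | zero => exact measurable_fst
    | succ n => exact (measurable_pi_apply n).comp measurable_snd
  have key : ((expMeasure r).prod (expSeq r)).map
      (fun p : ℝ × (ℕ → ℝ) => (fun n => Nat.casesOn n p.1 p.2 : ℕ → ℝ)) = expSeq r := by
    refine Measure.eq_infinitePi (fun _ => expMeasure r) fun s t ht => ?_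
    obtain ⟨n, hn⟩ : ∃ n, s ⊆ Finset.range (n + 1) :=
      ⟨s.sup id, fun i hi => Finset.mem_range.2
        (Nat.lt_succ_of_le (Finset.le_sup (f := id) hi))⟩
    classical
    -- The box is completed by trivial factors, so that it is indexed by an initial segment and its
    -- factor at `0` splits off.
    let t' : ℕ → Set ℝ := fun i => if i ∈ s then t i else univ
    have ht' : ∀ i, MeasurableSet (t' i) := fun i => by
      by_cases h : i ∈ s <;> simp [t', h, ht]
    have h1 : (fun p : ℝ × (ℕ → ℝ) => (fun n => Nat.casesOn n p.1 p.2 : ℕ → ℝ)) ⁻¹'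
        (s : Set ℕ).pi t = (t' 0) ×ˢ ((Finset.range n : Set ℕ).pi fun i => t' (i + 1)) := by
      ext p
      simp only [mem_preimage, Set.mem_pi, Finset.mem_coe, mem_prod, Finset.mem_range]
      constructor
      · intro h
        refine ⟨?_, fun i _ => ?_⟩
        · by_cases hi : 0 ∈ s
          · simpa [t', hi] using h 0 hi
          · simp [t', hi]
        · by_cases hi : i + 1 ∈ s
          · simpa [t', hi] using h (i + 1) hi
          · simp [t', hi]
      · rintro ⟨h0, h⟩ i hi
        cases i with
        | zero => simpa [t', hi] using h0
        | succ i =>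
          have := h i (by have := Finset.mem_range.1 (hn hi); omega)
          simpa [t', hi] using this
    have hms : MeasurableSet ((s : Set ℕ).pi t) :=
      MeasurableSet.pi s.countable_toSet fun i _ => ht i
    rw [Measure.map_apply hcons hms, h1, Measure.prod_prod, expSeq,
      Measure.infinitePi_pi _ (fun i _ => ht' (i + 1))]
    have h2 : ∏ i ∈ s, expMeasure r (t i) = ∏ i ∈ Finset.range (n + 1), expMeasure r (t' i) := by
      rw [← Finset.prod_subset hn]
      · exact Finset.prod_congr rfl fun i hi => by simp [t', hi]
      · intro i _ hi
        simp [t', hi]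
    rw [h2, Finset.prod_range_succ', mul_comm]
  conv_lhs => rw [← key]
  rw [Measure.map_map hm hcons]
  have : (fun x : ℕ → ℝ => (x 0, shift x)) ∘
      (fun p : ℝ × (ℕ → ℝ) => (fun n => Nat.casesOn n p.1 p.2 : ℕ → ℝ)) = id := by
    ext p <;> simp [shift]
  rw [this, Measure.map_id]

end VacationQueue

namespace VacationQueue

open Set
open scoped ENNReal

/-! ### The jump chain -/

/-- The rates of the arrivals, of the services and of the vacations. -/
structure Rates where
  lam : ℝ
  mu : ℝ
  v : ℝ
  lam_pos : 0 < lam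
  mu_pos : 0 < mu
  v_pos : 0 < v

/-- The mode of the system: on vacation with an empty buffer (`idle`) or with a packet in the buffer
(`loaded`), in service without (`serving`) or with (`disturbed`) an arrival since the start of the
service. -/
inductive Mode where
  | idle
  | loaded
  | serving
  | disturbed

instance : MeasurableSpace Mode := ⊤

instance : DiscreteMeasurableSpace Mode := ⟨fun _ => trivial⟩

instance : Countable Mode := by
  refine ⟨fun m => match m with | .idle => 0 | .loaded => 1 | .serving => 2 | .disturbed => 3, ?_⟩
  rintro (_ | _ | _ | _) (_ | _ | _ | _) h <;> simp_all

/-- The current time, the generation times of the packets in the server and in the buffer, the time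
of the last completion and the generation time of the packet completed then. -/
abbrev Label := ℝ × ℝ × ℝ × ℝ × ℝ

/-- The observable state of the system. -/
abbrev Obs := Mode × Label

/-- Unused inter-generation times, service times and vacation times. -/
abbrev Streams := (ℕ → ℝ) × (ℕ → ℝ) × (ℕ → ℝ)

/-- The residual time to the next arrival, the residual time of the current phase, and the unused
primitives. -/
abbrev Clock := ℝ × ℝ × Streams

namespace Mode

/-- The rate at which the current phase ends. -/
def rate (ρ : Rates) : Mode → ℝ
  | idle | loaded => ρ.v
  | serving | disturbed => ρ.mu

/-- The mode after an arrival. -/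
def arr : Mode → Mode
  | idle | loaded => loaded
  | serving | disturbed => disturbed

/-- The mode after the end of a phase. -/
def next (π : Policy) : Mode → Mode
  | idle | serving => idle
  | loaded => serving
  | disturbed => match π with
    | .brs => loaded
    | _ => idle

theorem rate_pos (ρ : Rates) (m : Mode) : 0 < m.rate ρ := by
  cases m <;> simp [rate, ρ.v_pos, ρ.mu_pos]

@[simp] theorem rate_arr (ρ : Rates) (m : Mode) : m.arr.rate ρ = m.rate ρ := by
  cases m <;> rfl

end Mode

/-- The state after an arrival, a time `h` after the last event. -/
def Obs.arr (π : Policy) (s : Obs) (h : ℝ) : Obs :=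
  match s, π with
  | (.idle, n, gs, _, y), _ => (.loaded, n + h, gs, n + h, y)
  | (.loaded, n, gs, _, y), _ => (.loaded, n + h, gs, n + h, y)
  | (.serving, n, gs, gb, y), .cbs => (.disturbed, n + h, gs, gb, y)
  | (.disturbed, n, gs, gb, y), .cbs => (.disturbed, n + h, gs, gb, y)
  | (.serving, n, gs, _, y), .brs => (.disturbed, n + h, gs, n + h, y)
  | (.disturbed, n, gs, _, y), .brs => (.disturbed, n + h, gs, n + h, y)
  | (.serving, n, _, gb, y), .cbsp => (.disturbed, n + h, n + h, gb, y)
  | (.disturbed, n, _, gb, y), .cbsp => (.disturbed, n + h, n + h, gb, y)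

/-- The state after the end of a phase, a time `h` after the last event. -/
def Obs.next (π : Policy) (s : Obs) (h : ℝ) : Obs :=
  match s with
  | (.idle, n, gs, gb, y) => (.idle, n + h, gs, gb, y)
  | (.loaded, n, _, gb, y) => (.serving, n + h, gb, gb, y)
  | (.serving, n, gs, gb, _) => (.idle, n + h, gs, gb, n + h, gs)
  | (.disturbed, n, gs, gb, _) => (Mode.disturbed.next π, n + h, gs, gb, n + h, gs)

@[simp] theorem Obs.arr_fst (π : Policy) (s : Obs) (h : ℝ) : (s.arr π h).1 = s.1.arr := by
  obtain ⟨_ | _ | _ | _, _⟩ := s <;> cases π <;> rfl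

@[simp] theorem Obs.next_fst (π : Policy) (s : Obs) (h : ℝ) : (s.next π h).1 = s.1.next π := by
  obtain ⟨_ | _ | _ | _, _⟩ := s <;> rfl

namespace Streams

/-- Take the next inter-generation time. -/
def pullT (x : Streams) : ℝ × Streams := (x.1 0, shift x.1, x.2)

/-- Take the next service time. -/
def pullH (x : Streams) : ℝ × Streams := (x.2.1 0, x.1, shift x.2.1, x.2.2)

/-- Take the next vacation time. -/
def pullV (x : Streams) : ℝ × Streams := (x.2.2 0, x.1, x.2.1, shift x.2.2)

end Streams

/-- The clock after an arrival, if `d` is the residual time of the phase. -/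
def arrClock (π : Policy) (m : Mode) (d : ℝ) (x : Streams) : Clock :=
  match m, π with
  | .idle, _ => (x.pullT.1, d, x.pullT.2)
  -- The head of the stream of service times is reserved for the packet in the buffer. Here that
  -- packet is displaced, so its service time is discarded and the next one becomes the head.
  -- Likewise a rejected packet takes its service time with it.
  | .loaded, _ => (x.pullT.1, d, x.pullT.2.pullH.2)
  | .serving, .brs => (x.pullT.1, d, x.pullT.2)
  | .disturbed, .brs => (x.pullT.1, d, x.pullT.2.pullH.2)
  | _, .cbs => (x.pullT.1, d, x.pullT.2.pullH.2)
  | _, .cbsp => (x.pullT.1, x.pullT.2.pullH)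

/-- The clock after the end of a phase, if `d` is the residual time to the next arrival. -/
def nextClock (m : Mode) (d : ℝ) (x : Streams) : Clock :=
  match m with
  | .loaded => (d, x.pullH)
  | _ => (d, x.pullV)

/-- The transition to the next event. -/
noncomputable def jump (π : Policy) (c : Obs × Clock) : Obs × Clock :=
  if c.2.1 < c.2.2.1 then (c.1.arr π c.2.1, arrClock π c.1.1 (c.2.2.1 - c.2.1) c.2.2.2)
  else (c.1.next π c.2.2.1, nextClock c.1.1 (c.2.1 - c.2.2.1) c.2.2.2)

section Measurability

theorem Obs.measurable_arr (π : Policy) : Measurable fun p : Obs × ℝ => p.1.arr π p.2 := by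
  have : Measurable fun p : Mode × (Label × ℝ) => Obs.arr π (p.1, p.2.1) p.2.2 := by
    refine measurable_from_prod_countable_right fun m => ?_
    cases m <;> cases π <;> simp only [Obs.arr] <;> fun_prop
  exact this.comp (g := fun p : Mode × (Label × ℝ) => Obs.arr π (p.1, p.2.1) p.2.2)
    (f := fun p : Obs × ℝ => (p.1.1, p.1.2, p.2)) (by fun_prop)

theorem Obs.measurable_next (π : Policy) : Measurable fun p : Obs × ℝ => p.1.next π p.2 := by
  have : Measurable fun p : Mode × (Label × ℝ) => Obs.next π (p.1, p.2.1) p.2.2 := by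
    refine measurable_from_prod_countable_right fun m => ?_
    cases m <;> simp only [Obs.next] <;> fun_prop
  exact this.comp (g := fun p : Mode × (Label × ℝ) => Obs.next π (p.1, p.2.1) p.2.2)
    (f := fun p : Obs × ℝ => (p.1.1, p.1.2, p.2)) (by fun_prop)

@[fun_prop]
theorem Obs.measurable_arr' {α : Type*} [MeasurableSpace α] (π : Policy) {f : α → Obs} {g : α → ℝ}
    (hf : Measurable f) (hg : Measurable g) : Measurable fun x => (f x).arr π (g x) :=
  (Obs.measurable_arr π).comp (hf.prodMk hg)

@[fun_prop]
theorem Obs.measurable_next' {α : Type*} [MeasurableSpace α] (π : Policy) {f : α → Obs} {g : α → ℝ}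
    (hf : Measurable f) (hg : Measurable g) : Measurable fun x => (f x).next π (g x) :=
  (Obs.measurable_next π).comp (hf.prodMk hg)

attribute [fun_prop] measurable_shift

@[fun_prop]
theorem Streams.measurable_pullH : Measurable Streams.pullH := by
  unfold Streams.pullH; fun_prop

@[fun_prop]
theorem Streams.measurable_pullV : Measurable Streams.pullV := by
  unfold Streams.pullV; fun_prop

theorem measurable_arrClock (π : Policy) (m : Mode) :
    Measurable fun p : ℝ × Streams => arrClock π m p.1 p.2 := by
  cases m <;> cases π <;> simp only [arrClock] <;> fun_prop

theorem measurable_nextClock (m : Mode) :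
    Measurable fun p : ℝ × Streams => nextClock m p.1 p.2 := by
  cases m <;> simp only [nextClock] <;> fun_prop

theorem measurable_jump (π : Policy) : Measurable (jump π) := by
  unfold jump
  have h1 : Measurable fun c : Obs × Clock => arrClock π c.1.1 (c.2.2.1 - c.2.1) c.2.2.2 := by
    have : Measurable fun p : Mode × (ℝ × Streams) => arrClock π p.1 p.2.1 p.2.2 :=
      measurable_from_prod_countable_right fun m => measurable_arrClock π m
    exact this.comp (f := fun c : Obs × Clock => (c.1.1, c.2.2.1 - c.2.1, c.2.2.2))
      (by fun_prop)
  have h2 : Measurable fun c : Obs × Clock => nextClock c.1.1 (c.2.1 - c.2.2.1) c.2.2.2 := by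
    have : Measurable fun p : Mode × (ℝ × Streams) => nextClock p.1 p.2.1 p.2.2 :=
      measurable_from_prod_countable_right fun m => measurable_nextClock m
    exact this.comp (f := fun c : Obs × Clock => (c.1.1, c.2.1 - c.2.2.1, c.2.2.2))
      (by fun_prop)
  exact Measurable.ite (measurableSet_lt (by fun_prop) (by fun_prop))
    (Measurable.prodMk (by fun_prop) h1) (Measurable.prodMk (by fun_prop) h2)

end Measurability

/-! ### Laws of the clocks and the one-step Markov property. -/

section Laws

variable (ρ : Rates)

instance : IsProbabilityMeasure (expMeasure ρ.lam) := isProbabilityMeasure_expMeasure ρ.lam_pos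
instance : IsProbabilityMeasure (expMeasure ρ.mu) := isProbabilityMeasure_expMeasure ρ.mu_pos
instance : IsProbabilityMeasure (expMeasure ρ.v) := isProbabilityMeasure_expMeasure ρ.v_pos
instance : IsProbabilityMeasure (expSeq ρ.lam) := isProbabilityMeasure_expSeq ρ.lam_pos
instance : IsProbabilityMeasure (expSeq ρ.mu) := isProbabilityMeasure_expSeq ρ.mu_pos
instance : IsProbabilityMeasure (expSeq ρ.v) := isProbabilityMeasure_expSeq ρ.v_pos

instance (m : Mode) : IsProbabilityMeasure (expMeasure (m.rate ρ)) :=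
  isProbabilityMeasure_expMeasure (m.rate_pos ρ)

theorem Mode.add_rate_pos (m : Mode) : 0 < ρ.lam + m.rate ρ :=
  add_pos ρ.lam_pos (m.rate_pos ρ)

instance (m : Mode) : IsProbabilityMeasure (expMeasure (ρ.lam + m.rate ρ)) :=
  isProbabilityMeasure_expMeasure (m.add_rate_pos ρ)

/-- The law of the unused primitives. -/
noncomputable def streamLaw : Measure Streams :=
  (expSeq ρ.lam).prod ((expSeq ρ.mu).prod (expSeq ρ.v))

instance : IsProbabilityMeasure (streamLaw ρ) := by unfold streamLaw; infer_instance

/-- The law of the clock in mode `m`. -/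
noncomputable def clockLaw (m : Mode) : Measure Clock :=
  (expMeasure ρ.lam).prod ((expMeasure (m.rate ρ)).prod (streamLaw ρ))

instance (m : Mode) : IsProbabilityMeasure (clockLaw ρ m) := by unfold clockLaw; infer_instance

theorem measurePreserving_rotate {α β γ : Type*} [MeasurableSpace α] [MeasurableSpace β]
    [MeasurableSpace γ] (μa : Measure α) (μb : Measure β) (μc : Measure γ) [SFinite μa] [SFinite μb]
    [SFinite μc] :
    MeasurePreserving (fun p : α × β × γ => (p.2.1, p.1, p.2.2)) (μa.prod (μb.prod μc))
      (μb.prod (μa.prod μc)) := by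
  have h1 := (measurePreserving_prodAssoc μa μb μc).symm
  have h2 := (Measure.measurePreserving_swap (μ := μa) (ν := μb)).prod (MeasurePreserving.id μc)
  have h3 := measurePreserving_prodAssoc μb μa μc
  exact h3.comp (h2.comp h1)

theorem measurePreserving_pullT :
    MeasurePreserving Streams.pullT (streamLaw ρ) ((expMeasure ρ.lam).prod (streamLaw ρ)) :=
  (measurePreserving_prodAssoc _ _ _).comp
    ((measurePreserving_head_shift ρ.lam_pos).prod (MeasurePreserving.id _))

theorem measurePreserving_pullH :
    MeasurePreserving Streams.pullH (streamLaw ρ) ((expMeasure ρ.mu).prod (streamLaw ρ)) := by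
  have h1 := (measurePreserving_prodAssoc (expMeasure ρ.mu) (expSeq ρ.mu) (expSeq ρ.v)).comp
    ((measurePreserving_head_shift ρ.mu_pos).prod (MeasurePreserving.id (expSeq ρ.v)))
  exact (measurePreserving_rotate _ _ _).comp ((MeasurePreserving.id (expSeq ρ.lam)).prod h1)

theorem measurePreserving_pullV :
    MeasurePreserving Streams.pullV (streamLaw ρ) ((expMeasure ρ.v).prod (streamLaw ρ)) := by
  have h1 := (measurePreserving_rotate (expSeq ρ.mu) (expMeasure ρ.v) (expSeq ρ.v)).comp
    ((MeasurePreserving.id (expSeq ρ.mu)).prod (measurePreserving_head_shift ρ.v_pos))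
  exact (measurePreserving_rotate _ _ _).comp ((MeasurePreserving.id (expSeq ρ.lam)).prod h1)

/-- The residual phase is independent of the streams, and removing the head of an i.i.d. stream does
not change its law. With preemption the residual phase is replaced by a fresh service time of the
same rate. -/
theorem measurePreserving_arrClock (π : Policy) (m : Mode) :
    MeasurePreserving (fun p : ℝ × Streams => arrClock π m p.1 p.2)
      ((expMeasure (m.rate ρ)).prod (streamLaw ρ)) (clockLaw ρ m.arr) := by
  have keep : ∀ r : ℝ, SFinite (expMeasure r) →
      MeasurePreserving (fun p : ℝ × Streams => ((p.2.pullT.1, p.1, p.2.pullT.2) : Clock))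
      ((expMeasure r).prod (streamLaw ρ))
      ((expMeasure ρ.lam).prod ((expMeasure r).prod (streamLaw ρ))) := fun r _ =>
    (measurePreserving_rotate _ _ _).comp
      ((MeasurePreserving.id (expMeasure r)).prod (measurePreserving_pullT ρ))
  have dropH : MeasurePreserving (fun x : Streams => x.pullH.2) (streamLaw ρ) (streamLaw ρ) :=
    measurePreserving_snd.comp (measurePreserving_pullH ρ)
  have drop : ∀ r : ℝ, SFinite (expMeasure r) →
      MeasurePreserving (fun p : ℝ × Streams => ((p.2.pullT.1, p.1, p.2.pullT.2.pullH.2) : Clock))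
      ((expMeasure r).prod (streamLaw ρ))
      ((expMeasure ρ.lam).prod ((expMeasure r).prod (streamLaw ρ))) := fun r h =>
    ((MeasurePreserving.id (expMeasure ρ.lam)).prod
      ((MeasurePreserving.id (expMeasure r)).prod dropH)).comp (keep r h)
  have pre : MeasurePreserving (fun p : ℝ × Streams => ((p.2.pullT.1, p.2.pullT.2.pullH) : Clock))
      ((expMeasure ρ.mu).prod (streamLaw ρ))
      ((expMeasure ρ.lam).prod ((expMeasure ρ.mu).prod (streamLaw ρ))) :=
    ((MeasurePreserving.id (expMeasure ρ.lam)).prod (measurePreserving_pullH ρ)).comp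
      ((measurePreserving_pullT ρ).comp measurePreserving_snd)
  cases m <;> cases π
  case serving.cbsp => exact pre
  case disturbed.cbsp => exact pre
  case idle.cbs => exact keep _ inferInstance
  case idle.brs => exact keep _ inferInstance
  case idle.cbsp => exact keep _ inferInstance
  case serving.brs => exact keep _ inferInstance
  all_goals exact drop _ inferInstance

theorem measurePreserving_nextClock (π : Policy) (m : Mode) :
    MeasurePreserving (fun p : ℝ × Streams => nextClock m p.1 p.2)
      ((expMeasure ρ.lam).prod (streamLaw ρ)) (clockLaw ρ (m.next π)) := by
  have vac : MeasurePreserving (fun p : ℝ × Streams => ((p.1, p.2.pullV) : Clock))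
      ((expMeasure ρ.lam).prod (streamLaw ρ))
      ((expMeasure ρ.lam).prod ((expMeasure ρ.v).prod (streamLaw ρ))) :=
    (MeasurePreserving.id (expMeasure ρ.lam)).prod (measurePreserving_pullV ρ)
  have srv : MeasurePreserving (fun p : ℝ × Streams => ((p.1, p.2.pullH) : Clock))
      ((expMeasure ρ.lam).prod (streamLaw ρ))
      ((expMeasure ρ.lam).prod ((expMeasure ρ.mu).prod (streamLaw ρ))) :=
    (MeasurePreserving.id (expMeasure ρ.lam)).prod (measurePreserving_pullH ρ)
  cases m
  case loaded => exact srv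
  case disturbed => cases π <;> exact vac
  all_goals exact vac

/-- The expectation of a functional of the chain with a fresh clock, started from `s`. -/
noncomputable def J (f : Obs × Clock → ℝ≥0∞) (s : Obs) : ℝ≥0∞ := ∫⁻ e, f (s, e) ∂clockLaw ρ s.1

theorem measurable_J {f : Obs × Clock → ℝ≥0∞} (hf : Measurable f) : Measurable (J ρ f) := by
  have : ∀ m, Measurable fun x : Label => ∫⁻ e, f ((m, x), e) ∂clockLaw ρ m := fun m =>
    Measurable.lintegral_prod_right' (f := fun p : Label × Clock => f ((m, p.1), p.2))
      (hf.comp (by fun_prop))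
  exact measurable_from_prod_countable_right (f := J ρ f) this

/-- The transition operator of the observable chain. -/
noncomputable def K (π : Policy) (w : Obs → ℝ≥0∞) (s : Obs) : ℝ≥0∞ :=
  ∫⁻ h, (ENNReal.ofReal (ρ.lam / (ρ.lam + s.1.rate ρ)) * w (s.arr π h) +
    ENNReal.ofReal (s.1.rate ρ / (ρ.lam + s.1.rate ρ)) * w (s.next π h))
      ∂expMeasure (ρ.lam + s.1.rate ρ)

/-- The strong Markov property at the first event. -/
theorem J_jump (π : Policy) {f : Obs × Clock → ℝ≥0∞} (hf : Measurable f) (s : Obs) :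
    J ρ (fun c => f (jump π c)) s = K ρ π (J ρ f) s := by
  have hfj : Measurable fun c => f (jump π c) := hf.comp (measurable_jump π)
  set r := s.1.rate ρ with hr
  have hr0 : 0 < r := s.1.rate_pos ρ
  have hΦ : Measurable (Function.uncurry fun a q : ℝ =>
      ∫⁻ x, f (jump π (s, a, q, x)) ∂streamLaw ρ) :=
    Measurable.lintegral_prod_right'
      (f := fun p : (ℝ × ℝ) × Streams => f (jump π (s, p.1.1, p.1.2, p.2)))
      (hfj.comp (by fun_prop))
  have h1 : J ρ (fun c => f (jump π c)) s =
      ∫⁻ a, ∫⁻ q, ∫⁻ x, f (jump π (s, a, q, x)) ∂streamLaw ρ ∂expMeasure r ∂expMeasure ρ.lam := by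
    have m1 : Measurable fun e : Clock => f (jump π (s, e)) := hfj.comp measurable_prodMk_left
    rw [J, clockLaw, lintegral_prod _ m1.aemeasurable]
    refine lintegral_congr fun a => ?_
    have m2 : Measurable fun e : ℝ × Streams => f (jump π (s, a, e)) :=
      m1.comp measurable_prodMk_left
    rw [lintegral_prod _ m2.aemeasurable]
  rw [h1, lintegral_race ρ.lam_pos hr0 hΦ, K]
  refine lintegral_congr fun h => ?_
  have ha : ∫⁻ y, ∫⁻ x, f (jump π (s, h, h + y, x)) ∂streamLaw ρ ∂expMeasure r =
      J ρ f (s.arr π h) := by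
    have : ∫⁻ y, ∫⁻ x, f (jump π (s, h, h + y, x)) ∂streamLaw ρ ∂expMeasure r =
        ∫⁻ y, ∫⁻ x, f (s.arr π h, arrClock π s.1 y x) ∂streamLaw ρ ∂expMeasure r := by
      -- The leftover `y` is almost surely positive, so `jump` takes the branch of an arrival.
      refine lintegral_congr_ae ?_
      filter_upwards [ae_expMeasure_pos r] with y hy
      refine lintegral_congr fun x => ?_
      simp [jump, hy]
    have m1 : Measurable fun e : Clock => f (s.arr π h, e) := hf.comp measurable_prodMk_left
    rw [this, J, Obs.arr_fst, ← (measurePreserving_arrClock ρ π s.1).lintegral_comp m1,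
      lintegral_prod]
    exact (hf.comp ((measurable_const).prodMk (measurable_arrClock π s.1))).aemeasurable
  have hb : ∫⁻ y, ∫⁻ x, f (jump π (s, h + y, h, x)) ∂streamLaw ρ ∂expMeasure ρ.lam =
      J ρ f (s.next π h) := by
    have : ∫⁻ y, ∫⁻ x, f (jump π (s, h + y, h, x)) ∂streamLaw ρ ∂expMeasure ρ.lam =
        ∫⁻ y, ∫⁻ x, f (s.next π h, nextClock s.1 y x) ∂streamLaw ρ ∂expMeasure ρ.lam := by
      refine lintegral_congr_ae ?_
      filter_upwards [ae_expMeasure_pos ρ.lam] with y hy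
      refine lintegral_congr fun x => ?_
      simp [jump, not_lt.2 hy.le]
    have m1 : Measurable fun e : Clock => f (s.next π h, e) := hf.comp measurable_prodMk_left
    rw [this, J, Obs.next_fst, ← (measurePreserving_nextClock ρ π s.1).lintegral_comp m1,
      lintegral_prod]
    exact (hf.comp ((measurable_const).prodMk (measurable_nextClock s.1))).aemeasurable
  rw [ha, hb]

end Laws

end VacationQueue

namespace VacationQueue

open Set
open scoped ENNReal

/-! ### A whole phase described by its length and its last arrival. -/

section Phase

variable (ρ : Rates) (π : Policy)

/-- Within a phase an arrival overwrites what the previous one has written, so only the time of the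
last arrival matters. -/
theorem Obs.arr_arr {s : Obs} (hs : s.1 ≠ .idle) (h k : ℝ) :
    (s.arr π h).arr π k = s.arr π (h + k) := by
  obtain ⟨m, n, gs, gb, y⟩ := s
  cases m <;> cases π <;> first | exact absurd rfl hs | simp [Obs.arr, add_assoc]

/-- A vacation that ends with an empty buffer leaves no trace but the elapsed time. -/
theorem Obs.next_arr {s : Obs} (hs : s.1 = .idle) (h k : ℝ) :
    (s.next π h).arr π k = s.arr π (h + k) := by
  obtain ⟨m, n, gs, gb, y⟩ := s
  subst hs
  cases π <;> simp [Obs.arr, Obs.next, add_assoc]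

/-- The state after a phase of length `R`, if the last arrival before its end occurs a time `E`
before the end, provided `E < R`. -/
noncomputable def Obs.phase (s : Obs) (p : ℝ × ℝ) : Obs :=
  if p.2 < p.1 then (s.arr π (p.1 - p.2)).next π p.2 else s.next π p.1

theorem Obs.measurable_phase : Measurable fun p : Obs × ℝ × ℝ => p.1.phase π p.2 := by
  unfold Obs.phase
  exact Measurable.ite (measurableSet_lt (by fun_prop) (by fun_prop)) (by fun_prop) (by fun_prop)

@[fun_prop]
theorem Obs.measurable_phase' {α : Type*} [MeasurableSpace α] {f : α → Obs} {g : α → ℝ × ℝ}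
    (hf : Measurable f) (hg : Measurable g) : Measurable fun x => (f x).phase π (g x) :=
  (Obs.measurable_phase π).comp (hf.prodMk hg)

theorem ofReal_race_add {a b : ℝ} (ha : 0 < a) (hb : 0 < b) :
    ENNReal.ofReal (a / (a + b)) + ENNReal.ofReal (b / (a + b)) = 1 := by
  rw [← ENNReal.ofReal_add (by positivity) (by positivity), ← add_div, div_self (by positivity),
    ENNReal.ofReal_one]

/-- The clock that rings first after several attempts has its original law. -/
theorem lintegral_race_right {a b : ℝ} (ha : 0 < a) (hb : 0 < b) {f : ℝ → ℝ≥0∞}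
    (hf : Measurable f) :
    ∫⁻ h, (ENNReal.ofReal (a / (a + b)) * ∫⁻ y, f (h + y) ∂expMeasure b +
        ENNReal.ofReal (b / (a + b)) * f h) ∂expMeasure (a + b) = ∫⁻ y, f y ∂expMeasure b := by
  have := isProbabilityMeasure_expMeasure ha
  have h := lintegral_race ha hb (Φ := fun _ y => f y) (hf.comp measurable_snd)
  simp only [lintegral_const, measure_univ, mul_one] at h
  exact h.symm

theorem lintegral_race_left {a b : ℝ} (ha : 0 < a) (hb : 0 < b) {f : ℝ → ℝ≥0∞}
    (hf : Measurable f) :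
    ∫⁻ h, (ENNReal.ofReal (a / (a + b)) * f h +
        ENNReal.ofReal (b / (a + b)) * ∫⁻ y, f (h + y) ∂expMeasure a) ∂expMeasure (a + b) =
      ∫⁻ y, f y ∂expMeasure a := by
  have := isProbabilityMeasure_expMeasure hb
  have h := lintegral_race ha hb (Φ := fun x _ => f x) (hf.comp measurable_fst)
  simp only [lintegral_const, measure_univ, mul_one] at h
  exact h.symm

/-- The race is run backwards from the end of the phase: if the arrival clock `E` wins at `h`, the
last arrival lies `h` before the end and is preceded by a fresh exponential time `y`; otherwise the
phase has no arrival and length `h`. -/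
theorem lintegral_phase (s : Obs) {ψ : Obs → ℝ≥0∞} (hψ : Measurable ψ) :
    ∫⁻ p, ψ (s.phase π p) ∂(expMeasure (s.1.rate ρ)).prod (expMeasure ρ.lam) =
      ∫⁻ h, (ENNReal.ofReal (ρ.lam / (ρ.lam + s.1.rate ρ)) *
          ∫⁻ y, ψ ((s.arr π y).next π h) ∂expMeasure (s.1.rate ρ) +
        ENNReal.ofReal (s.1.rate ρ / (ρ.lam + s.1.rate ρ)) * ψ (s.next π h))
          ∂expMeasure (ρ.lam + s.1.rate ρ) := by
  have hm : Measurable fun p : ℝ × ℝ => ψ (s.phase π p) := hψ.comp (by fun_prop)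
  have hm2 : Measurable fun p : ℝ × ℝ => ψ (s.phase π (p.2, p.1)) := hψ.comp (by fun_prop)
  rw [lintegral_prod_symm _ hm.aemeasurable,
    lintegral_race ρ.lam_pos (s.1.rate_pos ρ) (Φ := fun E R => ψ (s.phase π (R, E))) hm2]
  refine lintegral_congr fun h => ?_
  congr 2
  · refine lintegral_congr_ae ?_
    filter_upwards [ae_expMeasure_pos (s.1.rate ρ)] with y hy
    simp [Obs.phase, hy]
  · have : ∫⁻ x, ψ (s.phase π (h, h + x)) ∂expMeasure ρ.lam =
        ∫⁻ _, ψ (s.next π h) ∂expMeasure ρ.lam := by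
      refine lintegral_congr_ae ?_
      filter_upwards [ae_expMeasure_pos ρ.lam] with x hx
      simp [Obs.phase, not_lt.2 hx.le]
    rw [this, lintegral_const, measure_univ, mul_one]

/-- First-step equation for the description by length and last arrival. After the first arrival the
phase starts again, and by `Obs.arr_arr` only the sum of the time to the first arrival and the time
from it to the last one is seen. For a fixed distance `x` of the last arrival from the end,
`lintegral_race_right` identifies the law of this sum as exponential of the rate of the phase. -/
theorem lintegral_phase_step {s : Obs} (hs : s.1 ≠ .idle) {ψ : Obs → ℝ≥0∞} (hψ : Measurable ψ) :
    ∫⁻ h, (ENNReal.ofReal (ρ.lam / (ρ.lam + s.1.rate ρ)) *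
          ∫⁻ p, ψ ((s.arr π h).phase π p) ∂(expMeasure (s.1.rate ρ)).prod (expMeasure ρ.lam) +
        ENNReal.ofReal (s.1.rate ρ / (ρ.lam + s.1.rate ρ)) * ψ (s.next π h))
          ∂expMeasure (ρ.lam + s.1.rate ρ) =
    ∫⁻ p, ψ (s.phase π p) ∂(expMeasure (s.1.rate ρ)).prod (expMeasure ρ.lam) := by
  set r := s.1.rate ρ with hr
  have hr0 : 0 < r := s.1.rate_pos ρ
  set pa := ENNReal.ofReal (ρ.lam / (ρ.lam + r))
  set pe := ENNReal.ofReal (r / (ρ.lam + r))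
  have : IsProbabilityMeasure (expMeasure (ρ.lam + r)) :=
    isProbabilityMeasure_expMeasure (add_pos ρ.lam_pos hr0)
  have : IsProbabilityMeasure (expMeasure r) := isProbabilityMeasure_expMeasure hr0
  let k : ℝ → ℝ → ℝ≥0∞ := fun x y => ψ ((s.arr π x).next π y)
  have hk : Measurable fun p : ℝ × ℝ => k p.1 p.2 := hψ.comp (by fun_prop)
  have h1 : ∀ h, ∫⁻ p, ψ ((s.arr π h).phase π p) ∂(expMeasure r).prod (expMeasure ρ.lam) =
      ∫⁻ x, (pa * ∫⁻ y, k (h + y) x ∂expMeasure r + pe * k h x) ∂expMeasure (ρ.lam + r) := by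
    intro h
    have := lintegral_phase ρ π (s.arr π h) hψ
    simp only [Obs.arr_fst, Mode.rate_arr, Obs.arr_arr π hs] at this
    exact this
  have mk1 : Measurable fun p : ℝ × ℝ => ∫⁻ y, k (p.1 + y) p.2 ∂expMeasure r :=
    Measurable.lintegral_prod_right' (f := fun q : (ℝ × ℝ) × ℝ => k (q.1.1 + q.2) q.1.2)
      (hk.comp (f := fun q : (ℝ × ℝ) × ℝ => (q.1.1 + q.2, q.1.2)) (by fun_prop))
  have mk2 : Measurable fun h => pe * ψ (s.next π h) :=
    (hψ.comp (by fun_prop : Measurable fun h => s.next π h)).const_mul _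
  have mk3 : Measurable (Function.uncurry fun h x =>
      pa * ∫⁻ y, k (h + y) x ∂expMeasure r + pe * k h x) :=
    (mk1.const_mul _).add (hk.const_mul _)
  rw [lintegral_phase ρ π s hψ]
  simp only [h1]
  rw [lintegral_add_right _ mk2, lintegral_add_right _ mk2]
  congr 1
  have mk4 : Measurable fun h => ∫⁻ y, k y h ∂expMeasure r :=
    Measurable.lintegral_prod_right' (f := fun q : ℝ × ℝ => k q.2 q.1)
      (hk.comp measurable_swap)
  have mk5 : Measurable fun h => ∫⁻ x, (pa * ∫⁻ y, k (h + y) x ∂expMeasure r + pe * k h x)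
      ∂expMeasure (ρ.lam + r) := mk3.lintegral_prod_right'
  refine (lintegral_const_mul pa mk5).trans (Eq.trans ?_ (lintegral_const_mul pa mk4).symm)
  rw [lintegral_lintegral_swap mk3.aemeasurable]
  congr 1
  refine lintegral_congr fun x => ?_
  exact lintegral_race_right ρ.lam_pos hr0 (f := fun z => k z x)
    (hk.comp (f := fun z => (z, x)) (by fun_prop))

end Phase

/-! ### Expectations at the next start of a service. -/

section Cycle

variable (ρ : Rates) (π : Policy)

/-- The state at the end of the vacations, if `X` is the time to the next arrival (needed when the
buffer is empty) and the rest of the last vacation is described by `p`. -/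
noncomputable def Obs.vacation (s : Obs) (x : ℝ × ℝ × ℝ) : Obs :=
  match s.1 with
  | .idle => (s.arr π x.1).phase π x.2
  | _ => s.phase π x.2

/-- The law of the variables that govern the vacations between two services. -/
noncomputable def vacLaw : Measure (ℝ × ℝ × ℝ) :=
  (expMeasure ρ.lam).prod ((expMeasure ρ.v).prod (expMeasure ρ.lam))

/-- The law of the variables that govern a service. -/
noncomputable def srvLaw : Measure (ℝ × ℝ) := (expMeasure ρ.mu).prod (expMeasure ρ.lam)

instance : IsProbabilityMeasure (vacLaw ρ) := by unfold vacLaw; infer_instance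
instance : IsProbabilityMeasure (srvLaw ρ) := by unfold srvLaw; infer_instance

theorem Obs.measurable_vacation :
    Measurable fun p : Obs × ℝ × ℝ × ℝ => p.1.vacation π p.2 := by
  have : Measurable fun p : Mode × (Label × ℝ × ℝ × ℝ) =>
      Obs.vacation π (p.1, p.2.1) p.2.2 := by
    refine measurable_from_prod_countable_right fun m => ?_
    cases m <;> simp only [Obs.vacation] <;> fun_prop
  exact this.comp (f := fun p : Obs × ℝ × ℝ × ℝ => (p.1.1, p.1.2, p.2)) (by fun_prop)

@[fun_prop]
theorem Obs.measurable_vacation' {α : Type*} [MeasurableSpace α] {f : α → Obs}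
    {g : α → ℝ × ℝ × ℝ} (hf : Measurable f) (hg : Measurable g) :
    Measurable fun x => (f x).vacation π (g x) :=
  (Obs.measurable_vacation π).comp (hf.prodMk hg)

/-- The expectation of `ψ` at the next start of a service, from the vacations. -/
noncomputable def vacExp (ψ : Obs → ℝ≥0∞) (s : Obs) : ℝ≥0∞ :=
  ∫⁻ x, ψ (s.vacation π x) ∂vacLaw ρ

/-- The expectation of `ψ` at the next start of a service. -/
noncomputable def startExp (ψ : Obs → ℝ≥0∞) (s : Obs) : ℝ≥0∞ :=
  match s.1 with
  | .idle | .loaded => vacExp ρ π ψ s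
  | .serving | .disturbed => ∫⁻ p, vacExp ρ π ψ (s.phase π p) ∂srvLaw ρ

theorem measurable_vacExp {ψ : Obs → ℝ≥0∞} (hψ : Measurable ψ) : Measurable (vacExp ρ π ψ) :=
  Measurable.lintegral_prod_right' (f := fun p : Obs × ℝ × ℝ × ℝ => ψ (p.1.vacation π p.2))
    (hψ.comp (by fun_prop))

theorem vacExp_loaded {ψ : Obs → ℝ≥0∞} (hψ : Measurable ψ) {s : Obs} (hs : s.1 = .loaded) :
    vacExp ρ π ψ s =
      ∫⁻ p, ψ (s.phase π p) ∂(expMeasure ρ.v).prod (expMeasure ρ.lam) := by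
  have hv : ∀ x, s.vacation π x = s.phase π x.2 := fun x => by simp [Obs.vacation, hs]
  have hm : Measurable fun x : ℝ × ℝ × ℝ => ψ (s.phase π x.2) := hψ.comp (by fun_prop)
  simp only [vacExp, hv, vacLaw]
  rw [lintegral_prod _ hm.aemeasurable]
  simp

theorem vacExp_idle {ψ : Obs → ℝ≥0∞} (hψ : Measurable ψ) {s : Obs} (hs : s.1 = .idle) :
    vacExp ρ π ψ s = ∫⁻ x, vacExp ρ π ψ (s.arr π x) ∂expMeasure ρ.lam := by
  have hv : ∀ x, s.vacation π x = (s.arr π x.1).phase π x.2 := fun x => by simp [Obs.vacation, hs]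
  have hm : Measurable fun x : ℝ × ℝ × ℝ => ψ ((s.arr π x.1).phase π x.2) :=
    hψ.comp (by fun_prop)
  rw [vacExp]
  simp only [hv, vacLaw]
  rw [lintegral_prod _ hm.aemeasurable]
  refine lintegral_congr fun x => ?_
  rw [vacExp_loaded ρ π hψ (by simp [hs, Mode.arr])]

open Classical in
/-- `startExp` is harmonic for the chain stopped at the starts of services. -/
theorem K_startExp {ψ : Obs → ℝ≥0∞} (hψ : Measurable ψ) (s : Obs) :
    K ρ π (fun s => if s.1 = .serving then ψ s else startExp ρ π ψ s) s =
      startExp ρ π ψ s := by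
  obtain ⟨m, x⟩ := s
  have hv := measurable_vacExp ρ π hψ
  cases m
  case idle =>
    have h1 : ∀ h, (Obs.arr π (.idle, x) h).1 = .loaded := fun h => by simp [Mode.arr]
    have h2 : ∀ h, (Obs.next π (.idle, x) h).1 = .idle := fun h => by simp [Mode.next]
    simp only [K, startExp, h1, h2, reduceCtorEq, if_false]
    rw [vacExp_idle ρ π hψ (s := (.idle, x)) rfl]
    have hm : Measurable fun h => vacExp ρ π ψ (Obs.arr π (.idle, x) h) := hv.comp (by fun_prop)
    rw [← lintegral_race_left ρ.lam_pos ρ.v_pos hm]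
    refine lintegral_congr fun h => ?_
    rw [vacExp_idle ρ π hψ (h2 h)]
    simp only [Obs.next_arr π (s := (.idle, x)) rfl]
    rfl
  case loaded =>
    have h1 : ∀ h, (Obs.arr π (.loaded, x) h).1 = .loaded := fun h => by simp [Mode.arr]
    have h2 : ∀ h, (Obs.next π (.loaded, x) h).1 = .serving := fun h => by simp [Mode.next]
    simp only [K, startExp, h1, h2, reduceCtorEq, if_false, if_true]
    rw [vacExp_loaded ρ π hψ (s := (.loaded, x)) rfl]
    refine Eq.trans ?_ (lintegral_phase_step ρ π (s := (.loaded, x)) (by simp) hψ)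
    refine lintegral_congr fun h => ?_
    rw [vacExp_loaded ρ π hψ (h1 h)]
    rfl
  case serving =>
    have h1 : ∀ h, (Obs.arr π (.serving, x) h).1 = .disturbed := fun h => by simp [Mode.arr]
    have h2 : ∀ h, (Obs.next π (.serving, x) h).1 = .idle := fun h => by simp [Mode.next]
    simp only [K, startExp, h1, h2, reduceCtorEq, if_false]
    exact lintegral_phase_step ρ π (s := (.serving, x)) (by simp) hv
  case disturbed =>
    have h1 : ∀ h, (Obs.arr π (.disturbed, x) h).1 = .disturbed := fun h => by simp [Mode.arr]
    -- Whether the policy leads to an idle or to a loaded vacation, `startExp` is `vacExp` there,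
    -- and no service starts at once.
    have h2 : ∀ h, (if (Obs.next π (.disturbed, x) h).1 = .serving
        then ψ (Obs.next π (.disturbed, x) h) else startExp ρ π ψ (Obs.next π (.disturbed, x) h)) =
        vacExp ρ π ψ (Obs.next π (.disturbed, x) h) := fun h => by
      cases π <;> simp [Obs.next, Mode.next, startExp]
    simp only [K, h2]
    simp only [startExp, h1, reduceCtorEq, if_false]
    exact lintegral_phase_step ρ π (s := (.disturbed, x)) (by simp) hv

theorem startExp_add {ψ φ : Obs → ℝ≥0∞} (hψ : Measurable ψ) (s : Obs) :
    startExp ρ π (fun s => ψ s + φ s) s = startExp ρ π ψ s + startExp ρ π φ s := by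
  have hv : ∀ s, vacExp ρ π (fun s => ψ s + φ s) s = vacExp ρ π ψ s + vacExp ρ π φ s := fun s =>
    lintegral_add_left (hψ.comp (by fun_prop)) _
  have hm := measurable_vacExp ρ π hψ
  unfold startExp
  split <;> simp only [hv]
  · exact lintegral_add_left (hm.comp (by fun_prop)) _
  · exact lintegral_add_left (hm.comp (by fun_prop)) _

theorem startExp_const (c : ℝ≥0∞) (s : Obs) : startExp ρ π (fun _ => c) s = c := by
  unfold startExp vacExp
  split <;> simp

theorem K_mono {w z : Obs → ℝ≥0∞} (h : ∀ s, w s ≤ z s) (s : Obs) : K ρ π w s ≤ K ρ π z s :=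
  lintegral_mono fun _ => add_le_add (mul_le_mul_right (h _) _) (mul_le_mul_right (h _) _)

/-- Lower bounds on `w` after an arrival and after the end of a phase, uniform in the holding time,
combine with the two jump probabilities. -/
theorem le_K {w : Obs → ℝ≥0∞} {s : Obs} {a b : ℝ≥0∞} (ha : ∀ h, a ≤ w (s.arr π h))
    (hb : ∀ h, b ≤ w (s.next π h)) :
    ENNReal.ofReal (ρ.lam / (ρ.lam + s.1.rate ρ)) * a +
      ENNReal.ofReal (s.1.rate ρ / (ρ.lam + s.1.rate ρ)) * b ≤ K ρ π w s := by
  have : ∫⁻ _, (ENNReal.ofReal (ρ.lam / (ρ.lam + s.1.rate ρ)) * a +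
      ENNReal.ofReal (s.1.rate ρ / (ρ.lam + s.1.rate ρ)) * b)
      ∂expMeasure (ρ.lam + s.1.rate ρ) ≤ K ρ π w s :=
    lintegral_mono fun h => add_le_add (mul_le_mul_right (ha h) _) (mul_le_mul_right (hb h) _)
  simpa using this

end Cycle

end VacationQueue

namespace VacationQueue

open Set
open scoped ENNReal

/-! ### The strong Markov property at the starts of services. -/

section Hitting

variable (ρ : Rates) (π : Policy)

/-- The state after `n` events. -/
noncomputable def path (c : Obs × Clock) (n : ℕ) : Obs × Clock := (jump π)^[n] c

theorem path_succ (c : Obs × Clock) (n : ℕ) : path π c (n + 1) = path π (jump π c) n := rfl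

theorem path_succ' (c : Obs × Clock) (n : ℕ) : path π c (n + 1) = jump π (path π c n) :=
  Function.iterate_succ_apply' _ _ _

theorem measurable_path (n : ℕ) : Measurable fun c => path π c n := (measurable_jump π).iterate n

/-- A service starts after the initial time. -/
def Starts (c : Obs × Clock) : Prop := ∃ n, (path π c (n + 1)).1.1 = .serving

theorem measurableSet_serving : MeasurableSet {c : Obs × Clock | c.1.1 = .serving} :=
  (measurable_fst.comp measurable_fst) (measurableSet_singleton Mode.serving)

theorem measurableSet_path_serving (n : ℕ) :
    MeasurableSet {c : Obs × Clock | (path π c n).1.1 = .serving} :=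
  (measurable_path π n) measurableSet_serving

theorem measurableSet_starts : MeasurableSet {c | Starts π c} := by
  have : {c | Starts π c} = ⋃ n, {c | (path π c (n + 1)).1.1 = .serving} := by
    ext c; simp [Starts]
  rw [this]
  exact MeasurableSet.iUnion fun n => measurableSet_path_serving π (n + 1)

/-- The second alternative makes the search total: if no service ever starts, it stops at `0` and
`startIndex` has the default value `1`. -/
theorem exists_start (c : Obs × Clock) :
    ∃ n, (path π c (n + 1)).1.1 = .serving ∨ ¬ Starts π c := by
  by_cases h : Starts π c
  · obtain ⟨n, hn⟩ := h
    exact ⟨n, Or.inl hn⟩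
  · exact ⟨0, Or.inr h⟩

open Classical in
/-- The number of events up to the first start of a service. -/
noncomputable def startIndex (c : Obs × Clock) : ℕ := Nat.find (exists_start π c) + 1

/-- The state at the first start of a service after the initial time. -/
noncomputable def start (c : Obs × Clock) : Obs × Clock := path π c (startIndex π c)

theorem measurable_start : Measurable (start π) := by
  classical
  refine Measurable.find (f := fun n c => path π c (n + 1))
    (p := fun n c => (path π c (n + 1)).1.1 = .serving ∨ ¬ Starts π c)
    (fun n => measurable_path π (n + 1)) (fun n => ?_) (exists_start π)
  exact (measurableSet_path_serving π (n + 1)).union (measurableSet_starts π).compl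

theorem start_serving {c : Obs × Clock} (h : Starts π c) : (start π c).1.1 = .serving := by
  classical
  exact (Nat.find_spec (exists_start π c)).resolve_right (not_not.2 h)

theorem not_serving_of_lt_startIndex {c : Obs × Clock} {n : ℕ} (h0 : 0 < n)
    (hn : n < startIndex π c) : (path π c n).1.1 ≠ .serving := by
  classical
  obtain ⟨n, rfl⟩ := Nat.exists_eq_succ_of_ne_zero h0.ne'
  have := Nat.find_min (exists_start π c) (Nat.lt_of_succ_lt_succ hn)
  exact fun h => this (Or.inl h)

theorem starts_iff (c : Obs × Clock) :
    Starts π c ↔ (jump π c).1.1 = .serving ∨ Starts π (jump π c) := by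
  constructor
  · rintro ⟨n, hn⟩
    cases n with
    | zero => exact Or.inl hn
    | succ n => exact Or.inr ⟨n, hn⟩
  · rintro (h | ⟨n, hn⟩)
    · exact ⟨0, h⟩
    · exact ⟨n + 1, hn⟩

theorem start_of_serving {c : Obs × Clock} (h : (jump π c).1.1 = .serving) :
    start π c = jump π c := by
  classical
  have : Nat.find (exists_start π c) = 0 := (Nat.find_eq_zero _).2 (Or.inl h)
  rw [start, startIndex, this]
  rfl

theorem start_of_not_serving {c : Obs × Clock} (h : (jump π c).1.1 ≠ .serving)
    (hs : Starts π c) : start π c = start π (jump π c) := by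
  classical
  have hs' : Starts π (jump π c) := ((starts_iff π c).1 hs).resolve_left h
  have h0 : ¬ ((path π c (0 + 1)).1.1 = .serving ∨ ¬ Starts π c) := by
    rintro (h' | h')
    exacts [h h', h' hs]
  have hc : ∃ n, (path π c (n + 1 + 1)).1.1 = .serving ∨ ¬ Starts π c := by
    obtain ⟨n, hn⟩ := hs'
    exact ⟨n, Or.inl hn⟩
  have key : Nat.find (exists_start π c) = Nat.find (exists_start π (jump π c)) + 1 := by
    rw [Nat.find_comp_succ (exists_start π c) hc h0]
    congr 1
    refine Nat.find_congr' fun {n} => ?_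
    simp only [hs, hs', not_true_eq_false, or_false]
    rfl
  rw [start, start, startIndex, startIndex, key]
  rfl

open Classical in
/-- `f` at the first start of a service if this is reached within `n` events, and `0` otherwise. -/
noncomputable def startWithin (f : Obs × Clock → ℝ≥0∞) : ℕ → Obs × Clock → ℝ≥0∞
  | 0, _ => 0
  | n + 1, c => if (jump π c).1.1 = .serving then f (jump π c) else startWithin f n (jump π c)

theorem measurable_startWithin {f : Obs × Clock → ℝ≥0∞} (hf : Measurable f) (n : ℕ) :
    Measurable (startWithin π f n) := by
  classical
  induction n with
  | zero => exact measurable_const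
  | succ n ih =>
    exact Measurable.ite ((measurable_jump π) measurableSet_serving)
      (hf.comp (measurable_jump π)) (ih.comp (measurable_jump π))

theorem startWithin_of_not_starts (f : Obs × Clock → ℝ≥0∞) (n : ℕ) {c : Obs × Clock}
    (h : ¬ Starts π c) : startWithin π f n c = 0 := by
  induction n generalizing c with
  | zero => rfl
  | succ n ih =>
    rw [starts_iff, not_or] at h
    rw [startWithin, if_neg h.1, ih h.2]

/-- The truncated functional jumps once, when the horizon passes the time of the first start. This
gives both its monotonicity and its supremum. -/
theorem startWithin_eq (f : Obs × Clock → ℝ≥0∞) {c : Obs × Clock} (h : Starts π c) :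
    ∃ k, ∀ n, startWithin π f n c = if k < n then f (start π c) else 0 := by
  obtain ⟨n, hn⟩ := h
  induction n generalizing c with
  | zero =>
    refine ⟨0, fun n => ?_⟩
    cases n with
    | zero => rfl
    | succ n =>
      have hn' : (jump π c).1.1 = .serving := hn
      simp [startWithin, hn', start_of_serving π hn']
  | succ n ih =>
    by_cases hc : (jump π c).1.1 = .serving
    · refine ⟨0, fun n => ?_⟩
      cases n with
      | zero => rfl
      | succ n => simp [startWithin, hc, start_of_serving π hc]
    · obtain ⟨k, hk⟩ := ih (c := jump π c) hn
      refine ⟨k + 1, fun n => ?_⟩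
      cases n with
      | zero => rfl
      | succ n =>
        rw [startWithin, if_neg hc, hk, start_of_not_serving π hc ⟨_, hn⟩]
        simp

open Classical in
theorem iSup_startWithin (f : Obs × Clock → ℝ≥0∞) (c : Obs × Clock) :
    ⨆ n, startWithin π f n c = if Starts π c then f (start π c) else 0 := by
  split_ifs with h
  · obtain ⟨k, hk⟩ := startWithin_eq π f h
    refine le_antisymm (iSup_le fun n => ?_) ?_
    · rw [hk]; split_ifs <;> simp
    · refine le_iSup_of_le (k + 1) ?_
      rw [hk, if_pos k.lt_succ_self]
  · simp [startWithin_of_not_starts π f _ h]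

theorem monotone_startWithin (f : Obs × Clock → ℝ≥0∞) : Monotone (startWithin π f) := by
  intro m n hmn c
  by_cases h : Starts π c
  · obtain ⟨k, hk⟩ := startWithin_eq π f h
    rw [hk, hk]
    split_ifs with h1 h2
    · exact le_rfl
    · exact absurd (h1.trans_le hmn) h2
    · exact zero_le
    · exact le_rfl
  · simp [startWithin_of_not_starts π f _ h]

open Classical in
theorem J_ite_serving (f g : Obs × Clock → ℝ≥0∞) (s : Obs) :
    J ρ (fun c => if c.1.1 = .serving then f c else g c) s =
      if s.1 = .serving then J ρ f s else J ρ g s := by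
  unfold J
  split_ifs with h <;> simp [h]

/-- Induction on the horizon: one step of the chain is the operator `K`, and `startExp` is a fixed
point of the stopped recursion by `K_startExp`. -/
theorem J_startWithin_le {f : Obs × Clock → ℝ≥0∞} (hf : Measurable f) (n : ℕ) (s : Obs) :
    J ρ (startWithin π f n) s ≤ startExp ρ π (J ρ f) s := by
  classical
  induction n generalizing s with
  | zero => simp [J, startWithin]
  | succ n ih =>
    have hm : Measurable fun c : Obs × Clock =>
        if c.1.1 = .serving then f c else startWithin π f n c :=
      Measurable.ite measurableSet_serving hf (measurable_startWithin π hf n)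
    have h1 := J_jump ρ π hm s
    change J ρ (startWithin π f (n + 1)) s = _ at h1
    rw [h1, ← K_startExp ρ π (measurable_J ρ hf)]
    refine K_mono ρ π (fun t => ?_) s
    rw [J_ite_serving]
    split_ifs
    · exact le_rfl
    · exact ih t

open Classical in
-- Monotone convergence as the horizon grows. Only the inequality is available here, since the
-- recursion may have larger fixed points as long as a start is not known to be certain.
theorem J_start_le {f : Obs × Clock → ℝ≥0∞} (hf : Measurable f) (s : Obs) :
    J ρ (fun c => if Starts π c then f (start π c) else 0) s ≤ startExp ρ π (J ρ f) s := by
  have : J ρ (fun c => if Starts π c then f (start π c) else 0) s =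
      ⨆ n, J ρ (startWithin π f n) s := by
    unfold J
    rw [← lintegral_iSup]
    · simp only [iSup_startWithin]
    · exact fun n => (measurable_startWithin π hf n).comp measurable_prodMk_left
    · exact fun m n hmn e => monotone_startWithin π f hmn _
  rw [this]
  exact iSup_le fun n => J_startWithin_le ρ π hf n s

open Classical in
/-- The probability that a service starts. -/
noncomputable def startProb (s : Obs) : ℝ≥0∞ :=
  J ρ (fun c => if Starts π c then 1 else 0) s

theorem startProb_le_one (s : Obs) : startProb ρ π s ≤ 1 := by
  classical
  calc startProb ρ π s ≤ ∫⁻ _, 1 ∂clockLaw ρ s.1 :=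
        lintegral_mono fun e => by dsimp only; split_ifs <;> simp
    _ = 1 := by simp

open Classical in
theorem startProb_eq (s : Obs) :
    startProb ρ π s = K ρ π (fun s => if s.1 = .serving then 1 else startProb ρ π s) s := by
  have hm : Measurable fun c : Obs × Clock =>
      if c.1.1 = .serving then (1 : ℝ≥0∞) else if Starts π c then 1 else 0 :=
    Measurable.ite measurableSet_serving measurable_const
      (Measurable.ite (measurableSet_starts π) measurable_const measurable_const)
  have h1 := J_jump ρ π hm s
  have h2 : J ρ (fun c => if (jump π c).1.1 = .serving then (1 : ℝ≥0∞)
      else if Starts π (jump π c) then 1 else 0) s = startProb ρ π s := by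
    unfold startProb
    congr 1
    ext c
    by_cases h : (jump π c).1.1 = .serving <;> simp [starts_iff π c, h]
  rw [← h2, h1]
  congr 1
  ext t
  rw [J_ite_serving]
  simp [J, startProb]

/-- Since the two coefficients add up to `1`, the inequality reduces to `q ≤ q * x` with `q > 0`;
finiteness of `x` allows the cancellation. -/
theorem one_le_of_race {a b : ℝ} (ha : 0 < a) (hb : 0 < b) {x : ℝ≥0∞} (hx : x ≤ 1)
    (h : ENNReal.ofReal (a / (a + b)) * x + ENNReal.ofReal (b / (a + b)) ≤ x) : 1 ≤ x := by
  have hx' : x ≠ ∞ := (hx.trans_lt ENNReal.one_lt_top).ne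
  have h1 := ofReal_race_add ha hb
  set p := ENNReal.ofReal (a / (a + b))
  set q := ENNReal.ofReal (b / (a + b)) with hq
  have hq0 : q ≠ 0 := by
    rw [hq, Ne, ENNReal.ofReal_eq_zero, not_le]; positivity
  have h2 : p * x + q ≤ p * x + q * x := by rwa [← add_mul, h1, one_mul]
  have h3 : q ≤ q * x := (ENNReal.add_le_add_iff_left
    (ENNReal.mul_ne_top ENNReal.ofReal_ne_top hx')).1 h2
  rwa [← ENNReal.mul_le_mul_iff_right hq0 ENNReal.ofReal_ne_top, mul_one]

/-- The infimum over all labels satisfies the inequality of `one_le_of_race`: an arrival leads back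
to a loaded state and the end of the phase starts a service. Working with the infimum avoids showing
that the probability does not depend on the labels. -/
theorem one_le_startProb_loaded {s : Obs} (hs : s.1 = .loaded) : 1 ≤ startProb ρ π s := by
  classical
  have : 1 ≤ ⨅ x : Label, startProb ρ π (.loaded, x) := by
    refine one_le_of_race ρ.lam_pos ρ.v_pos ((iInf_le _ 0).trans (startProb_le_one ρ π _))
      (le_iInf fun x => ?_)
    have h := le_K ρ π (w := fun s => if s.1 = .serving then 1 else startProb ρ π s)
      (s := (.loaded, x)) (a := ⨅ x : Label, startProb ρ π (.loaded, x)) (b := 1)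
      (fun h => by
        rw [if_neg (by simp [Mode.arr])]
        exact iInf_le _ _)
      (fun h => by rw [if_pos (by simp [Mode.next])])
    rwa [← startProb_eq, mul_one] at h
  obtain ⟨m, x⟩ := s
  subst hs
  exact this.trans (iInf_le _ x)

theorem one_le_startProb_idle {s : Obs} (hs : s.1 = .idle) : 1 ≤ startProb ρ π s := by
  classical
  have : 1 ≤ ⨅ x : Label, startProb ρ π (.idle, x) := by
    refine one_le_of_race ρ.v_pos ρ.lam_pos ((iInf_le _ 0).trans (startProb_le_one ρ π _))
      (le_iInf fun x => ?_)
    have h := le_K ρ π (w := fun s => if s.1 = .serving then 1 else startProb ρ π s)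
      (s := (.idle, x)) (a := 1) (b := ⨅ x : Label, startProb ρ π (.idle, x))
      (fun h => by
        rw [if_neg (by simp [Mode.arr])]
        exact one_le_startProb_loaded ρ π (by simp [Mode.arr]))
      (fun h => by
        rw [if_neg (by simp [Mode.next])]
        exact iInf_le _ _)
    rw [← startProb_eq, mul_one, add_comm, add_comm ρ.lam] at h
    exact h
  obtain ⟨m, x⟩ := s
  subst hs
  exact this.trans (iInf_le _ x)

theorem one_le_startProb_disturbed {s : Obs} (hs : s.1 = .disturbed) :
    1 ≤ startProb ρ π s := by
  classical
  have : 1 ≤ ⨅ x : Label, startProb ρ π (.disturbed, x) := by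
    refine one_le_of_race ρ.lam_pos ρ.mu_pos ((iInf_le _ 0).trans (startProb_le_one ρ π _))
      (le_iInf fun x => ?_)
    have h := le_K ρ π (w := fun s => if s.1 = .serving then 1 else startProb ρ π s)
      (s := (.disturbed, x)) (a := ⨅ x : Label, startProb ρ π (.disturbed, x)) (b := 1)
      (fun h => by
        have e : Obs.arr π (.disturbed, x) h = (.disturbed, (Obs.arr π (.disturbed, x) h).2) :=
          Prod.ext (by simp [Mode.arr]) rfl
        rw [if_neg (by simp [Mode.arr]), e]
        exact iInf_le (fun x : Label => startProb ρ π (.disturbed, x)) _)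
      (fun h => by
        rw [if_neg (by cases π <;> simp [Mode.next])]
        have hn : (Obs.next π (.disturbed, x) h).1 = .idle ∨
            (Obs.next π (.disturbed, x) h).1 = .loaded := by
          cases π <;> simp [Mode.next]
        exact hn.elim (one_le_startProb_idle ρ π) (one_le_startProb_loaded ρ π))
    rwa [← startProb_eq, mul_one] at h
  obtain ⟨m, x⟩ := s
  subst hs
  exact this.trans (iInf_le _ x)

theorem startProb_eq_one (s : Obs) : startProb ρ π s = 1 := by
  classical
  refine le_antisymm (startProb_le_one ρ π s) ?_
  obtain ⟨m, x⟩ := s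
  cases m
  · exact one_le_startProb_idle ρ π rfl
  · exact one_le_startProb_loaded ρ π rfl
  · have h := le_K ρ π (w := fun s => if s.1 = .serving then 1 else startProb ρ π s)
      (s := (.serving, x)) (a := 1) (b := 1)
      (fun h => by
        rw [if_neg (by simp [Mode.arr])]
        exact one_le_startProb_disturbed ρ π (by simp [Mode.arr]))
      (fun h => by
        rw [if_neg (by simp [Mode.next])]
        exact one_le_startProb_idle ρ π (by simp [Mode.next]))
    rwa [← startProb_eq, mul_one, mul_one,
      ofReal_race_add ρ.lam_pos (Mode.rate_pos ρ _)] at h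
  · exact one_le_startProb_disturbed ρ π rfl

theorem ae_starts (s : Obs) : ∀ᵐ e ∂clockLaw ρ s.1, Starts π (s, e) := by
  classical
  have h := startProb_eq_one ρ π s
  have hm : MeasurableSet {e | Starts π (s, e)} :=
    measurable_prodMk_left (measurableSet_starts π)
  have h2 : startProb ρ π s = clockLaw ρ s.1 {e | Starts π (s, e)} := by
    rw [← lintegral_indicator_one hm]
    rfl
  rw [h2] at h
  rwa [← prob_compl_eq_zero_iff hm] at h

/-- The strong Markov property at the first start of a service. -/
theorem J_start {f : Obs × Clock → ℝ≥0∞} (hf : Measurable f) (hf1 : ∀ c, f c ≤ 1) (s : Obs) :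
    J ρ (fun c => f (start π c)) s = startExp ρ π (J ρ f) s := by
  classical
  -- The upper bound `J_start_le` is applied to `f` and to `1 - f`. Both the left and the right
  -- sides add up to `1`, because a start is almost sure, so both inequalities are equalities.
  let g : Obs × Clock → ℝ≥0∞ := fun c => 1 - f c
  have hg : Measurable g := measurable_const.sub hf
  have hfg : ∀ c, f c + g c = 1 := fun c => add_tsub_cancel_of_le (hf1 c)
  have hrep : ∀ φ : Obs × Clock → ℝ≥0∞, J ρ (fun c => φ (start π c)) s =
      J ρ (fun c => if Starts π c then φ (start π c) else 0) s := by
    intro φ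
    refine lintegral_congr_ae ?_
    filter_upwards [ae_starts ρ π s] with e he
    rw [if_pos he]
  have h1 : J ρ (fun c => f (start π c)) s ≤ startExp ρ π (J ρ f) s :=
    (hrep f).trans_le (J_start_le ρ π hf s)
  have h2 : J ρ (fun c => g (start π c)) s ≤ startExp ρ π (J ρ g) s :=
    (hrep g).trans_le (J_start_le ρ π hg s)
  have hf' : Measurable fun e => f (start π (s, e)) :=
    hf.comp ((measurable_start π).comp measurable_prodMk_left)
  have h3 : J ρ (fun c => f (start π c)) s + J ρ (fun c => g (start π c)) s = 1 := by
    unfold J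
    rw [← lintegral_add_left hf']
    simp [hfg]
  have h4 : startExp ρ π (J ρ f) s + startExp ρ π (J ρ g) s = 1 := by
    rw [← startExp_add ρ π (measurable_J ρ hf)]
    have : ∀ t, J ρ f t + J ρ g t = 1 := fun t => by
      have hft : Measurable fun e => f (t, e) := hf.comp measurable_prodMk_left
      unfold J
      rw [← lintegral_add_left hft]
      simp [hfg]
    simp only [this, startExp_const]
  refine le_antisymm h1 ?_
  have hfin : J ρ (fun c => g (start π c)) s ≠ ∞ := by
    intro h
    rw [h, add_top] at h3
    exact ENNReal.top_ne_one h3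
  refine (ENNReal.add_le_add_iff_right hfin).1 ?_
  rw [h3, ← h4]
  gcongr

end Hitting

end VacationQueue

namespace VacationQueue

open Set
open scoped ENNReal

/-! ### The chain describes the system of the statement. -/

section Correspondence

variable (π : Policy)

/-- The current time. -/
abbrev Obs.now (s : Obs) : ℝ := s.2.1

/-- The generation time of the packet in service. -/
abbrev Obs.inService (s : Obs) : ℝ := s.2.2.1

/-- The generation time of the packet in the buffer. -/
abbrev Obs.inBuffer (s : Obs) : ℝ := s.2.2.2.1

/-- The time of the last completion. -/
abbrev Obs.lastCompl (s : Obs) : ℝ := s.2.2.2.2.1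

/-- The generation time of the packet completed last. -/
abbrev Obs.lastGen (s : Obs) : ℝ := s.2.2.2.2.2

attribute [local simp] Obs.now Obs.inService Obs.inBuffer Obs.lastCompl Obs.lastGen

/-- The state of the chain that corresponds to the initial state of the system. -/
def initObs (a₀ : ℝ) : Obs := (.idle, 0, -a₀, -a₀, 0, -a₀)

/-- The clock that corresponds to the initial state of the system. -/
def initClock (T H V : ℕ → ℝ) : Clock := (T 0, V 0, shift T, H, shift V)

/-- The stream `x` of service times belongs to the packets that can still be served: the packet in
the buffer, if any, and the packets from number `n` on. -/
def ServiceTimes (H : ℕ → ℝ) (n : ℕ) (b : Option ℕ) (x : ℕ → ℝ) : Prop :=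
  match b with
  | none => ∀ k, x k = H (n + k)
  | some m => x 0 = H m ∧ ∀ k, x (k + 1) = H (n + k)

/-- The state of the chain describes the state of the system. -/
structure Describes (T H V : ℕ → ℝ) (σ : State) (c : Obs × Clock) : Prop where
  arrival : c.2.1 = genTime T σ.nextPacket - c.1.now
  phase : c.2.2.1 = σ.phaseEnd - c.1.now
  streamT : ∀ k, c.2.2.2.1 k = T (σ.nextPacket + 1 + k)
  streamH : ServiceTimes H σ.nextPacket σ.buffer c.2.2.2.2.1
  streamV : ∀ k, c.2.2.2.2.2 k = V (σ.nextVacation + k)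
  mode : match c.1.1, π with
    | .idle, _ => σ.server = none ∧ σ.buffer = none
    | .loaded, _ => σ.server = none ∧ ∃ m, σ.buffer = some m ∧ c.1.inBuffer = genTime T m
    | .serving, _ => σ.buffer = none ∧ ∃ n, σ.server = some n ∧ c.1.inService = genTime T n
    | .disturbed, .brs => (∃ n, σ.server = some n ∧ c.1.inService = genTime T n) ∧
        ∃ m, σ.buffer = some m ∧ c.1.inBuffer = genTime T m
    | .disturbed, _ => σ.buffer = none ∧ ∃ n, σ.server = some n ∧ c.1.inService = genTime T n

theorem genTime_succ (T : ℕ → ℝ) (n : ℕ) : genTime T (n + 1) = genTime T n + T (n + 1) := by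
  simp [genTime, Finset.sum_range_succ]

theorem describes_init (T H V : ℕ → ℝ) (a₀ : ℝ) :
    Describes π T H V (State.init V) (initObs a₀, initClock T H V) where
  arrival := by simp [initObs, initClock, State.init, genTime]
  phase := by simp [initObs, initClock, State.init]
  streamT k := by simp [initClock, State.init, shift, add_comm]
  streamH := by simp [initClock, State.init, ServiceTimes]
  streamV k := by simp [initClock, State.init, shift, add_comm]
  mode := by simp [initObs, State.init]

variable {π} {T H V : ℕ → ℝ} {σ : State} {c : Obs × Clock}

theorem Describes.arrivalNext_iff (h : Describes π T H V σ c) :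
    σ.ArrivalNext T ↔ c.2.1 < c.2.2.1 := by
  rw [h.arrival, h.phase, State.ArrivalNext, sub_lt_sub_iff_right]

/-- The following four facts cover the possible changes: packet `n` never enters the buffer (it is
rejected or served at once), it displaces the packet in the buffer, it enters the empty buffer, or
the packet in the buffer goes into service. -/
theorem ServiceTimes.drop_none {n : ℕ} {x : ℕ → ℝ} (h : ServiceTimes H n none x) :
    ServiceTimes H (n + 1) none (shift x) := fun k => by
  rw [shift, h]; congr 1; omega

theorem ServiceTimes.drop_some {n m : ℕ} {x : ℕ → ℝ} (h : ServiceTimes H n (some m) x) :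
    ServiceTimes H (n + 1) (some n) (shift x) :=
  ⟨by simpa [shift] using h.2 0, fun k => by rw [shift, h.2]; congr 1; omega⟩

theorem ServiceTimes.fill {n : ℕ} {x : ℕ → ℝ} (h : ServiceTimes H n none x) :
    ServiceTimes H (n + 1) (some n) x :=
  ⟨by simpa using h 0, fun k => by rw [h]; congr 1; omega⟩

theorem ServiceTimes.take {n m : ℕ} {x : ℕ → ℝ} (h : ServiceTimes H n (some m) x) :
    ServiceTimes H n none (shift x) := fun k => h.2 k

/-- A check of all modes and policies. The two branches of `jump` match those of `State.step`
because both clocks of the chain are measured from the same current time. -/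
theorem Describes.step (h : Describes π T H V σ c) :
    Describes π T H V (σ.step π T H V) (jump π c) := by
  classical
  obtain ⟨np, nv, srv, buf, pe⟩ := σ
  obtain ⟨⟨m, n, gs, gb, C, r⟩, a, q, xT, xH, xV⟩ := c
  have harr := h.arrivalNext_iff
  obtain ⟨ha, hq, hT, hH, hV, hm⟩ := h
  simp only [Obs.now] at ha hq
  simp only at hT hH hV harr
  have hTs : ∀ k, shift xT k = T (np + 1 + 1 + k) := fun k => by
    rw [shift, hT]; congr 1; omega
  have hVs : ∀ k, shift xV k = V (nv + 1 + k) := fun k => by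
    rw [shift, hV]; congr 1; omega
  have hT0 : xT 0 = genTime T (np + 1) - (n + a) := by
    rw [hT, genTime_succ, ha]; simp
  have hV0 : xV 0 = (pe + V nv) - (n + q) := by
    rw [hV, hq]; simp
  have hnow : genTime T np = n + a := by rw [ha]; ring
  have hpe : pe = n + q := by rw [hq]; ring
  by_cases hlt : a < q
  · have hstep : State.step π T H V ⟨np, nv, srv, buf, pe⟩ =
        State.onArrival π T H ⟨np, nv, srv, buf, pe⟩ := if_pos (harr.2 hlt)
    rw [hstep]
    simp only [jump, hlt, if_true]
    cases m
    case idle =>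
      obtain ⟨rfl, rfl⟩ := hm
      refine ⟨?_, ?_, ?_, ?_, ?_, ?_⟩ <;>
        simp [State.onArrival, Obs.arr, arrClock, Streams.pullT, hT0, hTs, hV, hnow, hpe, hH.fill]
    case loaded =>
      obtain ⟨rfl, k, rfl, -⟩ := hm
      refine ⟨?_, ?_, ?_, ?_, ?_, ?_⟩ <;>
        simp [State.onArrival, Obs.arr, arrClock, Streams.pullT, Streams.pullH, hT0, hTs, hV, hnow,
          hpe, hH.drop_some]
    case serving =>
      obtain ⟨rfl, k, rfl, hk⟩ := hm
      dsimp only [Obs.inService, Obs.inBuffer] at hk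
      have hH0 := hH 0
      simp only [add_zero] at hH0
      cases π <;> refine ⟨?_, ?_, ?_, ?_, ?_, ?_⟩ <;>
        simp [State.onArrival, Obs.arr, arrClock, Streams.pullT, Streams.pullH, hT0, hTs, hV, hnow,
          hpe, hH.fill, hH.drop_none, hk, hH0]
    case disturbed =>
      cases π
      case brs =>
        obtain ⟨⟨k, rfl, hk⟩, l, rfl, hl⟩ := hm
        dsimp only [Obs.inService, Obs.inBuffer] at hk
        refine ⟨?_, ?_, ?_, ?_, ?_, ?_⟩ <;>
        simp [State.onArrival, Obs.arr, arrClock, Streams.pullT, Streams.pullH, hT0, hTs, hV, hnow,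
          hpe, hH.drop_some, hk]
      all_goals
        obtain ⟨rfl, k, rfl, hk⟩ := hm
        dsimp only [Obs.inService, Obs.inBuffer] at hk
        have hH0 := hH 0
        simp only [add_zero] at hH0
        refine ⟨?_, ?_, ?_, ?_, ?_, ?_⟩ <;>
          simp [State.onArrival, Obs.arr, arrClock, Streams.pullT, Streams.pullH, hT0, hTs, hV,
            hnow, hpe, hH.drop_none, hk, hH0]
  · have hstep : State.step π T H V ⟨np, nv, srv, buf, pe⟩ =
        State.onPhaseEnd H V ⟨np, nv, srv, buf, pe⟩ := if_neg fun h => hlt (harr.1 h)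
    rw [hstep]
    simp only [jump, hlt, if_false]
    have haq : a - q = genTime T np - (n + q) := by rw [ha]; ring
    cases m
    case idle =>
      obtain ⟨rfl, rfl⟩ := hm
      refine ⟨?_, ?_, ?_, ?_, ?_, ?_⟩ <;>
        simp [State.onPhaseEnd, Obs.next, nextClock, Streams.pullV, hT, hVs, hV0, hpe, haq, hH]
    case loaded =>
      obtain ⟨rfl, k, rfl, hk⟩ := hm
      dsimp only [Obs.inService, Obs.inBuffer] at hk
      refine ⟨?_, ?_, ?_, ?_, ?_, ?_⟩ <;>
        simp [State.onPhaseEnd, Obs.next, nextClock, Streams.pullH, hT, hV, hpe, haq, hH.take,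
          hH.1, hk]
    case serving =>
      obtain ⟨rfl, k, rfl, hk⟩ := hm
      refine ⟨?_, ?_, ?_, ?_, ?_, ?_⟩ <;>
        simp [State.onPhaseEnd, Obs.next, nextClock, Streams.pullV, hT, hVs, hV0, hpe, haq, hH]
    case disturbed =>
      cases π
      case brs =>
        obtain ⟨⟨k, rfl, hk⟩, l, rfl, hl⟩ := hm
        dsimp only [Obs.inService, Obs.inBuffer] at hl
        refine ⟨?_, ?_, ?_, ?_, ?_, ?_⟩ <;>
        simp [State.onPhaseEnd, Obs.next, Mode.next, nextClock, Streams.pullV, hT, hVs, hV0, hpe,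
          haq, hH, hl]
      all_goals
        obtain ⟨rfl, k, rfl, hk⟩ := hm
        refine ⟨?_, ?_, ?_, ?_, ?_, ?_⟩ <;>
          simp [State.onPhaseEnd, Obs.next, Mode.next, nextClock, Streams.pullV, hT, hVs, hV0, hpe,
            haq, hH]

variable (π T H V)

theorem describes_stateAt (a₀ : ℝ) (j : ℕ) :
    Describes π T H V (stateAt π T H V j) (path π (initObs a₀, initClock T H V) j) := by
  induction j with
  | zero => exact describes_init π T H V a₀
  | succ j ih =>
    rw [path_succ', stateAt, Function.iterate_succ_apply']
    exact ih.step

/-- The mode is a service mode: `1`, otherwise `0`. -/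
def Mode.busy : Mode → ℕ
  | .idle | .loaded => 0
  | .serving | .disturbed => 1

/-- The next event is a completion. -/
def Completes (c : Obs × Clock) : Prop := ¬ c.2.1 < c.2.2.1 ∧ c.1.1.busy = 1

theorem isCompletion_iff (a₀ : ℝ) (j : ℕ) :
    IsCompletion π T H V j ↔ Completes (path π (initObs a₀, initClock T H V) j) := by
  have h := describes_stateAt π T H V a₀ j
  rw [IsCompletion, Completes, h.arrivalNext_iff]
  refine and_congr_right fun _ => ?_
  have hm := h.mode
  generalize path π (initObs a₀, initClock T H V) j = c at hm ⊢
  generalize stateAt π T H V j = σ at hm ⊢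
  obtain ⟨⟨m, x⟩, y⟩ := c
  cases m
  case idle => simp [hm.1, Mode.busy]
  case loaded => simp [hm.1, Mode.busy]
  case serving => obtain ⟨-, n, hn, -⟩ := hm; simp [hn, Mode.busy]
  case disturbed =>
    cases π
    case brs => obtain ⟨⟨n, hn, -⟩, -⟩ := hm; simp [hn, Mode.busy]
    all_goals obtain ⟨-, n, hn, -⟩ := hm; simp [hn, Mode.busy]

open Classical in
/-- The labels of the chain record the last completion. -/
theorem path_last (a₀ : ℝ) (j : ℕ) :
    (path π (initObs a₀, initClock T H V) j).1.lastCompl =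
        complTime π T H V (Nat.count (IsCompletion π T H V) j) ∧
      (path π (initObs a₀, initClock T H V) j).1.lastGen =
        informGenTime π a₀ T H V (Nat.count (IsCompletion π T H V) j) := by
  induction j with
  | zero => simp [path, complTime, informGenTime, initObs]
  | succ j ih =>
    have hd := describes_stateAt π T H V a₀ j
    have hc := isCompletion_iff π T H V a₀ j
    rw [path_succ', Nat.count_succ]
    by_cases h : IsCompletion π T H V j
    · rw [if_pos h]
      simp only [complTime, informGenTime, Nat.nth_count h]
      have hph := hd.phase
      have hm := hd.mode
      obtain ⟨h1, h2⟩ := hc.1 h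
      generalize path π (initObs a₀, initClock T H V) j = c at hm hph h1 h2 ⊢
      generalize stateAt π T H V j = σ at hm hph ⊢
      obtain ⟨⟨m, n, gs, gb, C, r⟩, a, q, x⟩ := c
      simp only at h1 hph
      have hpe : σ.phaseEnd = n + q := by rw [hph]; ring
      cases m
      case idle => simp [Mode.busy] at h2
      case loaded => simp [Mode.busy] at h2
      case serving =>
        obtain ⟨-, k, hk, hg⟩ := hm
        dsimp only [Obs.inService, Obs.inBuffer] at hg
        simp [jump, h1, Obs.next, hpe, hk, hg]
      case disturbed =>
        cases π
        case brs =>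
          obtain ⟨⟨k, hk, hg⟩, -⟩ := hm
          dsimp only [Obs.inService, Obs.inBuffer] at hg
          simp [jump, h1, Obs.next, hpe, hk, hg]
        all_goals
          obtain ⟨-, k, hk, hg⟩ := hm
          dsimp only [Obs.inService, Obs.inBuffer] at hg
          simp [jump, h1, Obs.next, hpe, hk, hg]
    · rw [if_neg h, add_zero, ← ih.1, ← ih.2]
      rw [hc, Completes, not_and] at h
      generalize path π (initObs a₀, initClock T H V) j = c at h ⊢
      obtain ⟨⟨m, n, gs, gb, C, r⟩, a, q, x⟩ := c
      simp only at h
      by_cases hlt : a < q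
      · cases m <;> cases π <;> simp [jump, hlt, Obs.arr]
      · have := h hlt
        cases m <;> simp_all [jump, Obs.next, Mode.busy, not_lt.2]

open Classical in
-- Conservation law: the server becomes busy only when a service starts, and becomes free only by a
-- completion. Preemption keeps it busy.
theorem busy_jump (c : Obs × Clock) :
    if (jump π c).1.1 = .serving then c.1.1.busy = 0 ∧ ¬ Completes c
    else (if Completes c then 1 else 0) + (jump π c).1.1.busy = c.1.1.busy := by
  obtain ⟨⟨m, n, gs, gb, C, r⟩, a, q, x⟩ := c
  by_cases hlt : a < q
  · cases m <;> cases π <;> simp [jump, hlt, Obs.arr, Mode.busy, Completes]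
  · cases m <;> cases π <;> simp [jump, hlt, Obs.next, Mode.next, Mode.busy, Completes]

open Classical in
theorem count_completes_add_busy {c : Obs × Clock} {n : ℕ} (hn : n < startIndex π c) :
    Nat.count (fun k => Completes (path π c k)) n + (path π c n).1.1.busy = c.1.1.busy := by
  induction n with
  | zero => rw [Nat.count_zero, zero_add]; rfl
  | succ n ih =>
    have hs := not_serving_of_lt_startIndex π n.succ_pos hn
    have h := busy_jump π (path π c n)
    rw [path_succ'] at hs
    rw [if_neg hs] at h
    rw [Nat.count_succ, path_succ', add_assoc, h]
    exact ih (n.lt_succ_self.trans hn)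

open Classical in
-- Summing `busy_jump`: up to the next start exactly the service in progress, if any, is completed.
theorem count_completes_startIndex {c : Obs × Clock} (h : Starts π c) :
    Nat.count (fun k => Completes (path π c k)) (startIndex π c) = c.1.1.busy := by
  have hs := start_serving π h
  obtain ⟨n, hn⟩ : ∃ n, startIndex π c = n + 1 := ⟨_, rfl⟩
  rw [start, hn, path_succ'] at hs
  have h1 := busy_jump π (path π c n)
  rw [if_pos hs] at h1
  have h2 := count_completes_add_busy π (c := c) (n := n) (by omega)
  rw [hn, Nat.count_succ, if_neg h1.2]
  omega

/-- The state at the start of the `(l + 1)`-st service. -/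
noncomputable def cycle (c : Obs × Clock) (l : ℕ) : Obs × Clock := (start π)^[l] (start π c)

theorem cycle_succ (c : Obs × Clock) (l : ℕ) : cycle π c (l + 1) = start π (cycle π c l) :=
  Function.iterate_succ_apply' _ _ _

theorem measurable_cycle (l : ℕ) : Measurable fun c => cycle π c l :=
  ((measurable_start π).iterate l).comp (measurable_start π)

/-- A service starts again and again. -/
def Recurrent (c : Obs × Clock) : Prop := Starts π c ∧ ∀ l, Starts π (cycle π c l)

theorem path_path (c : Obs × Clock) (m n : ℕ) : path π (path π c m) n = path π c (m + n) := by
  rw [path, path, path, ← Function.iterate_add_apply, add_comm]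

variable {π T H V}

open Classical in
-- The initial state is idle and every later cycle begins in service, so no completion precedes the
-- first start and exactly one falls into each cycle. Hence the labels at the `l`-th cycle state are
-- the completion and generation times with index `l`.
theorem Recurrent.exists_index {a₀ : ℝ} (h : Recurrent π (initObs a₀, initClock T H V)) (l : ℕ) :
    ∃ n, cycle π (initObs a₀, initClock T H V) l = path π (initObs a₀, initClock T H V) n ∧
      Nat.count (IsCompletion π T H V) n = l := by
  have hcount : ∀ n, Nat.count (IsCompletion π T H V) n =
      Nat.count (fun j => Completes (path π (initObs a₀, initClock T H V) j)) n := fun n =>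
    by
      simp only [Nat.count_eq_card_filter_range]
      congr 1
      ext j
      simp only [Finset.mem_filter, isCompletion_iff π T H V a₀]
  have hserv : ∀ l, (cycle π (initObs a₀, initClock T H V) l).1.1 = .serving := fun l => by
    cases l with
    | zero => exact start_serving π h.1
    | succ l => rw [cycle_succ]; exact start_serving π (h.2 l)
  induction l with
  | zero =>
    refine ⟨_, rfl, ?_⟩
    rw [hcount, count_completes_startIndex π h.1]
    rfl
  | succ l ih =>
    obtain ⟨n, hn, hl⟩ := ih
    refine ⟨n + startIndex π (cycle π (initObs a₀, initClock T H V) l), ?_, ?_⟩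
    · rw [cycle_succ, start, hn, path_path]
    · rw [hcount] at hl ⊢
      rw [Nat.count_add, hl]
      have := count_completes_startIndex π (h.2 l)
      rw [hserv] at this
      simp only [Mode.busy] at this
      rw [← this]
      congr 2
      ext k
      rw [hn, path_path]

theorem Recurrent.complTime_eq {a₀ : ℝ} (h : Recurrent π (initObs a₀, initClock T H V)) (l : ℕ) :
    complTime π T H V l = (cycle π (initObs a₀, initClock T H V) l).1.lastCompl := by
  classical
  obtain ⟨n, hn, hl⟩ := h.exists_index l
  rw [hn, (path_last π T H V a₀ n).1, hl]

theorem Recurrent.informGenTime_eq {a₀ : ℝ} (h : Recurrent π (initObs a₀, initClock T H V))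
    (l : ℕ) :
    informGenTime π a₀ T H V l = (cycle π (initObs a₀, initClock T H V) l).1.lastGen := by
  classical
  obtain ⟨n, hn, hl⟩ := h.exists_index l
  rw [hn, (path_last π T H V a₀ n).2, hl]

/-- The labels along the path run exactly through the successive completions; recurrence ensures
that each of them is reached. -/
theorem Recurrent.forall_path_iff {a₀ : ℝ} (h : Recurrent π (initObs a₀, initClock T H V))
    (p : ℝ → ℝ → Prop) :
    (∀ j, p (path π (initObs a₀, initClock T H V) j).1.lastCompl
      (path π (initObs a₀, initClock T H V) j).1.lastGen) ↔
    ∀ l, p (complTime π T H V l) (informGenTime π a₀ T H V l) := by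
  classical
  constructor
  · intro hp l
    obtain ⟨n, hn, hl⟩ := h.exists_index l
    rw [h.complTime_eq, h.informGenTime_eq, hn]
    exact hp n
  · intro hp j
    rw [(path_last π T H V a₀ j).1, (path_last π T H V a₀ j).2]
    exact hp _

end Correspondence

end VacationQueue

namespace VacationQueue

open Set
open scoped ENNReal

/-! ### Independence and common law of the cycle data. -/

section Cycles

variable (ρ : Rates) (π : Policy)

/-- A service has just started, of a packet generated before. -/
def Obs.Good (s : Obs) : Prop := s.1 = .serving ∧ s.inService ≤ s.now

/-- The state at the next start of a service, in terms of the variables that govern the cycle. -/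
noncomputable def Obs.renew (s : Obs) (z : (ℝ × ℝ) × ℝ × ℝ × ℝ) : Obs :=
  (s.phase π z.1).vacation π z.2

/-- The variables that govern a cycle are positive. -/
def Positive (z : (ℝ × ℝ) × ℝ × ℝ × ℝ) : Prop :=
  0 < z.1.1 ∧ 0 < z.1.2 ∧ 0 < z.2.1 ∧ 0 < z.2.2.1 ∧ 0 < z.2.2.2

/-- The law of the variables that govern a cycle. -/
noncomputable def cycleLaw : Measure ((ℝ × ℝ) × ℝ × ℝ × ℝ) := (srvLaw ρ).prod (vacLaw ρ)

instance : IsProbabilityMeasure (cycleLaw ρ) := by unfold cycleLaw; infer_instance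

/-- The length of the service, the age of the completed packet at its completion (up to the age
that it had at the start of the service, if this packet is the one whose service was started), the
indicator that this packet is the one whose service was started, the length of the vacations, and
the age of the packet in the buffer at their end. -/
abbrev CycleData := ℝ × ℝ × ℝ × ℝ × ℝ

/-- The data of the cycle that starts in state `s` and ends in state `t`. -/
noncomputable def cycleData (s t : Obs) : CycleData :=
  (t.lastCompl - s.now, if t.lastGen ≤ s.now then t.lastCompl - s.now else t.lastCompl - t.lastGen,
    if t.lastGen ≤ s.now then 1 else 0, t.now - t.lastCompl, t.now - t.inService)

/-- The data of a cycle in terms of the variables that govern it. -/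
noncomputable def cycleVal (z : (ℝ × ℝ) × ℝ × ℝ × ℝ) : CycleData :=
  match π with
  | .cbs => (z.1.1, z.1.1, 1, z.2.1 + z.2.2.1, min z.2.2.2 z.2.2.1)
  | .brs => (z.1.1, z.1.1, 1, (if z.1.2 < z.1.1 then 0 else z.2.1) + z.2.2.1,
      min z.2.2.2 z.2.2.1 + if z.1.2 < z.1.1 ∧ z.2.2.1 ≤ z.2.2.2 then z.1.2 else 0)
  | .cbsp => (z.1.1, min z.1.2 z.1.1, if z.1.2 < z.1.1 then 0 else 1, z.2.1 + z.2.2.1,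
      min z.2.2.2 z.2.2.1)

/-- The relations between the states at the starts of consecutive services. -/
structure Consecutive (s t : Obs) : Prop where
  now_le : s.now ≤ t.lastCompl
  lastCompl_le : t.lastCompl ≤ t.now
  inService_le : t.inService ≤ t.now
  lastGen_le : t.lastGen ≤ t.inService
  le_lastGen : s.inService ≤ t.lastGen
  lastGen_le' : t.lastGen ≤ t.lastCompl
  eq_of_le : t.lastGen ≤ s.now → t.lastGen = s.inService

theorem ae_prod_of_ae {α β : Type*} [MeasurableSpace α] [MeasurableSpace β] {μ : Measure α}
    {ν : Measure β} [SFinite ν] {p : α → Prop} {q : β → Prop} (hp : ∀ᵐ x ∂μ, p x)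
    (hq : ∀ᵐ y ∂ν, q y) : ∀ᵐ z ∂μ.prod ν, p z.1 ∧ q z.2 :=
  (Measure.quasiMeasurePreserving_fst.ae hp).and (Measure.quasiMeasurePreserving_snd.ae hq)

theorem ae_vacLaw_pos : ∀ᵐ x ∂vacLaw ρ, 0 < x.1 ∧ 0 < x.2.1 ∧ 0 < x.2.2 :=
  ae_prod_of_ae (ae_expMeasure_pos _)
    (ae_prod_of_ae (ae_expMeasure_pos _) (ae_expMeasure_pos _))

theorem ae_srvLaw_pos : ∀ᵐ p ∂srvLaw ρ, 0 < p.1 ∧ 0 < p.2 :=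
  ae_prod_of_ae (ae_expMeasure_pos _) (ae_expMeasure_pos _)

theorem ae_cycleLaw_pos : ∀ᵐ z ∂cycleLaw ρ, Positive z := by
  filter_upwards [ae_prod_of_ae (ae_srvLaw_pos ρ) (ae_vacLaw_pos ρ)] with z hz
  exact ⟨hz.1.1, hz.1.2, hz.2⟩

attribute [local simp] Obs.now Obs.inService Obs.inBuffer Obs.lastCompl Obs.lastGen

variable {s : Obs} {z : (ℝ × ℝ) × ℝ × ℝ × ℝ}

theorem Obs.Good.renew_fst (hs : s.Good) : (s.renew π z).1 = .serving := by
  obtain ⟨m, n, gs, gb, C, r⟩ := s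
  obtain ⟨⟨D, E⟩, X, R, E'⟩ := z
  obtain ⟨rfl, hle⟩ := hs
  by_cases h1 : E < D <;> by_cases h2 : E' < R <;> cases π <;>
    simp [Obs.renew, Obs.phase, Obs.vacation, h1, h2, Obs.arr, Obs.next, Mode.next]

theorem Obs.Good.consecutive (hs : s.Good) (hz : Positive z) : Consecutive s (s.renew π z) := by
  obtain ⟨m, n, gs, gb, C, r⟩ := s
  obtain ⟨⟨D, E⟩, X, R, E'⟩ := z
  obtain ⟨rfl, hle⟩ := hs
  obtain ⟨h3, h4, h5, h6, h7⟩ := hz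
  simp only [Obs.now, Obs.inService] at hle h3 h4 h5 h6 h7
  by_cases h1 : E < D <;> by_cases h2 : E' < R <;> cases π <;> constructor <;>
    simp [Obs.renew, Obs.phase, Obs.vacation, h1, h2, Obs.arr, Obs.next, Mode.next] <;>
    linarith

/-- The regeneration property in deterministic form: the data of a cycle depend on the driving
variables alone, not on the labels at its start. The labels enter only through differences, and
`keep` separates off the age that the packet had before. -/
theorem Obs.Good.cycleData_renew (hs : s.Good) (hz : Positive z) :
    cycleData s (s.renew π z) = cycleVal π z := by
  obtain ⟨m, n, gs, gb, C, r⟩ := s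
  obtain ⟨⟨D, E⟩, X, R, E'⟩ := z
  obtain ⟨rfl, hle⟩ := hs
  obtain ⟨h3, h4, h5, h6, h7⟩ := hz
  simp only [Obs.now, Obs.inService] at hle h3 h4 h5 h6 h7
  by_cases h1 : E < D
  · have e1 : ¬ n + (D - E) ≤ n := by linarith
    have e2 : min E D = E := min_eq_left h1.le
    by_cases h2 : E' < R
    · have e3 : ¬ R ≤ E' := not_le.2 h2
      have e4 : min E' R = E' := min_eq_left h2.le
      cases π <;>
        simp [cycleData, cycleVal, Obs.renew, Obs.phase, Obs.vacation, h1, h2, Obs.arr, Obs.next,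
          Mode.next, hle, e1, e2, e3, e4] <;> ring_nf <;> simp
    · have e3 : R ≤ E' := not_lt.1 h2
      cases π <;>
        simp [cycleData, cycleVal, Obs.renew, Obs.phase, Obs.vacation, h1, h2, Obs.arr, Obs.next,
          Mode.next, hle, e1, e2, e3] <;> ring_nf <;> simp
  · have e2 : min E D = D := min_eq_right (not_lt.1 h1)
    by_cases h2 : E' < R
    · have e4 : min E' R = E' := min_eq_left h2.le
      cases π <;>
        simp [cycleData, cycleVal, Obs.renew, Obs.phase, Obs.vacation, h1, h2, Obs.arr, Obs.next,
          hle, e2, e4] <;> ring_nf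
    · have e3 : R ≤ E' := not_lt.1 h2
      have e4 : min E' R = R := min_eq_right e3
      cases π <;>
        simp [cycleData, cycleVal, Obs.renew, Obs.phase, Obs.vacation, h1, h2, Obs.arr, Obs.next,
          hle, e2, e4] <;> ring_nf

theorem Obs.Good.renew (hs : s.Good) (hz : Positive z) : (s.renew π z).Good :=
  ⟨hs.renew_fst π, (hs.consecutive π hz).inService_le⟩

/-- The state at the start of the first service. -/
theorem initObs_vacation (a₀ : ℝ) {x : ℝ × ℝ × ℝ} :
    (initObs a₀).vacation π x = (.serving, x.1 + x.2.1, x.1 + x.2.1 - min x.2.2 x.2.1,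
      x.1 + x.2.1 - min x.2.2 x.2.1, 0, -a₀) := by
  obtain ⟨X, R, E⟩ := x
  by_cases h : E < R
  · have e : min E R = E := min_eq_left h.le
    cases π <;> simp [initObs, Obs.vacation, Obs.phase, h, Obs.arr, Obs.next, e] <;> ring_nf <;>
      simp
  · have e : min E R = R := min_eq_right (not_lt.1 h)
    cases π <;> simp [initObs, Obs.vacation, Obs.phase, h, Obs.arr, Obs.next, e]

theorem initObs_vacation_good (a₀ : ℝ) {x : ℝ × ℝ × ℝ} (hx : 0 < x.1 ∧ 0 < x.2.1 ∧ 0 < x.2.2) :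
    ((initObs a₀).vacation π x).Good := by
  rw [initObs_vacation]
  refine ⟨rfl, ?_⟩
  have : 0 < min x.2.2 x.2.1 := lt_min hx.2.2 hx.2.1
  simp [this.le]

@[fun_prop]
theorem Obs.measurable_renew {α : Type*} [MeasurableSpace α] {f : α → Obs}
    {g : α → (ℝ × ℝ) × ℝ × ℝ × ℝ} (hf : Measurable f) (hg : Measurable g) :
    Measurable fun x => (f x).renew π (g x) := by
  unfold Obs.renew; fun_prop

theorem startExp_of_good (hs : s.Good) {ψ : Obs → ℝ≥0∞} (hψ : Measurable ψ) :
    startExp ρ π ψ s = ∫⁻ z, ψ (s.renew π z) ∂cycleLaw ρ := by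
  have h1 : startExp ρ π ψ s = ∫⁻ p, vacExp ρ π ψ (s.phase π p) ∂srvLaw ρ := by
    simp [startExp, hs.1]
  have hm : Measurable fun z => ψ (s.renew π z) := hψ.comp (by fun_prop)
  rw [h1, cycleLaw, lintegral_prod _ hm.aemeasurable]
  rfl

theorem measurable_cycleData : Measurable fun p : Obs × Obs => cycleData p.1 p.2 := by
  have hle : MeasurableSet {p : Obs × Obs | p.2.lastGen ≤ p.1.now} :=
    measurableSet_le (by fun_prop) (by fun_prop)
  unfold cycleData
  exact Measurable.prodMk (by fun_prop) (Measurable.prodMk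
    (Measurable.ite hle (by fun_prop) (by fun_prop)) (Measurable.prodMk
    (Measurable.ite hle (by fun_prop) (by fun_prop)) (by fun_prop)))

theorem measurable_cycleVal : Measurable (cycleVal π) := by
  have hlt : MeasurableSet {z : (ℝ × ℝ) × ℝ × ℝ × ℝ | z.1.2 < z.1.1} :=
    measurableSet_lt (by fun_prop) (by fun_prop)
  have hle : MeasurableSet {z : (ℝ × ℝ) × ℝ × ℝ × ℝ | z.2.2.1 ≤ z.2.2.2} :=
    measurableSet_le (by fun_prop) (by fun_prop)
  unfold cycleVal
  cases π <;> simp only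
  · fun_prop
  · exact Measurable.prodMk (by fun_prop) (Measurable.prodMk (by fun_prop)
      (Measurable.prodMk (by fun_prop) (Measurable.prodMk
        ((Measurable.ite hlt (by fun_prop) (by fun_prop)).add (by fun_prop))
        (Measurable.add (by fun_prop)
          (Measurable.ite (hlt.inter hle) (by fun_prop) (by fun_prop))))))
  · exact Measurable.prodMk (by fun_prop) (Measurable.prodMk (by fun_prop)
      (Measurable.prodMk (Measurable.ite hlt (by fun_prop) (by fun_prop)) (by fun_prop)))

/-- The law of the data of a cycle. -/
noncomputable def dataLaw : Measure CycleData := (cycleLaw ρ).map (cycleVal π)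

instance : IsProbabilityMeasure (dataLaw ρ π) :=
  Measure.isProbabilityMeasure_map (measurable_cycleVal π).aemeasurable

variable (a₀ : ℝ)

/-- The law of the initial clock. -/
noncomputable abbrev initLaw : Measure Clock := clockLaw ρ .idle

/-- The state at the start of the `(l + 1)`-st service, in terms of the initial clock. -/
noncomputable def service (l : ℕ) (e : Clock) : Obs × Clock := cycle π (initObs a₀, e) l

/-- The data of the `(l + 1)`-st cycle. -/
noncomputable def serviceData (l : ℕ) (e : Clock) : CycleData :=
  cycleData (service π a₀ l e).1 (service π a₀ (l + 1) e).1

theorem measurable_service (l : ℕ) : Measurable (service π a₀ l) :=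
  (measurable_cycle π l).comp measurable_prodMk_left

theorem measurable_serviceData (l : ℕ) : Measurable (serviceData π a₀ l) :=
  measurable_cycleData.comp
    ((measurable_service π a₀ l).fst.prodMk (measurable_service π a₀ (l + 1)).fst)

theorem service_succ (l : ℕ) (e : Clock) :
    service π a₀ (l + 1) e = start π (service π a₀ l e) := cycle_succ _ _ _

/-- If the future functional has the same expectation `a` from every good state, conditioning on the
data of the present cycle does not affect it. This is the induction step for independence. -/
theorem J_indicator_start {s : Obs} (hs : s.Good) {A : Set CycleData} (hA : MeasurableSet A)
    {f : Obs × Clock → ℝ≥0∞} (hf : Measurable f) (hf1 : ∀ c, f c ≤ 1) {a : ℝ≥0∞}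
    (hfa : ∀ s : Obs, s.Good → J ρ f s = a) :
    J ρ (fun c => A.indicator 1 (cycleData c.1 (start π c).1) * f (start π c)) s =
      dataLaw ρ π A * a := by
  have hind : Measurable fun c : Obs × Clock => A.indicator (1 : CycleData → ℝ≥0∞)
      (cycleData s c.1) :=
    (measurable_one.indicator hA).comp
      (measurable_cycleData.comp (measurable_const.prodMk measurable_fst))
  let g : Obs × Clock → ℝ≥0∞ := fun c => A.indicator 1 (cycleData s c.1) * f c
  have hg : Measurable g := hind.mul hf
  have hg1 : ∀ c, g c ≤ 1 := fun c => mul_le_one' (indicator_le_self' (fun _ _ => zero_le) _) (hf1 c)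
  have h1 := J_start ρ π hg hg1 s
  have h2 : J ρ (fun c => A.indicator 1 (cycleData c.1 (start π c).1) * f (start π c)) s =
      J ρ (fun c => g (start π c)) s := rfl
  have hmJ := measurable_J ρ hg
  rw [h2, h1, startExp_of_good ρ π hs hmJ, dataLaw, Measure.map_apply (measurable_cycleVal π) hA,
    ← lintegral_indicator_one ((measurable_cycleVal π) hA), ← lintegral_mul_const]
  · refine lintegral_congr_ae ?_
    filter_upwards [ae_cycleLaw_pos ρ] with z hz
    rw [← hfa _ (hs.renew π hz), J, J, ← lintegral_const_mul]
    · refine lintegral_congr fun e => ?_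
      simp only [g, hs.cycleData_renew π hz]
      rfl
    · exact hf.comp measurable_prodMk_left
  · exact (measurable_one.indicator ((measurable_cycleVal π) hA))

/-- Induction on the number of cycles: the last indicator and `f` after one more start form a
functional that again has the same expectation from every good state, by `J_indicator_start`. -/
theorem lintegral_service {f : Obs × Clock → ℝ≥0∞} (hf : Measurable f) (hf1 : ∀ c, f c ≤ 1)
    {a : ℝ≥0∞} (hfa : ∀ s : Obs, s.Good → J ρ f s = a) {A : ℕ → Set CycleData}
    (hA : ∀ i, MeasurableSet (A i)) (n : ℕ) :
    ∫⁻ e, (∏ i ∈ Finset.range n, (A i).indicator 1 (serviceData π a₀ i e)) *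
        f (service π a₀ n e) ∂initLaw ρ =
      (∏ i ∈ Finset.range n, dataLaw ρ π (A i)) * a := by
  induction n generalizing f a with
  | zero =>
    simp only [Finset.range_zero, Finset.prod_empty, one_mul]
    have h1 := J_start ρ π hf hf1 (initObs a₀)
    have h2 : startExp ρ π (J ρ f) (initObs a₀) = ∫⁻ _, a ∂vacLaw ρ := by
      change vacExp ρ π (J ρ f) (initObs a₀) = _
      refine lintegral_congr_ae ?_
      filter_upwards [ae_vacLaw_pos ρ] with x hx
      exact hfa _ (initObs_vacation_good π a₀ hx)
    rw [h2, lintegral_const, measure_univ, mul_one] at h1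
    exact h1
  | succ n ih =>
    let f' : Obs × Clock → ℝ≥0∞ := fun c =>
      (A n).indicator 1 (cycleData c.1 (start π c).1) * f (start π c)
    have hf' : Measurable f' :=
      ((measurable_one.indicator (hA n)).comp (measurable_cycleData.comp
        (measurable_fst.prodMk (measurable_start π).fst))).mul (hf.comp (measurable_start π))
    have hf'1 : ∀ c, f' c ≤ 1 := fun c =>
      mul_le_one' (indicator_le_self' (fun _ _ => zero_le) _) (hf1 _)
    have := ih hf' hf'1 (a := dataLaw ρ π (A n) * a)
      (fun s hs => J_indicator_start ρ π hs (hA n) hf hf1 hfa)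
    rw [Finset.prod_range_succ, mul_assoc, ← this]
    refine lintegral_congr fun e => ?_
    rw [Finset.prod_range_succ, mul_assoc]
    simp only [f', serviceData, service_succ]

theorem measure_serviceData {A : ℕ → Set CycleData} (hA : ∀ i, MeasurableSet (A i)) (n : ℕ) :
    initLaw ρ (⋂ i ∈ Finset.range n, serviceData π a₀ i ⁻¹' A i) =
      ∏ i ∈ Finset.range n, dataLaw ρ π (A i) := by
  have h := lintegral_service ρ π a₀ (f := fun _ => 1) measurable_const (fun _ => le_rfl)
    (a := 1) (fun s _ => by simp [J]) hA n
  simp only [mul_one] at h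
  rw [← h, ← lintegral_indicator_one]
  · refine lintegral_congr fun e => ?_
    by_cases he : ∀ i ∈ Finset.range n, serviceData π a₀ i e ∈ A i
    · rw [indicator_of_mem (by simpa using he), Pi.one_apply, Finset.prod_eq_one]
      intro i hi
      simp [he i hi]
    · rw [indicator_of_notMem (by simpa using he)]
      push Not at he
      obtain ⟨i, hi, hi'⟩ := he
      rw [Finset.prod_eq_zero hi]
      simp [hi']
  · exact Finset.measurableSet_biInter _ fun i _ => (measurable_serviceData π a₀ i) (hA i)

theorem map_serviceData (l : ℕ) : (initLaw ρ).map (serviceData π a₀ l) = dataLaw ρ π := by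
  classical
  ext A hA
  rw [Measure.map_apply (measurable_serviceData π a₀ l) hA]
  have h := measure_serviceData ρ π a₀ (A := fun i => if i = l then A else univ)
    (fun i => by split_ifs <;> simp [hA]) (l + 1)
  rw [Finset.prod_eq_single l] at h
  · rw [if_pos rfl] at h
    rw [← h]
    congr 1
    ext e
    simp only [mem_preimage, mem_iInter, Finset.mem_range]
    constructor
    · intro he i _
      split_ifs with hi
      · rwa [hi]
      · trivial
    · intro he
      simpa using he l (by omega)
  · intro i _ hi
    simp [hi]
  · simp

theorem iIndepFun_serviceData : iIndepFun (serviceData π a₀) (initLaw ρ) := by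
  classical
  rw [iIndepFun_iff_measure_inter_preimage_eq_mul]
  intro S A hA
  -- Indices outside `S` receive the trivial condition, which turns a finite set of indices into an
  -- initial segment.
  have h := measure_serviceData ρ π a₀ (A := fun i => if i ∈ S then A i else univ)
    (fun i => by split_ifs with hi <;> simp [hA i, hi]) (S.sup id + 1)
  have hS : ∀ i ∈ S, i ∈ Finset.range (S.sup id + 1) := fun i hi =>
    Finset.mem_range.2 (Nat.lt_succ_of_le (Finset.le_sup (f := id) hi))
  have hsub : S ⊆ Finset.range (S.sup id + 1) := hS
  rw [← Finset.prod_subset hsub] at h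
  · rw [Finset.prod_congr rfl fun i hi => ?_]
    · rw [← h]
      congr 1
      ext e
      simp only [mem_iInter, mem_preimage]
      constructor
      · intro he i _
        split_ifs with hi
        · exact he i hi
        · trivial
      · intro he i hi
        simpa [hi] using he i (hS i hi)
    · rw [if_pos hi, ← map_serviceData ρ π a₀ i,
        Measure.map_apply (measurable_serviceData π a₀ i) (hA i hi)]
  · intro i _ hi
    simp [hi]

/-- The case of value zero of `lintegral_service`, for the indicator of the exceptional set and
trivial conditions on the data. -/
theorem ae_service {p : Obs × Clock → Prop} (hp : MeasurableSet {c | p c})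
    (h : ∀ s : Obs, s.Good → ∀ᵐ e ∂clockLaw ρ s.1, p (s, e)) (l : ℕ) :
    ∀ᵐ e ∂initLaw ρ, p (service π a₀ l e) := by
  have hm : Measurable ({c | p c}ᶜ.indicator (1 : Obs × Clock → ℝ≥0∞)) :=
    measurable_one.indicator hp.compl
  have h1 := lintegral_service ρ π a₀ hm (fun c => indicator_le_self' (fun _ _ => zero_le) _)
    (a := 0) (fun s hs => ?_) (A := fun _ => univ) (fun _ => MeasurableSet.univ) l
  · simp only [indicator_univ, Pi.one_apply, Finset.prod_const_one, one_mul, mul_zero] at h1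
    have hms : Measurable fun e => ({c | p c}ᶜ.indicator (1 : Obs × Clock → ℝ≥0∞))
        (service π a₀ l e) := hm.comp (measurable_service π a₀ l)
    rw [lintegral_eq_zero_iff hms] at h1
    filter_upwards [h1] with e he
    by_contra hc
    have : service π a₀ l e ∈ {c | p c}ᶜ := hc
    exact one_ne_zero ((indicator_of_mem this (1 : Obs × Clock → ℝ≥0∞)).symm.trans he)
  · have hms : Measurable fun e => ({c | p c}ᶜ.indicator (1 : Obs × Clock → ℝ≥0∞)) (s, e) :=
      hm.comp measurable_prodMk_left
    rw [J, lintegral_eq_zero_iff hms]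
    filter_upwards [h s hs] with e he
    have : (s, e) ∉ {c | p c}ᶜ := not_not.2 he
    simp [indicator_of_notMem this]

theorem ae_recurrent : ∀ᵐ e ∂initLaw ρ, Recurrent π (initObs a₀, e) := by
  have h1 : ∀ᵐ e ∂initLaw ρ, ∀ l, Starts π (service π a₀ l e) := ae_all_iff.2 fun l =>
    ae_service ρ π a₀ (measurableSet_starts π) (fun s _ => ae_starts ρ π s) l
  filter_upwards [ae_starts ρ π (initObs a₀), h1] with e h2 h3
  exact ⟨h2, h3⟩

theorem measurableSet_consecutive : MeasurableSet {p : Obs × Obs | Consecutive p.1 p.2} := by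
  have : {p : Obs × Obs | Consecutive p.1 p.2} =
      {p | p.1.now ≤ p.2.lastCompl} ∩ {p | p.2.lastCompl ≤ p.2.now} ∩
      {p | p.2.inService ≤ p.2.now} ∩ {p | p.2.lastGen ≤ p.2.inService} ∩
      {p | p.1.inService ≤ p.2.lastGen} ∩ {p | p.2.lastGen ≤ p.2.lastCompl} ∩
      ({p | p.2.lastGen ≤ p.1.now}ᶜ ∪ {p | p.2.lastGen = p.1.inService}) := by
    ext p
    simp only [mem_inter_iff, mem_union, mem_compl_iff, mem_ofPred_eq, ← imp_iff_not_or]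
    exact ⟨fun ⟨h1, h2, h3, h4, h5, h6, h7⟩ => ⟨⟨⟨⟨⟨⟨h1, h2⟩, h3⟩, h4⟩, h5⟩, h6⟩, h7⟩,
      fun ⟨⟨⟨⟨⟨⟨h1, h2⟩, h3⟩, h4⟩, h5⟩, h6⟩, h7⟩ => ⟨h1, h2, h3, h4, h5, h6, h7⟩⟩
  rw [this]
  exact ((((((measurableSet_le (by fun_prop) (by fun_prop)).inter
    (measurableSet_le (by fun_prop) (by fun_prop))).inter
    (measurableSet_le (by fun_prop) (by fun_prop))).inter
    (measurableSet_le (by fun_prop) (by fun_prop))).inter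
    (measurableSet_le (by fun_prop) (by fun_prop))).inter
    (measurableSet_le (by fun_prop) (by fun_prop))).inter
    ((measurableSet_le (by fun_prop) (by fun_prop)).compl.union
      (measurableSet_eq_fun (by fun_prop) (by fun_prop)))

/-- Almost sure properties of a cycle. -/
theorem Obs.Good.ae_start {s : Obs} (hs : s.Good) {p : Obs → Prop} (hp : MeasurableSet {s | p s})
    (h : ∀ z, Positive z → p (s.renew π z)) : ∀ᵐ e ∂clockLaw ρ s.1, p (start π (s, e)).1 := by
  have hm : Measurable ((Prod.fst ⁻¹' {s | p s}ᶜ).indicator (1 : Obs × Clock → ℝ≥0∞)) :=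
    measurable_one.indicator (measurable_fst hp.compl)
  have h1 := J_start ρ π hm (fun c => indicator_le_self' (fun _ _ => zero_le) _) s
  rw [startExp_of_good ρ π hs (measurable_J ρ hm)] at h1
  have h2 : ∫⁻ z, J ρ ((Prod.fst ⁻¹' {s | p s}ᶜ).indicator 1) (s.renew π z) ∂cycleLaw ρ = 0 := by
    have hms : Measurable fun z => J ρ ((Prod.fst ⁻¹' {s | p s}ᶜ).indicator 1) (s.renew π z) :=
      (measurable_J ρ hm).comp (by fun_prop)
    rw [lintegral_eq_zero_iff hms]
    filter_upwards [ae_cycleLaw_pos ρ] with z hz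
    simp [J, h z hz]
  have hms : Measurable fun e => (Prod.fst ⁻¹' {s | p s}ᶜ).indicator (1 : Obs × Clock → ℝ≥0∞)
      (start π (s, e)) := hm.comp ((measurable_start π).comp measurable_prodMk_left)
  rw [h2, J, lintegral_eq_zero_iff hms] at h1
  filter_upwards [h1] with e he
  by_contra hc
  have : start π (s, e) ∈ (Prod.fst ⁻¹' {s | p s}ᶜ : Set (Obs × Clock)) := hc
  exact one_ne_zero ((indicator_of_mem this (1 : Obs × Clock → ℝ≥0∞)).symm.trans he)

theorem ae_consecutive : ∀ᵐ e ∂initLaw ρ, ∀ l,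
    Consecutive (service π a₀ l e).1 (service π a₀ (l + 1) e).1 := by
  refine ae_all_iff.2 fun l => ?_
  have hm : MeasurableSet {c : Obs × Clock | Consecutive c.1 (start π c).1} :=
    (measurable_fst.prodMk (measurable_start π).fst) measurableSet_consecutive
  filter_upwards [ae_service ρ π a₀ hm (fun s hs => hs.ae_start ρ π
    (measurable_prodMk_left measurableSet_consecutive) fun z hz => hs.consecutive π hz) l]
    with e he
  rwa [service_succ]

/-- The law of the state at the start of the first service. -/
theorem map_service_zero :
    (initLaw ρ).map (fun e => (service π a₀ 0 e).1) =
      (vacLaw ρ).map fun x => (initObs a₀).vacation π x := by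
  have hv : Measurable fun x => (initObs a₀).vacation π x := by fun_prop
  ext B hB
  rw [Measure.map_apply (measurable_service π a₀ 0).fst hB, Measure.map_apply hv hB,
    ← lintegral_indicator_one ((measurable_service π a₀ 0).fst hB),
    ← lintegral_indicator_one (hv hB)]
  have hm : Measurable ((Prod.fst ⁻¹' B).indicator (1 : Obs × Clock → ℝ≥0∞)) :=
    measurable_one.indicator (measurable_fst hB)
  refine (J_start ρ π hm (fun c => indicator_le_self' (fun _ _ => zero_le) _) (initObs a₀)).trans ?_
  change vacExp ρ π _ _ = _
  refine lintegral_congr fun x => ?_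
  by_cases hx : (initObs a₀).vacation π x ∈ B
  · have : ∀ e, ((initObs a₀).vacation π x, e) ∈ (Prod.fst ⁻¹' B : Set (Obs × Clock)) :=
      fun _ => hx
    simp [J, hx]
  · simp [J, hx]

end Cycles

end VacationQueue

namespace VacationQueue

open Set
open scoped ENNReal

/-! ### Moments of exponential variables. -/

section Means

variable {α β : Type*} [MeasurableSpace α] [MeasurableSpace β] {μ : Measure α} {ν : Measure β}

/-- The function `f` is integrable with integral `a`. -/
structure HasMean (μ : Measure α) (f : α → ℝ) (a : ℝ) : Prop where
  integrable : Integrable f μ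
  integral_eq : ∫ x, f x ∂μ = a

namespace HasMean

variable {f g : α → ℝ} {a b : ℝ}

theorem congr_mean (h : HasMean μ f a) (hab : a = b) : HasMean μ f b := hab ▸ h

theorem congr (h : HasMean μ f a) (hfg : ∀ᵐ x ∂μ, f x = g x) : HasMean μ g a :=
  ⟨h.integrable.congr hfg, by rw [← integral_congr_ae hfg, h.integral_eq]⟩

theorem add (hf : HasMean μ f a) (hg : HasMean μ g b) : HasMean μ (fun x => f x + g x) (a + b) :=
  ⟨hf.integrable.add hg.integrable, by
    rw [integral_add hf.integrable hg.integrable, hf.integral_eq, hg.integral_eq]⟩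

theorem const_mul (c : ℝ) (hf : HasMean μ f a) : HasMean μ (fun x => c * f x) (c * a) :=
  ⟨hf.integrable.const_mul c, by rw [integral_const_mul, hf.integral_eq]⟩

theorem const (μ : Measure α) [IsProbabilityMeasure μ] (c : ℝ) : HasMean μ (fun _ => c) c :=
  ⟨integrable_const c, by simp⟩

theorem prod [SFinite μ] [SFinite ν] {g : β → ℝ} (hf : HasMean μ f a) (hg : HasMean ν g b) :
    HasMean (μ.prod ν) (fun z => f z.1 * g z.2) (a * b) :=
  ⟨hf.integrable.mul_prod hg.integrable, by
    rw [integral_prod_mul, hf.integral_eq, hg.integral_eq]⟩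

theorem fst [SFinite μ] [IsProbabilityMeasure ν] (hf : HasMean μ f a) :
    HasMean (μ.prod ν) (fun z => f z.1) a := by
  simpa using hf.prod (HasMean.const ν 1)

theorem snd [IsProbabilityMeasure μ] [SFinite ν] {g : β → ℝ} (hg : HasMean ν g b) :
    HasMean (μ.prod ν) (fun z => g z.2) b := by
  simpa using (HasMean.const μ 1).prod hg

theorem swap [SFinite μ] [SFinite ν] {f : α × β → ℝ} (hf : HasMean (μ.prod ν) f a) :
    HasMean (ν.prod μ) (fun z => f z.swap) a :=
  ⟨hf.integrable.swap, by rw [integral_prod_swap, hf.integral_eq]⟩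

theorem comp {φ : β → α} (hφ : MeasurePreserving φ ν μ) (hf : HasMean μ f a) :
    HasMean ν (fun y => f (φ y)) a := by
  refine ⟨hφ.integrable_comp_of_integrable hf.integrable, ?_⟩
  have h := hf.integrable.aestronglyMeasurable
  rw [← hφ.map_eq] at h
  rw [← hf.integral_eq, ← hφ.map_eq, integral_map hφ.aemeasurable h]

theorem of_comp {φ : β → α} (hφ : MeasurePreserving φ ν μ) (hm : Measurable f)
    (hf : HasMean ν (fun y => f (φ y)) a) : HasMean μ f a := by
  refine ⟨(hφ.integrable_comp hm.aestronglyMeasurable).1 hf.integrable, ?_⟩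
  rw [← hf.integral_eq, ← hφ.map_eq, integral_map hφ.aemeasurable hm.aestronglyMeasurable]

theorem of_lintegral (hm : Measurable f) (h0 : ∀ᵐ x ∂μ, 0 ≤ f x) (ha : 0 ≤ a)
    (h : ∫⁻ x, ENNReal.ofReal (f x) ∂μ = ENNReal.ofReal a) : HasMean μ f a := by
  refine ⟨⟨hm.aestronglyMeasurable, ?_⟩, ?_⟩
  · rw [hasFiniteIntegral_iff_ofReal h0, h]
    exact ENNReal.ofReal_lt_top
  · rw [integral_eq_lintegral_of_nonneg_ae h0 hm.aestronglyMeasurable, h, ENNReal.toReal_ofReal ha]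

theorem lintegral_eq (hf : HasMean μ f a) (h0 : ∀ᵐ x ∂μ, 0 ≤ f x) :
    ∫⁻ x, ENNReal.ofReal (f x) ∂μ = ENNReal.ofReal a := by
  rw [← ofReal_integral_eq_lintegral_ofReal hf.integrable h0, hf.integral_eq]

end HasMean

theorem hasMean_pow_mul_exp {r s : ℝ} (hr : 0 < r) (hs : 0 ≤ s) (n : ℕ) :
    HasMean (expMeasure r) (fun x => x ^ n * Real.exp (-(s * x)))
      (n.factorial * r / (r + s) ^ (n + 1)) := by
  have hrs : 0 < r + s := by linarith
  have h := Real.integral_rpow_mul_exp_neg_mul_Ioi (a := n + 1) (by positivity) hrs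
  have h0 : (1 / (r + s)) ^ ((n : ℝ) + 1) * Real.Gamma (n + 1) =
      n.factorial / (r + s) ^ (n + 1) := by
    rw [Real.Gamma_nat_eq_factorial]
    have : ((n : ℝ) + 1) = ((n + 1 : ℕ) : ℝ) := by push_cast; ring
    rw [this, Real.rpow_natCast, one_div_pow]
    ring
  rw [h0] at h
  simp only [add_sub_cancel_right, Real.rpow_natCast] at h
  have hi : IntegrableOn (fun t : ℝ => t ^ n * Real.exp (-((r + s) * t))) (Ioi 0) := by
    -- A non-integrable function would have the default integral `0`, whereas the Gamma integral is
    -- positive.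
    by_contra hc
    rw [integral_undef hc] at h
    have : 0 < n.factorial / (r + s) ^ (n + 1) := by positivity
    linarith
  refine HasMean.of_lintegral (by fun_prop) ?_ (by positivity) ?_
  · filter_upwards [ae_expMeasure_pos r] with x hx
    positivity
  · rw [lintegral_expMeasure _ (by fun_prop)]
    have e : ∀ x : ℝ, x ∈ Ioi 0 → ENNReal.ofReal (r * Real.exp (-(r * x))) *
        ENNReal.ofReal (x ^ n * Real.exp (-(s * x))) =
        ENNReal.ofReal (r * (x ^ n * Real.exp (-((r + s) * x)))) := fun x _ => by
      rw [← ENNReal.ofReal_mul (by positivity)]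
      congr 1
      have : -((r + s) * x) = -(r * x) + -(s * x) := by ring
      rw [this, Real.exp_add]; ring
    rw [setLIntegral_congr_fun measurableSet_Ioi e, ← ofReal_integral_eq_lintegral_ofReal
      (hi.const_mul r), integral_const_mul, h]
    · congr 1; ring
    · filter_upwards [ae_restrict_mem measurableSet_Ioi] with x hx
      have : (0 : ℝ) < x := hx
      positivity

theorem hasMean_pow_expMeasure {r : ℝ} (hr : 0 < r) (n : ℕ) :
    HasMean (expMeasure r) (fun x => x ^ n) (n.factorial / r ^ n) := by
  refine ((hasMean_pow_mul_exp hr le_rfl n).congr_mean ?_).congr (.of_forall fun x => by simp)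
  rw [add_zero, pow_succ]
  field_simp

theorem hasMean_id_expMeasure {r : ℝ} (hr : 0 < r) : HasMean (expMeasure r) (fun x => x) (1 / r) := by
  simpa using hasMean_pow_expMeasure hr 1

theorem hasMean_sq_expMeasure {r : ℝ} (hr : 0 < r) :
    HasMean (expMeasure r) (fun x => x ^ 2) (2 / r ^ 2) := by
  simpa using hasMean_pow_expMeasure hr 2

theorem expMeasure_Ioi {r : ℝ} (hr : 0 < r) {x : ℝ} (hx : 0 < x) :
    expMeasure r (Ioi x) = ENNReal.ofReal (Real.exp (-(r * x))) := by
  have := isProbabilityMeasure_expMeasure hr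
  have h := lintegral_expMeasure_tail (r := r) hx (f := 1) measurable_one
  rw [lintegral_indicator_one measurableSet_Ioi] at h
  simpa using h

/-- Integrating out the second variable leaves its tail `exp (-(s * x))` as a weight, which reduces
the claim to `hasMean_pow_mul_exp`. -/
theorem hasMean_pow_of_fst_le {r s : ℝ} (hr : 0 < r) (hs : 0 < s) (n : ℕ) :
    HasMean ((expMeasure r).prod (expMeasure s)) (fun p => if p.1 ≤ p.2 then p.1 ^ n else 0)
      (n.factorial * r / (r + s) ^ (n + 1)) := by
  have := isProbabilityMeasure_expMeasure hr
  have := isProbabilityMeasure_expMeasure hs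
  have hle : MeasurableSet {p : ℝ × ℝ | p.1 ≤ p.2} := measurableSet_le measurable_fst measurable_snd
  have hm : Measurable fun p : ℝ × ℝ => if p.1 ≤ p.2 then p.1 ^ n else 0 :=
    Measurable.ite hle (by fun_prop) (by fun_prop)
  refine HasMean.of_lintegral hm ?_ (by positivity) ?_
  · filter_upwards [ae_prod_of_ae (ae_expMeasure_pos r) (ae_expMeasure_pos s)] with p hp
    have := hp.1
    split_ifs <;> positivity
  · rw [lintegral_prod _ hm.ennreal_ofReal.aemeasurable,
      ← (hasMean_pow_mul_exp hr hs.le n).lintegral_eq]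
    · refine lintegral_congr_ae ?_
      filter_upwards [ae_expMeasure_pos r] with x hx
      have : ∀ y, ENNReal.ofReal (if x ≤ y then x ^ n else 0) =
          ENNReal.ofReal (x ^ n) * (Ici x).indicator 1 y := fun y => by
        by_cases h : x ≤ y <;> simp [h]
      simp only [this]
      rw [lintegral_const_mul _ (measurable_one.indicator measurableSet_Ici),
        lintegral_indicator_one measurableSet_Ici, measure_congr Ioi_ae_eq_Ici.symm,
        expMeasure_Ioi hs hx, ← ENNReal.ofReal_mul (by positivity)]
    · filter_upwards [ae_expMeasure_pos r] with x hx
      positivity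

theorem ae_fst_ne_snd (r s : ℝ) (hs : 0 < s) :
    ∀ᵐ p ∂(expMeasure r).prod (expMeasure s), p.1 ≠ p.2 := by
  have := isProbabilityMeasure_expMeasure hs
  have hm : MeasurableSet {p : ℝ × ℝ | p.1 ≠ p.2} :=
    (measurableSet_eq_fun measurable_fst measurable_snd).compl
  rw [Measure.ae_prod_iff_ae_ae hm]
  refine .of_forall fun x => ?_
  have := measure_singleton (μ := expMeasure s) x
  rw [ae_iff]
  convert this using 2
  ext y
  simp [eq_comm]

theorem hasMean_pow_of_fst_lt {r s : ℝ} (hr : 0 < r) (hs : 0 < s) (n : ℕ) :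
    HasMean ((expMeasure r).prod (expMeasure s)) (fun p => if p.1 < p.2 then p.1 ^ n else 0)
      (n.factorial * r / (r + s) ^ (n + 1)) := by
  refine (hasMean_pow_of_fst_le hr hs n).congr ?_
  filter_upwards [ae_fst_ne_snd r s hs] with p hp
  simp [lt_iff_le_and_ne, hp]

theorem hasMean_pow_of_snd_lt {r s : ℝ} (hr : 0 < r) (hs : 0 < s) (n : ℕ) :
    HasMean ((expMeasure r).prod (expMeasure s)) (fun p => if p.2 < p.1 then p.2 ^ n else 0)
      (n.factorial * s / (s + r) ^ (n + 1)) := by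
  have := isProbabilityMeasure_expMeasure hr
  have := isProbabilityMeasure_expMeasure hs
  exact (hasMean_pow_of_fst_lt hs hr n).swap

theorem hasMean_min_pow {r s : ℝ} (hr : 0 < r) (hs : 0 < s) (n : ℕ) :
    HasMean ((expMeasure r).prod (expMeasure s)) (fun p => (min p.2 p.1) ^ n)
      (n.factorial / (r + s) ^ n) := by
  refine (((hasMean_pow_of_fst_le hr hs n).add (hasMean_pow_of_snd_lt hr hs n)).congr_mean
    ?_).congr (.of_forall fun p => ?_)
  · rw [add_comm s r, pow_succ]
    field_simp
  · rcases le_or_gt p.1 p.2 with h | h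
    · simp [h, not_lt.2 h]
    · simp [h, not_le.2 h, h.le]

end Means

end VacationQueue

namespace VacationQueue

open Set
open scoped ENNReal

/-! ### A strong law of large numbers for overlapping windows. -/

section Averages

theorem sum_range_eq_sum_mod_three (f : ℕ → ℝ) (n : ℕ) :
    ∑ i ∈ Finset.range n, f i = ∑ k ∈ Finset.range ((n + 2) / 3), f (3 * k) +
      ∑ k ∈ Finset.range ((n + 1) / 3), f (3 * k + 1) +
      ∑ k ∈ Finset.range (n / 3), f (3 * k + 2) := by
  induction n with
  | zero => simp
  | succ n ih =>
    rw [Finset.sum_range_succ, ih]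
    obtain ⟨q, h | h | h⟩ : ∃ q, n = 3 * q ∨ n = 3 * q + 1 ∨ n = 3 * q + 2 := ⟨n / 3, by omega⟩
    · have e1 : (n + 2) / 3 = q := by omega
      have e2 : (n + 1 + 2) / 3 = q + 1 := by omega
      have e3 : (n + 1) / 3 = q := by omega
      have e5 : n / 3 = q := by omega
      rw [e1, e2, e3, e5, Finset.sum_range_succ, h]
      ring
    · have e1 : (n + 2) / 3 = q + 1 := by omega
      have e2 : (n + 1 + 2) / 3 = q + 1 := by omega
      have e3 : (n + 1) / 3 = q := by omega
      have e5 : n / 3 = q := by omega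
      rw [e1, e2, e3, e5, Finset.sum_range_succ (fun k => f (3 * k + 1)), h]
      ring
    · have e1 : (n + 2) / 3 = q + 1 := by omega
      have e2 : (n + 1 + 2) / 3 = q + 1 := by omega
      have e3 : (n + 1) / 3 = q + 1 := by omega
      have e5 : n / 3 = q := by omega
      rw [e1, e2, e3, e5, Finset.sum_range_succ (fun k => f (3 * k + 2)), h]
      ring

theorem tendsto_div_three_div (r : ℕ) :
    Tendsto (fun n : ℕ => (((n + r) / 3 : ℕ) : ℝ) / n) atTop (𝓝 (1 / 3)) := by
  have h : Tendsto (fun n : ℕ => ((r : ℝ) + 1) * (1 / (n : ℝ))) atTop (𝓝 0) := by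
    simpa using tendsto_one_div_atTop_nhds_zero_nat.const_mul ((r : ℝ) + 1)
  refine tendsto_of_tendsto_of_tendsto_of_le_of_le' (g := fun n : ℕ => 1 / 3 - ((r : ℝ) + 1) * (1 / n))
    (h := fun n : ℕ => 1 / 3 + ((r : ℝ) + 1) * (1 / n)) (by simpa using h.const_sub (1 / 3 : ℝ))
    (by simpa using h.const_add (1 / 3 : ℝ)) ?_ ?_
  all_goals
    filter_upwards [eventually_gt_atTop 0] with n hn
    have hn' : (0 : ℝ) < n := by exact_mod_cast hn
    have h1 : 3 * (((n + r) / 3 : ℕ) : ℝ) ≤ n + r := by exact_mod_cast Nat.mul_div_le (n + r) 3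
    have h2 : (n : ℝ) + r ≤ 3 * (((n + r) / 3 : ℕ) : ℝ) + 2 := by
      have : n + r ≤ 3 * ((n + r) / 3) + 2 := by omega
      exact_mod_cast this
    have hr : (0 : ℝ) ≤ r := r.cast_nonneg
  · rw [le_div_iff₀ hn', sub_mul, mul_assoc, one_div_mul_cancel hn'.ne']
    linarith
  · rw [div_le_iff₀ hn', add_mul, mul_assoc, one_div_mul_cancel hn'.ne']
    linarith

/-- The three residue classes have asymptotic density `1 / 3` each, so a common limit of the
averages along the classes is the limit of the full averages. -/
theorem tendsto_average_mod_three {f : ℕ → ℝ} {a : ℝ}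
    (h : ∀ r < 3, Tendsto (fun n : ℕ => (∑ k ∈ Finset.range n, f (3 * k + r)) / n) atTop (𝓝 a)) :
    Tendsto (fun n : ℕ => (n : ℝ)⁻¹ * ∑ i ∈ Finset.range n, f i) atTop (𝓝 a) := by
  have key : ∀ r < 3, ∀ s, Tendsto (fun n : ℕ => (n : ℝ)⁻¹ *
      ∑ k ∈ Finset.range ((n + s) / 3), f (3 * k + r)) atTop (𝓝 (a * (1 / 3))) := fun r hr s => by
    have ht : Tendsto (fun n : ℕ => (n + s) / 3) atTop atTop :=
      (Nat.tendsto_div_const_atTop (by norm_num)).comp (tendsto_add_atTop_nat s)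
    refine (((h r hr).comp ht).mul (tendsto_div_three_div s)).congr' ?_
    filter_upwards [eventually_ge_atTop 3] with n hn
    have h1 : (((n + s) / 3 : ℕ) : ℝ) ≠ 0 := by
      have : 0 < (n + s) / 3 := Nat.div_pos (by omega) (by norm_num)
      positivity
    have h2 : (n : ℝ) ≠ 0 := by positivity
    simp only [Function.comp]
    field_simp
  have := ((key 0 (by norm_num) 2).add (key 1 (by norm_num) 1)).add (key 2 (by norm_num) 0)
  refine (this.congr fun n => ?_).trans (by rw [show a * (1 / 3) + a * (1 / 3) + a * (1 / 3) = a by ring])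
  rw [sum_range_eq_sum_mod_three f n]
  simp only [add_zero]
  ring

variable {Ω E : Type*} [MeasurableSpace Ω] [MeasurableSpace E] {P : Measure Ω}
  {X : ℕ → Ω → E} {ν : Measure E}

theorem measurePreserving_window [IsProbabilityMeasure P] (hX : ∀ l, Measurable (X l)) (hi : iIndepFun X P)
    (hν : ∀ l, P.map (X l) = ν) (l : ℕ) :
    MeasurePreserving (fun ω => (X l ω, X (l + 1) ω, X (l + 2) ω)) P (ν.prod (ν.prod ν)) := by
  have h2 : P.map (fun ω => (X (l + 1) ω, X (l + 2) ω)) = ν.prod ν := by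
    rw [(indepFun_iff_map_prod_eq_prod_map_map (hX _).aemeasurable (hX _).aemeasurable).1
      (hi.indepFun (by omega : l + 1 ≠ l + 2)), hν, hν]
  refine ⟨(hX l).prodMk ((hX _).prodMk (hX _)), ?_⟩
  rw [(indepFun_iff_map_prod_eq_prod_map_map (hX _).aemeasurable
    ((hX _).prodMk (hX _)).aemeasurable).1
    (hi.indepFun_prodMk hX (l + 1) (l + 2) l (by omega) (by omega)).symm, h2, hν]

/-- Windows whose starting indices differ by at least `3` use disjoint sets of terms. This is why
the strong law is applied along residue classes modulo `3`. -/
theorem indepFun_window (hX : ∀ l, Measurable (X l)) (hi : iIndepFun X P) {i j : ℕ}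
    (hij : i + 3 ≤ j) : IndepFun (fun ω => (X i ω, X (i + 1) ω, X (i + 2) ω))
      (fun ω => (X j ω, X (j + 1) ω, X (j + 2) ω)) P := by
  have h := hi.indepFun_finset {i, i + 1, i + 2} {j, j + 1, j + 2}
    (by simp only [Finset.disjoint_insert_left, Finset.disjoint_singleton_left, Finset.mem_insert,
          Finset.mem_singleton]; omega) hX
  have hm : ∀ k : ℕ, Measurable fun x : (({k, k + 1, k + 2} : Finset ℕ) → E) =>
      (x ⟨k, by simp⟩, x ⟨k + 1, by simp⟩, x ⟨k + 2, by simp⟩) := fun k => by fun_prop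
  exact h.comp (hm i) (hm j)

/-- The strong law of large numbers for functions of three consecutive terms of a sequence of
independent identically distributed variables. -/
theorem tendsto_average_window [IsProbabilityMeasure P] (hX : ∀ l, Measurable (X l)) (hi : iIndepFun X P)
    (hν : ∀ l, P.map (X l) = ν) {F : E × E × E → ℝ} (hF : Measurable F) {a : ℝ}
    (ha : HasMean (ν.prod (ν.prod ν)) F a) :
    ∀ᵐ ω ∂P, Tendsto (fun n : ℕ => (n : ℝ)⁻¹ * ∑ l ∈ Finset.range n,
      F (X l ω, X (l + 1) ω, X (l + 2) ω)) atTop (𝓝 a) := by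
  have hw := measurePreserving_window hX hi hν
  have hid : ∀ k l, IdentDistrib (fun ω => F (X k ω, X (k + 1) ω, X (k + 2) ω))
      (fun ω => F (X l ω, X (l + 1) ω, X (l + 2) ω)) P P := fun k l =>
    (IdentDistrib.mk (hw k).aemeasurable (hw l).aemeasurable
      ((hw k).map_eq.trans (hw l).map_eq.symm)).comp hF
  have h : ∀ r, ∀ᵐ ω ∂P, Tendsto (fun n : ℕ => (∑ k ∈ Finset.range n,
      F (X (3 * k + r) ω, X (3 * k + r + 1) ω, X (3 * k + r + 2) ω)) / n) atTop (𝓝 a) := fun r => by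
    have hm := ha.comp (hw (3 * 0 + r))
    rw [← hm.integral_eq]
    refine strong_law_ae_real
      (fun k ω => F (X (3 * k + r) ω, X (3 * k + r + 1) ω, X (3 * k + r + 2) ω)) hm.integrable ?_
      (fun i => hid _ _)
    intro i j hij
    rcases lt_or_gt_of_ne hij with h | h
    · exact (indepFun_window hX hi (by omega)).comp hF hF
    · exact ((indepFun_window hX hi (by omega)).comp hF hF).symm
  filter_upwards [ae_all_iff.2 h] with ω hω
  exact tendsto_average_mod_three (f := fun l => F (X l ω, X (l + 1) ω, X (l + 2) ω)) fun r _ => hω r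

end Averages

end VacationQueue

namespace VacationQueue

open Set
open scoped ENNReal

namespace CycleData

/-- The length of the service. -/
abbrev srv (x : CycleData) : ℝ := x.1

/-- The age of the completed packet at its completion, up to the age that it had at the start of the
service. -/
abbrev gain (x : CycleData) : ℝ := x.2.1

/-- The indicator that the packet whose service was started is completed. -/
abbrev keep (x : CycleData) : ℝ := x.2.2.1

/-- The length of the vacations. -/
abbrev vac (x : CycleData) : ℝ := x.2.2.2.1

/-- The age of the packet in the buffer at the end of the vacations. -/
abbrev wait (x : CycleData) : ℝ := x.2.2.2.2

end CycleData

/-! ### Moments of the cycle data under the three policies. -/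

section Moments

variable (ρ : Rates) (π : Policy)

/-- The indicator that the buffer is empty at the end of the service. -/
noncomputable def emptied (p : ℝ × ℝ) : ℝ :=
  match π with
  | .cbs | .cbsp => 1
  | .brs => if p.1 ≤ p.2 then 1 else 0

/-- The value of `CycleData.gain` in terms of the variables that govern the service. -/
noncomputable def srvGain (p : ℝ × ℝ) : ℝ :=
  match π with
  | .cbs | .brs => p.1
  | .cbsp => min p.2 p.1

/-- The value of `CycleData.keep` in terms of the variables that govern the service. -/
noncomputable def srvKeep (p : ℝ × ℝ) : ℝ :=
  match π with
  | .cbs | .brs => 1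
  | .cbsp => if p.1 ≤ p.2 then 1 else 0

/-- The age of the packet in the buffer at the end of the service, if any. -/
noncomputable def srvWait (p : ℝ × ℝ) : ℝ :=
  match π with
  | .cbs | .cbsp => 0
  | .brs => if p.2 < p.1 then p.2 else 0

/-- Uniform form of the data in which the variables of the service and those of the vacations appear
as separate factors, so that means are products of means over `srvLaw` and `vacLaw`. -/
theorem cycleVal_eq (z : (ℝ × ℝ) × ℝ × ℝ × ℝ) :
    cycleVal π z = (z.1.1, srvGain π z.1, srvKeep π z.1, emptied π z.1 * z.2.1 + z.2.2.1,
      min z.2.2.2 z.2.2.1 + srvWait π z.1 * if z.2.2.1 ≤ z.2.2.2 then 1 else 0) := by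
  rcases le_or_gt z.1.1 z.1.2 with h | h <;> cases π <;>
    simp [cycleVal, emptied, srvGain, srvKeep, srvWait, h, not_lt.2, not_le.2]

/-- The means of the variables that describe a service. -/
structure SrvMeans (em ga ke wa gaem keem : ℝ) : Prop where
  emptied : HasMean (srvLaw ρ) (emptied π) em
  gain : HasMean (srvLaw ρ) (srvGain π) ga
  keep : HasMean (srvLaw ρ) (srvKeep π) ke
  wait : HasMean (srvLaw ρ) (srvWait π) wa
  gain_emptied : HasMean (srvLaw ρ) (fun p => srvGain π p * VacationQueue.emptied π p) gaem
  keep_emptied : HasMean (srvLaw ρ) (fun p => srvKeep π p * VacationQueue.emptied π p) keem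

theorem hasMean_srv : HasMean (srvLaw ρ) (fun p => p.1) (1 / ρ.mu) :=
  (hasMean_id_expMeasure ρ.mu_pos).fst

theorem hasMean_srv_le : HasMean (srvLaw ρ) (fun p => if p.1 ≤ p.2 then 1 else 0)
    (ρ.mu / (ρ.mu + ρ.lam)) := by
  have h := hasMean_pow_of_fst_le ρ.mu_pos ρ.lam_pos 0
  simp only [pow_zero, Nat.factorial_zero, Nat.cast_one, one_mul, zero_add, pow_one] at h
  exact h

theorem hasMean_srv_min : HasMean (srvLaw ρ) (fun p => min p.2 p.1) (1 / (ρ.mu + ρ.lam)) := by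
  have h := hasMean_min_pow ρ.mu_pos ρ.lam_pos 1
  simp only [pow_one, Nat.factorial_one, Nat.cast_one] at h
  exact h

theorem srvMeans_cbs : SrvMeans ρ .cbs 1 (1 / ρ.mu) 1 0 (1 / ρ.mu) 1 where
  emptied := .const _ _
  gain := hasMean_srv ρ
  keep := .const _ _
  wait := .const _ _
  gain_emptied := by simpa [srvGain, emptied] using hasMean_srv ρ
  keep_emptied := by simpa [srvKeep, emptied] using HasMean.const (srvLaw ρ) 1

theorem srvMeans_brs : SrvMeans ρ .brs (ρ.mu / (ρ.mu + ρ.lam)) (1 / ρ.mu) 1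
    (ρ.lam / (ρ.lam + ρ.mu) ^ 2) (ρ.mu / (ρ.mu + ρ.lam) ^ 2) (ρ.mu / (ρ.mu + ρ.lam)) where
  emptied := hasMean_srv_le ρ
  gain := hasMean_srv ρ
  keep := .const _ _
  wait := by
    have h := hasMean_pow_of_snd_lt ρ.mu_pos ρ.lam_pos 1
    simp only [pow_one, Nat.factorial_one, Nat.cast_one, one_mul, Nat.reduceAdd] at h
    exact h
  gain_emptied := by
    have h := hasMean_pow_of_fst_le ρ.mu_pos ρ.lam_pos 1
    simp only [pow_one, Nat.factorial_one, Nat.cast_one, one_mul, Nat.reduceAdd] at h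
    exact h.congr (.of_forall fun p => by simp [srvGain, emptied])
  keep_emptied := by simpa [srvKeep, emptied] using hasMean_srv_le ρ

theorem srvMeans_cbsp : SrvMeans ρ .cbsp 1 (1 / (ρ.mu + ρ.lam)) (ρ.mu / (ρ.mu + ρ.lam)) 0
    (1 / (ρ.mu + ρ.lam)) (ρ.mu / (ρ.mu + ρ.lam)) where
  emptied := .const _ _
  gain := hasMean_srv_min ρ
  keep := hasMean_srv_le ρ
  wait := .const _ _
  gain_emptied := by simpa [srvGain, emptied] using hasMean_srv_min ρ
  keep_emptied := by simpa [srvKeep, emptied] using hasMean_srv_le ρ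

theorem measurePreserving_cycleVal :
    MeasurePreserving (cycleVal π) (cycleLaw ρ) (dataLaw ρ π) := ⟨measurable_cycleVal π, rfl⟩

variable {ρ π} {em ga ke wa gaem keem : ℝ}

theorem HasMean.of_cycleVal {f : CycleData → ℝ} {a : ℝ} (hf : Measurable f)
    (h : HasMean (cycleLaw ρ) (fun z => f (cycleVal π z)) a) : HasMean (dataLaw ρ π) f a :=
  HasMean.of_comp (measurePreserving_cycleVal ρ π) hf h

theorem hasMean_data_srv : HasMean (dataLaw ρ π) (fun x => x.srv) (1 / ρ.mu) := by
  refine HasMean.of_cycleVal (by fun_prop) ?_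
  simp only [CycleData.srv, cycleVal_eq]
  exact (hasMean_srv ρ).fst

theorem hasMean_data_srv_sq : HasMean (dataLaw ρ π) (fun x => x.srv ^ 2) (2 / ρ.mu ^ 2) := by
  refine HasMean.of_cycleVal (by fun_prop) ?_
  simp only [CycleData.srv, cycleVal_eq]
  exact (hasMean_sq_expMeasure ρ.mu_pos).fst.fst

theorem SrvMeans.data_gain (h : SrvMeans ρ π em ga ke wa gaem keem) :
    HasMean (dataLaw ρ π) (fun x => x.gain) ga := by
  refine HasMean.of_cycleVal (by fun_prop) ?_
  simp only [CycleData.gain, cycleVal_eq]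
  exact h.gain.fst

theorem SrvMeans.data_keep (h : SrvMeans ρ π em ga ke wa gaem keem) :
    HasMean (dataLaw ρ π) (fun x => x.keep) ke := by
  refine HasMean.of_cycleVal (by fun_prop) ?_
  simp only [CycleData.keep, cycleVal_eq]
  exact h.keep.fst

theorem hasMean_vac_fst : HasMean (vacLaw ρ) (fun x => x.1) (1 / ρ.lam) :=
  (hasMean_id_expMeasure ρ.lam_pos).fst

theorem hasMean_vac_snd : HasMean (vacLaw ρ) (fun x => x.2.1) (1 / ρ.v) :=
  (hasMean_id_expMeasure ρ.v_pos).fst.snd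

theorem hasMean_vac_fst_sq : HasMean (vacLaw ρ) (fun x => x.1 ^ 2) (2 / ρ.lam ^ 2) :=
  (hasMean_sq_expMeasure ρ.lam_pos).fst

theorem hasMean_vac_snd_sq : HasMean (vacLaw ρ) (fun x => x.2.1 ^ 2) (2 / ρ.v ^ 2) :=
  (hasMean_sq_expMeasure ρ.v_pos).fst.snd

theorem hasMean_vac_mul : HasMean (vacLaw ρ) (fun x => x.1 * x.2.1) (1 / ρ.lam * (1 / ρ.v)) :=
  (hasMean_id_expMeasure ρ.lam_pos).prod (hasMean_id_expMeasure ρ.v_pos).fst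

theorem SrvMeans.data_vac (h : SrvMeans ρ π em ga ke wa gaem keem) :
    HasMean (dataLaw ρ π) (fun x => x.vac) (em * (1 / ρ.lam) + 1 / ρ.v) := by
  refine HasMean.of_cycleVal (by fun_prop) ?_
  simp only [CycleData.vac, cycleVal_eq]
  exact (h.emptied.prod hasMean_vac_fst).add hasMean_vac_snd.snd

theorem emptied_sq (p : ℝ × ℝ) : emptied π p * emptied π p = emptied π p := by
  cases π <;> simp [emptied]

theorem SrvMeans.data_vac_sq (h : SrvMeans ρ π em ga ke wa gaem keem) :
    HasMean (dataLaw ρ π) (fun x => x.vac ^ 2)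
      (em * (2 / ρ.lam ^ 2) + 2 * (em * (1 / ρ.lam * (1 / ρ.v))) + 2 / ρ.v ^ 2) := by
  refine HasMean.of_cycleVal (by fun_prop) ?_
  simp only [CycleData.vac, cycleVal_eq]
  refine (((h.emptied.prod hasMean_vac_fst_sq).add
    ((h.emptied.prod hasMean_vac_mul).const_mul 2)).add hasMean_vac_snd_sq.snd).congr
    (.of_forall fun z => ?_)
  -- The indicator `emptied` is its own square.
  linear_combination -z.2.1 ^ 2 * emptied_sq (π := π) z.1

theorem SrvMeans.data_gain_vac (h : SrvMeans ρ π em ga ke wa gaem keem) :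
    HasMean (dataLaw ρ π) (fun x => x.gain * x.vac) (gaem * (1 / ρ.lam) + ga * (1 / ρ.v)) := by
  refine HasMean.of_cycleVal (by fun_prop) ?_
  simp only [CycleData.vac, CycleData.gain, cycleVal_eq]
  exact ((h.gain_emptied.prod hasMean_vac_fst).add (h.gain.prod hasMean_vac_snd)).congr
    (.of_forall fun z => by ring)

theorem SrvMeans.data_keep_vac (h : SrvMeans ρ π em ga ke wa gaem keem) :
    HasMean (dataLaw ρ π) (fun x => x.keep * x.vac) (keem * (1 / ρ.lam) + ke * (1 / ρ.v)) := by
  refine HasMean.of_cycleVal (by fun_prop) ?_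
  simp only [CycleData.vac, CycleData.keep, cycleVal_eq]
  exact ((h.keep_emptied.prod hasMean_vac_fst).add (h.keep.prod hasMean_vac_snd)).congr
    (.of_forall fun z => by ring)

theorem hasMean_vac_min (n : ℕ) : HasMean (vacLaw ρ) (fun x => (min x.2.2 x.2.1) ^ n)
    (n.factorial / (ρ.v + ρ.lam) ^ n) :=
  (hasMean_min_pow ρ.v_pos ρ.lam_pos n).snd

theorem hasMean_vac_le : HasMean (vacLaw ρ) (fun x => if x.2.1 ≤ x.2.2 then 1 else 0)
    (ρ.v / (ρ.v + ρ.lam)) := by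
  have h := hasMean_pow_of_fst_le ρ.v_pos ρ.lam_pos 0
  simp only [pow_zero, Nat.factorial_zero, Nat.cast_one, one_mul, zero_add, pow_one] at h
  exact h.snd

theorem SrvMeans.data_wait (h : SrvMeans ρ π em ga ke wa gaem keem) :
    HasMean (dataLaw ρ π) (fun x => x.wait)
      (1 / (ρ.v + ρ.lam) + wa * (ρ.v / (ρ.v + ρ.lam))) := by
  refine HasMean.of_cycleVal (by fun_prop) ?_
  simp only [CycleData.wait, cycleVal_eq]
  have h1 := hasMean_vac_min (ρ := ρ) 1
  simp only [pow_one, Nat.factorial_one, Nat.cast_one] at h1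
  exact h1.snd.add (h.wait.prod hasMean_vac_le)

theorem hasMean_data_wait_sq :
    HasMean (dataLaw ρ .cbs) (fun x => x.wait ^ 2) (2 / (ρ.v + ρ.lam) ^ 2) := by
  refine HasMean.of_cycleVal (by fun_prop) ?_
  simp only [CycleData.wait, cycleVal_eq]
  simpa [srvWait, cycleLaw] using (hasMean_vac_min (ρ := ρ) 2).snd (μ := srvLaw ρ)

theorem hasMean_data_gain_sq :
    HasMean (dataLaw ρ .cbs) (fun x => x.gain ^ 2) (2 / ρ.mu ^ 2) := by
  refine HasMean.of_cycleVal (by fun_prop) ?_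
  simp only [CycleData.gain, cycleVal_eq]
  exact (hasMean_sq_expMeasure ρ.mu_pos).fst.fst

end Moments

/-! ### Means of the peak, the gap and the area. -/

section Windows

/-- The peak of the age at the end of the third of three consecutive services. -/
def peakOf (w : CycleData × CycleData × CycleData) : ℝ :=
  w.2.2.srv + w.2.1.vac + w.2.1.gain + w.2.1.keep * w.1.wait

/-- The time between the second and the third of three consecutive completions. -/
def gapOf (w : CycleData × CycleData × CycleData) : ℝ := w.2.2.srv + w.2.1.vac

/-- The integral of the age between the second and the third of three consecutive completions. -/
noncomputable def areaOf (w : CycleData × CycleData × CycleData) : ℝ :=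
  (w.2.1.gain + w.2.1.keep * w.1.wait) * gapOf w + gapOf w ^ 2 / 2

/-- The law of the data of three consecutive cycles. -/
noncomputable abbrev windowLaw (ρ : Rates) (π : Policy) :
    Measure (CycleData × CycleData × CycleData) :=
  (dataLaw ρ π).prod ((dataLaw ρ π).prod (dataLaw ρ π))

variable {ρ : Rates} {π : Policy} {em ga ke wa gaem keem : ℝ}

theorem SrvMeans.hasMean_gap (h : SrvMeans ρ π em ga ke wa gaem keem) :
    HasMean (windowLaw ρ π) gapOf (1 / ρ.mu + (em * (1 / ρ.lam) + 1 / ρ.v)) :=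
  hasMean_data_srv.snd.snd.add h.data_vac.fst.snd

theorem SrvMeans.hasMean_peak (h : SrvMeans ρ π em ga ke wa gaem keem) :
    HasMean (windowLaw ρ π) peakOf (1 / ρ.mu + (em * (1 / ρ.lam) + 1 / ρ.v) + ga +
      ke * (1 / (ρ.v + ρ.lam) + wa * (ρ.v / (ρ.v + ρ.lam)))) :=
  ((h.hasMean_gap.add h.data_gain.fst.snd).add (h.data_wait.prod h.data_keep.fst)).congr
    (.of_forall fun w => by simp only [peakOf, gapOf]; ring) |>.congr_mean (by ring)

/-- The area is expanded into monomials. Factors from different cycles are independent; within a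
cycle only `gain * vac`, `keep * vac` and squares need the joint moments. -/
theorem SrvMeans.hasMean_area (h : SrvMeans ρ π em ga ke wa gaem keem) {W B : ℝ}
    (hW : em * (1 / ρ.lam) + 1 / ρ.v = W)
    (hB : 1 / (ρ.v + ρ.lam) + wa * (ρ.v / (ρ.v + ρ.lam)) = B) :
    HasMean (windowLaw ρ π) areaOf
      (gaem * (1 / ρ.lam) + ga * (1 / ρ.v) + ga * (1 / ρ.mu) +
        B * (keem * (1 / ρ.lam) + ke * (1 / ρ.v)) + B * (ke * (1 / ρ.mu)) +
        1 / 2 * (em * (2 / ρ.lam ^ 2) + 2 * (em * (1 / ρ.lam * (1 / ρ.v))) + 2 / ρ.v ^ 2) +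
        W * (1 / ρ.mu) + 1 / 2 * (2 / ρ.mu ^ 2)) := by
  subst hW hB
  refine ((((((((h.data_gain_vac.fst (ν := dataLaw ρ π)).snd (μ := dataLaw ρ π)).add
    (h.data_gain.prod hasMean_data_srv).snd).add (h.data_wait.prod h.data_keep_vac.fst)).add
    (h.data_wait.prod (h.data_keep.prod hasMean_data_srv))).add
    (h.data_vac_sq.fst.snd.const_mul (1 / 2))).add
    (h.data_vac.prod hasMean_data_srv).snd).add
    (hasMean_data_srv_sq.snd.snd.const_mul (1 / 2))).congr (.of_forall fun w => ?_)
  simp only [areaOf, gapOf]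
  ring

theorem hasMean_peak_sq_cbs : HasMean (windowLaw ρ .cbs) (fun w => peakOf w ^ 2)
    ((1 / ρ.mu + (1 * (1 / ρ.lam) + 1 / ρ.v) + 1 / ρ.mu +
      1 * (1 / (ρ.v + ρ.lam) + 0 * (ρ.v / (ρ.v + ρ.lam)))) ^ 2 +
      (1 / (ρ.lam + ρ.v) ^ 2 + 1 / ρ.lam ^ 2 + 1 / ρ.v ^ 2 + 2 / ρ.mu ^ 2)) := by
  have h := srvMeans_cbs ρ
  -- Without preemption the packet whose service starts is the one completed, so the peak is linear
  -- in the data and its square needs second moments only.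
  have hk : ∀ᵐ x ∂dataLaw ρ .cbs, x.keep = 1 := by
    rw [dataLaw, ae_map_iff (measurable_cycleVal _).aemeasurable
      (measurableSet_eq_fun (by fun_prop) (by fun_prop))]
    exact .of_forall fun z => rfl
  have hk' : ∀ᵐ w ∂windowLaw ρ .cbs, w.2.1.keep = 1 := by
    have h1 : ∀ᵐ w ∂(dataLaw ρ .cbs).prod (dataLaw ρ .cbs), w.1.keep = 1 :=
      Measure.quasiMeasurePreserving_fst.ae hk
    exact Measure.quasiMeasurePreserving_snd.ae h1
  have hD : HasMean (dataLaw ρ .cbs) (fun x => x.srv) (1 / ρ.mu) := hasMean_data_srv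
  have hDD : HasMean (dataLaw ρ .cbs) (fun x => x.srv ^ 2) (2 / ρ.mu ^ 2) := hasMean_data_srv_sq
  refine (((((((((hDD.snd.snd).add (h.data_vac_sq.fst.snd)).add
    (hasMean_data_gain_sq.fst.snd)).add (hasMean_data_wait_sq.fst)).add
    ((h.data_vac.prod hD).snd.const_mul 2)).add ((h.data_gain.prod hD).snd.const_mul 2)).add
    ((h.data_wait.prod hD.snd).const_mul 2)).add ((h.data_gain_vac.fst.snd).const_mul 2)).add
    (((h.data_wait.prod h.data_vac.fst).const_mul 2).add
      ((h.data_wait.prod h.data_gain.fst).const_mul 2))).congr_mean ?_ |>.congr ?_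
  · have := ρ.lam_pos
    have := ρ.mu_pos
    have := ρ.v_pos
    field_simp
    ring
  · filter_upwards [hk'] with w hw
    rw [peakOf, hw]
    ring

end Windows

end VacationQueue

namespace VacationQueue

open Set
open scoped ENNReal

/-! ### The age as a deterministic path. -/

section AgePath

/-- The age at time `t`, given completion times `C` and generation times `r`. -/
noncomputable def ageOf (C r : ℕ → ℝ) (t : ℝ) : ℝ := t - sSup {x | ∃ l, C l ≤ t ∧ x = r l}

/-- Completion times `C` and generation times `r` of packets that are completed in the order of
their generation. -/
structure Deliveries (C r : ℕ → ℝ) : Prop where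
  zero : C 0 = 0
  mono : Monotone C
  mono_gen : Monotone r
  gen_le : ∀ l, r l ≤ C l
  tendsto : Tendsto C atTop atTop

namespace Deliveries

variable {C r : ℕ → ℝ} (h : Deliveries C r)

include h

theorem bddAbove (t : ℝ) : BddAbove {x | ∃ l, C l ≤ t ∧ x = r l} :=
  ⟨t, by rintro x ⟨l, hl, rfl⟩; exact (h.gen_le l).trans hl⟩

theorem nonempty {t : ℝ} (ht : 0 ≤ t) : {x | ∃ l, C l ≤ t ∧ x = r l}.Nonempty :=
  ⟨r 0, 0, by rwa [h.zero], rfl⟩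

/-- The age is at least `x` exactly if nothing generated after `t - x` has been completed by time
`t`. This form is compared later with the survival events of the chain. -/
theorem le_ageOf_iff {t x : ℝ} (ht : 0 ≤ t) : x ≤ ageOf C r t ↔ ∀ l, C l ≤ t → r l ≤ t - x := by
  rw [ageOf, le_sub_comm, csSup_le_iff (h.bddAbove t) (h.nonempty ht)]
  exact ⟨fun H l hl => H _ ⟨l, hl, rfl⟩, by rintro H _ ⟨l, hl, rfl⟩; exact H l hl⟩

theorem ageOf_nonneg {t : ℝ} (ht : 0 ≤ t) : 0 ≤ ageOf C r t := by
  rw [h.le_ageOf_iff ht, sub_zero]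
  exact fun l hl => (h.gen_le l).trans hl

theorem ageOf_eq {t : ℝ} {l : ℕ} (h1 : C l ≤ t) (h2 : t < C (l + 1)) : ageOf C r t = t - r l := by
  rw [ageOf]
  congr 1
  refine IsGreatest.csSup_eq ⟨⟨l, h1, rfl⟩, ?_⟩
  rintro x ⟨k, hk, rfl⟩
  refine h.mono_gen ?_
  by_contra! hc
  have := h.mono (Nat.succ_le_of_lt hc)
  exact absurd (h2.trans_le (this.trans hk)) (lt_irrefl _)

/-- The age is the identity minus the generation time of the freshest completed packet, which is
monotone in `t`. -/
theorem intervalIntegrable {s t : ℝ} (hs : 0 ≤ s) (ht : 0 ≤ t) :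
    IntervalIntegrable (ageOf C r) volume s t := by
  have hm : MonotoneOn (fun t => sSup {x | ∃ l, C l ≤ t ∧ x = r l}) (uIcc s t) := by
    intro a ha b _ hab
    have ha0 : 0 ≤ a := (le_min hs ht).trans ha.1
    exact csSup_le_csSup (h.bddAbove b) (h.nonempty ha0)
      fun x ⟨l, hl, hx⟩ => ⟨l, hl.trans hab, hx⟩
  exact intervalIntegral.intervalIntegrable_id.sub hm.intervalIntegrable

theorem nonneg (l : ℕ) : 0 ≤ C l := h.zero ▸ h.mono l.zero_le

theorem integral_ageOf (l : ℕ) : ∫ t in C l..C (l + 1), ageOf C r t =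
    ((C (l + 1) - r l) ^ 2 - (C l - r l) ^ 2) / 2 := by
  have hle := h.mono l.le_succ
  have : ∫ t in C l..C (l + 1), ageOf C r t = ∫ t in C l..C (l + 1), (t - r l) := by
    refine intervalIntegral.integral_congr_ae ?_
    filter_upwards [Measure.ae_ne volume (C (l + 1))] with t ht hmem
    rw [uIoc_of_le hle] at hmem
    exact h.ageOf_eq hmem.1.le (lt_of_le_of_ne hmem.2 ht)
  rw [this, intervalIntegral.integral_sub intervalIntegral.intervalIntegrable_id
      intervalIntegrable_const,
    integral_id, intervalIntegral.integral_const, smul_eq_mul]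
  ring

theorem integral_ageOf_zero (n : ℕ) : ∫ t in (0 : ℝ)..C n, ageOf C r t =
    ∑ l ∈ Finset.range n, ((C (l + 1) - r l) ^ 2 - (C l - r l) ^ 2) / 2 := by
  have := intervalIntegral.sum_integral_adjacent_intervals (f := ageOf C r) (μ := volume) (a := C)
    (n := n) fun k _ => h.intervalIntegrable (h.nonneg k) (h.nonneg (k + 1))
  rw [h.zero] at this
  rw [← this]
  exact Finset.sum_congr rfl fun l _ => h.integral_ageOf l

theorem integral_mono {s t : ℝ} (hs : 0 ≤ s) (hst : s ≤ t) :
    ∫ t in (0 : ℝ)..s, ageOf C r t ≤ ∫ t in (0 : ℝ)..t, ageOf C r t := by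
  have ht := hs.trans hst
  rw [← intervalIntegral.integral_add_adjacent_intervals (h.intervalIntegrable le_rfl hs)
    (h.intervalIntegrable hs ht)]
  refine le_add_of_nonneg_right (intervalIntegral.integral_nonneg hst fun u hu => ?_)
  exact h.ageOf_nonneg (hs.trans hu.1)

/-- Every time lies between two completions. -/
theorem exists_between : ∃ N : ℝ → ℕ, Tendsto N atTop atTop ∧
    ∀ t, 0 ≤ t → C (N t) ≤ t ∧ t < C (N t + 1) := by
  have hex : ∀ t, 0 ≤ t → ∃ n, C n ≤ t ∧ t < C (n + 1) := fun t ht => by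
    classical
    have he : ∃ n, t < C n := (h.tendsto.eventually_gt_atTop t).exists
    obtain ⟨n, hn⟩ : ∃ n, Nat.find he = n + 1 := Nat.exists_eq_succ_of_ne_zero fun h0 => by
      have := Nat.find_spec he
      rw [h0, h.zero] at this
      exact absurd ht (not_le.2 this)
    refine ⟨n, not_lt.1 (Nat.find_min he (by omega)), ?_⟩
    rw [← hn]
    exact Nat.find_spec he
  choose! N hN using hex
  refine ⟨N, tendsto_atTop.2 fun n => ?_, hN⟩
  filter_upwards [eventually_ge_atTop (C n)] with t ht
  by_contra! hc
  have h1 := (hN t ((h.nonneg n).trans ht)).2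
  have h2 := h.mono (Nat.succ_le_of_lt hc)
  exact absurd (h1.trans_le (h2.trans ht)) (lt_irrefl _)

/-- The integral of the nonnegative age up to `τ` lies between its values at the neighbouring
completions `C n ≤ τ < C (n + 1)`. Both bounds, divided by the opposite completion times, converge
to `q / y`, since a shift of the index by one is negligible. -/
theorem tendsto_timeAverage {q y : ℝ} (hy : 0 < y)
    (hC : Tendsto (fun n : ℕ => (n : ℝ)⁻¹ * C n) atTop (𝓝 y))
    (hq : Tendsto (fun n : ℕ => (n : ℝ)⁻¹ * ∑ l ∈ Finset.range n,
      ((C (l + 1) - r l) ^ 2 - (C l - r l) ^ 2) / 2) atTop (𝓝 q)) :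
    Tendsto (fun τ : ℝ => τ⁻¹ * ∫ t in (0 : ℝ)..τ, ageOf C r t) atTop (𝓝 (q / y)) := by
  obtain ⟨N, hN, hbet⟩ := h.exists_between
  simp only [← h.integral_ageOf_zero] at hq
  let F : ℝ → ℝ := fun τ => ∫ t in (0 : ℝ)..τ, ageOf C r t
  have hF : ∀ n, F (C n) = ∫ t in (0 : ℝ)..C n, ageOf C r t := fun _ => rfl
  simp only [← hF] at hq
  have hratio : Tendsto (fun n : ℕ => ((n + 1 : ℕ) : ℝ)⁻¹ * n) atTop (𝓝 1) := by
    refine (tendsto_natCast_div_add_atTop (1 : ℝ)).congr fun n => ?_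
    push_cast
    rw [div_eq_inv_mul]
  have hC' : Tendsto (fun n : ℕ => (n : ℝ)⁻¹ * C (n + 1)) atTop (𝓝 y) := by
    have h1 := (hC.comp (tendsto_add_atTop_nat 1)).div hratio one_ne_zero
    rw [div_one] at h1
    refine h1.congr' ?_
    filter_upwards [eventually_gt_atTop 0] with n hn
    have : (n : ℝ) ≠ 0 := by positivity
    simp only [Pi.div_apply, Function.comp]
    push_cast
    field_simp
  have hq' : Tendsto (fun n : ℕ => (n : ℝ)⁻¹ * F (C (n + 1))) atTop (𝓝 q) := by
    have h1 := (hq.comp (tendsto_add_atTop_nat 1)).div hratio one_ne_zero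
    rw [div_one] at h1
    refine h1.congr' ?_
    filter_upwards [eventually_gt_atTop 0] with n hn
    have : (n : ℝ) ≠ 0 := by positivity
    simp only [Pi.div_apply, Function.comp]
    push_cast
    field_simp
  have hlow := (hq.div hC' hy.ne').comp hN
  have hupp := (hq'.div hC hy.ne').comp hN
  refine tendsto_of_tendsto_of_tendsto_of_le_of_le' hlow hupp ?_ ?_
  all_goals
    filter_upwards [hN.eventually_gt_atTop 0,
      hN.eventually (hC.eventually (eventually_gt_nhds hy)), eventually_gt_atTop 0]
      with t ht hpos ht0
    obtain ⟨hb1, hb2⟩ := hbet t ht0.le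
    have hn : (0 : ℝ) < N t := by exact_mod_cast ht
    have hCn : 0 < C (N t) := by
      rw [inv_mul_eq_div] at hpos
      exact (div_pos_iff_of_pos_right hn).1 hpos
    simp only [Pi.div_apply, Function.comp]
  · have h1 : F (C (N t)) ≤ F t := h.integral_mono hCn.le hb1
    have h0 : 0 ≤ F (C (N t)) := by
      simpa [F] using h.integral_mono le_rfl hCn.le
    have e : (N t : ℝ)⁻¹ * F (C (N t)) / ((N t : ℝ)⁻¹ * C (N t + 1)) =
        (C (N t + 1))⁻¹ * F (C (N t)) := by field_simp
    rw [e]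
    exact mul_le_mul (inv_anti₀ ht0 hb2.le) h1 h0 (inv_nonneg.2 ht0.le)
  · have h1 : F t ≤ F (C (N t + 1)) := h.integral_mono ht0.le hb2.le
    have h0 : 0 ≤ F t := by
      simpa [F] using h.integral_mono le_rfl ht0.le
    have e : (N t : ℝ)⁻¹ * F (C (N t + 1)) / ((N t : ℝ)⁻¹ * C (N t)) =
        (C (N t))⁻¹ * F (C (N t + 1)) := by field_simp
    rw [e]
    exact mul_le_mul (inv_anti₀ hCn hb1) h1 h0 (inv_nonneg.2 hCn.le)

end Deliveries

/-- Finitely many initial terms vanish in the average; two are skipped because the first two peaks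
still depend on the initial state. -/
theorem tendsto_average_of_shift {f g : ℕ → ℝ} {a : ℝ} (hfg : ∀ l, f (l + 2) = g l)
    (hg : Tendsto (fun n : ℕ => (n : ℝ)⁻¹ * ∑ l ∈ Finset.range n, g l) atTop (𝓝 a)) :
    Tendsto (fun n : ℕ => (n : ℝ)⁻¹ * ∑ l ∈ Finset.range n, f l) atTop (𝓝 a) := by
  rw [← tendsto_add_atTop_iff_nat 2]
  have h1 : Tendsto (fun n : ℕ => (n : ℝ) / (n + 2)) atTop (𝓝 1) :=
    tendsto_natCast_div_add_atTop (2 : ℝ)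
  have h2 : Tendsto (fun n : ℕ => (((n + 2 : ℕ) : ℝ))⁻¹ * (f 0 + f 1)) atTop (𝓝 (0 * (f 0 + f 1))) :=
    ((tendsto_inv_atTop_nhds_zero_nat (𝕜 := ℝ)).comp (tendsto_add_atTop_nat 2)).mul_const _
  have h3 := (h1.mul hg).add h2
  rw [zero_mul, add_zero, one_mul] at h3
  refine h3.congr' ?_
  filter_upwards [eventually_gt_atTop 0] with n hn
  have : (n : ℝ) ≠ 0 := by positivity
  rw [Finset.sum_range_succ', Finset.sum_range_succ']
  simp only [hfg]
  push_cast
  field_simp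
  ring

end AgePath

end VacationQueue

namespace VacationQueue

open Set
open scoped ENNReal

/-! ### Peaks, completions and areas as functions of consecutive cycles. -/

section PeakAge

variable (ρ : Rates) (π : Policy) (a₀ : ℝ)

/-- The completion times, in terms of the initial clock. -/
noncomputable def compl (e : Clock) (l : ℕ) : ℝ := (service π a₀ l e).1.lastCompl

/-- The generation times of the completed packets, in terms of the initial clock. -/
noncomputable def gen (e : Clock) (l : ℕ) : ℝ := (service π a₀ l e).1.lastGen

/-- The peaks of the age, in terms of the initial clock. -/
noncomputable def peakAt (l : ℕ) (e : Clock) : ℝ := compl π a₀ e (l + 1) - gen π a₀ e l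

@[fun_prop]
theorem measurable_compl (l : ℕ) : Measurable fun e => compl π a₀ e l :=
  (by fun_prop : Measurable fun s : Obs => s.lastCompl).comp (measurable_service π a₀ l).fst

@[fun_prop]
theorem measurable_gen (l : ℕ) : Measurable fun e => gen π a₀ e l :=
  (by fun_prop : Measurable fun s : Obs => s.lastGen).comp (measurable_service π a₀ l).fst

@[fun_prop]
theorem measurable_peakAt (l : ℕ) : Measurable (peakAt π a₀ l) := by
  unfold peakAt; fun_prop

/-- The data of three consecutive cycles, in terms of the initial clock. -/
noncomputable def window (l : ℕ) (e : Clock) : CycleData × CycleData × CycleData :=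
  (serviceData π a₀ l e, serviceData π a₀ (l + 1) e, serviceData π a₀ (l + 2) e)

theorem measurePreserving_serviceData (l : ℕ) :
    MeasurePreserving (serviceData π a₀ l) (initLaw ρ) (dataLaw ρ π) :=
  ⟨measurable_serviceData π a₀ l, map_serviceData ρ π a₀ l⟩

theorem measurePreserving_serviceWindow (l : ℕ) :
    MeasurePreserving (window π a₀ l) (initLaw ρ) (windowLaw ρ π) :=
  measurePreserving_window (measurable_serviceData π a₀) (iIndepFun_serviceData ρ π a₀)
    (map_serviceData ρ π a₀) l

theorem ae_service_zero {p : Obs → Prop} (hp : MeasurableSet {s | p s})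
    (h : ∀ x : ℝ × ℝ × ℝ, 0 < x.1 ∧ 0 < x.2.1 ∧ 0 < x.2.2 → p ((initObs a₀).vacation π x)) :
    ∀ᵐ e ∂initLaw ρ, p (service π a₀ 0 e).1 := by
  have h1 : ∀ᵐ s ∂(initLaw ρ).map (fun e => (service π a₀ 0 e).1), p s := by
    rw [map_service_zero, ae_map_iff (by fun_prop) hp]
    filter_upwards [ae_vacLaw_pos ρ] with x hx using h x hx
  rwa [ae_map_iff (measurable_service π a₀ 0).fst.aemeasurable hp] at h1

attribute [local simp] Obs.now Obs.inService Obs.inBuffer Obs.lastCompl Obs.lastGen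

theorem ae_service_zero_eq : ∀ᵐ e ∂initLaw ρ, (service π a₀ 0 e).1.lastCompl = 0 ∧
    (service π a₀ 0 e).1.lastGen = -a₀ ∧ 0 ≤ (service π a₀ 0 e).1.inService ∧
    (service π a₀ 0 e).1.inService ≤ (service π a₀ 0 e).1.now := by
  have hm : MeasurableSet {s : Obs | s.lastCompl = 0 ∧ s.lastGen = -a₀ ∧ 0 ≤ s.inService ∧
      s.inService ≤ s.now} := by
    have m1 : Measurable fun s : Obs => s.lastCompl := by fun_prop
    have m2 : Measurable fun s : Obs => s.lastGen := by fun_prop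
    have m3 : Measurable fun s : Obs => s.inService := by fun_prop
    have m4 : Measurable fun s : Obs => s.now := by fun_prop
    exact (measurableSet_eq_fun m1 measurable_const).inter
      ((measurableSet_eq_fun m2 measurable_const).inter
        ((measurableSet_le measurable_const m3).inter (measurableSet_le m3 m4)))
  refine ae_service_zero ρ π a₀ hm fun x ⟨h1, h2, h3⟩ => ?_
  rw [initObs_vacation]
  have h4 : 0 < min x.2.2 x.2.1 := lt_min h3 h2
  have h5 : min x.2.2 x.2.1 ≤ x.2.1 := min_le_right _ _
  refine ⟨rfl, rfl, ?_, ?_⟩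
  · simp only [Obs.inService]; linarith
  · simp only [Obs.inService, Obs.now]; linarith

/-- If the packet completed was already there at the start of the service, its age is the service
time plus its age at that start; otherwise it was generated during the service and `keep` is zero.
-/
theorem Consecutive.age_eq {s t : Obs} (h : Consecutive s t) : t.lastCompl - t.lastGen =
    (cycleData s t).gain + (cycleData s t).keep * (s.now - s.inService) := by
  by_cases hle : t.lastGen ≤ s.now
  · simp only [cycleData, hle, if_true]
    rw [h.eq_of_le hle]; ring
  · simp [cycleData, hle]

variable {π a₀} {e : Clock}

theorem compl_succ (l : ℕ) :
    compl π a₀ e (l + 1) = (service π a₀ l e).1.now + (serviceData π a₀ l e).srv := by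
  simp only [compl, serviceData, cycleData]; ring

theorem now_succ (l : ℕ) :
    (service π a₀ (l + 1) e).1.now = compl π a₀ e (l + 1) + (serviceData π a₀ l e).vac := by
  simp only [compl, serviceData, cycleData]; ring

theorem wait_succ (l : ℕ) : (service π a₀ (l + 1) e).1.now - (service π a₀ (l + 1) e).1.inService =
    (serviceData π a₀ l e).wait := rfl

theorem gap_eq (l : ℕ) :
    compl π a₀ e (l + 3) - compl π a₀ e (l + 2) = gapOf (window π a₀ l e) := by
  rw [compl_succ (l + 2), now_succ (l + 1)]
  simp only [gapOf, window]
  ring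

section

variable (h : ∀ l, Consecutive (service π a₀ l e).1 (service π a₀ (l + 1) e).1)

include h

theorem age_succ (l : ℕ) : compl π a₀ e (l + 1) - gen π a₀ e (l + 1) =
    (serviceData π a₀ l e).gain + (serviceData π a₀ l e).keep *
      ((service π a₀ l e).1.now - (service π a₀ l e).1.inService) := (h l).age_eq

theorem peakAt_succ (l : ℕ) : peakAt π a₀ (l + 1) e = (serviceData π a₀ (l + 1) e).srv +
    (serviceData π a₀ l e).vac + ((serviceData π a₀ l e).gain + (serviceData π a₀ l e).keep *
      ((service π a₀ l e).1.now - (service π a₀ l e).1.inService)) := by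
  rw [← age_succ h, peakAt, compl_succ (l + 1), now_succ l]
  ring

theorem peakAt_add_two (l : ℕ) : peakAt π a₀ (l + 2) e = peakOf (window π a₀ l e) := by
  rw [peakAt_succ h (l + 1), wait_succ]
  simp only [peakOf, window]
  ring

theorem area_eq (l : ℕ) :
    ((compl π a₀ e (l + 3) - gen π a₀ e (l + 2)) ^ 2 -
      (compl π a₀ e (l + 2) - gen π a₀ e (l + 2)) ^ 2) / 2 = areaOf (window π a₀ l e) := by
  have h1 := age_succ h (l + 1)
  rw [wait_succ] at h1
  have h2 := gap_eq (π := π) (a₀ := a₀) (e := e) l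
  have h3 : compl π a₀ e (l + 3) = compl π a₀ e (l + 2) + gapOf (window π a₀ l e) := by linarith
  rw [h3, areaOf]
  have h4 : compl π a₀ e (l + 2) - gen π a₀ e (l + 2) = (window π a₀ l e).2.1.gain +
    (window π a₀ l e).2.1.keep * (window π a₀ l e).1.wait := h1
  rw [← h4]
  ring

end

theorem memLp_of_hasMean_sq {α : Type*} [MeasurableSpace α] {μ : Measure α} {f : α → ℝ} {a : ℝ}
    (hm : Measurable f) (h : HasMean μ (fun x => f x ^ 2) a) : MemLp f 2 μ :=
  (memLp_two_iff_integrable_sq hm.aestronglyMeasurable).2 h.integrable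

theorem ae_keep : ∀ᵐ x ∂dataLaw ρ π, |x.keep| ≤ 1 := by
  rw [dataLaw, ae_map_iff (measurable_cycleVal π).aemeasurable
    (measurableSet_le (by fun_prop) (by fun_prop))]
  refine .of_forall fun z => ?_
  rw [cycleVal_eq]
  cases π <;> simp only [CycleData.keep, srvKeep, abs_one, le_refl]
  split_ifs <;> simp

theorem ae_gain : ∀ᵐ x ∂dataLaw ρ π, |x.gain| ≤ |x.srv| := by
  rw [dataLaw, ae_map_iff (measurable_cycleVal π).aemeasurable
    (measurableSet_le (by fun_prop) (by fun_prop))]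
  filter_upwards [ae_cycleLaw_pos ρ] with z hz
  rw [cycleVal_eq]
  cases π <;> simp only [CycleData.gain, CycleData.srv, srvGain, le_refl]
  rw [abs_of_pos (lt_min hz.2.1 hz.1), abs_of_pos hz.1]
  exact min_le_right _ _

variable (a₀)

theorem memLp_srv (l : ℕ) : MemLp (fun e => (serviceData π a₀ l e).srv) 2 (initLaw ρ) :=
  (memLp_of_hasMean_sq (by fun_prop) hasMean_data_srv_sq).comp_measurePreserving
    (measurePreserving_serviceData ρ π a₀ l)

theorem memLp_gain (l : ℕ) : MemLp (fun e => (serviceData π a₀ l e).gain) 2 (initLaw ρ) := by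
  have h : MemLp (fun x : CycleData => x.gain) 2 (dataLaw ρ π) :=
    (memLp_of_hasMean_sq (by fun_prop) hasMean_data_srv_sq).mono
      (by fun_prop : Measurable fun x : CycleData => x.gain).aestronglyMeasurable (ae_gain ρ)
  exact h.comp_measurePreserving (measurePreserving_serviceData ρ π a₀ l)

theorem exists_srvMeans (π : Policy) :
    ∃ em ga ke wa gaem keem, SrvMeans ρ π em ga ke wa gaem keem := by
  cases π
  · exact ⟨_, _, _, _, _, _, srvMeans_cbs ρ⟩
  · exact ⟨_, _, _, _, _, _, srvMeans_brs ρ⟩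
  · exact ⟨_, _, _, _, _, _, srvMeans_cbsp ρ⟩

theorem memLp_vac (l : ℕ) : MemLp (fun e => (serviceData π a₀ l e).vac) 2 (initLaw ρ) := by
  obtain ⟨_, _, _, _, _, _, h⟩ := exists_srvMeans ρ π
  exact (memLp_of_hasMean_sq (by fun_prop) h.data_vac_sq).comp_measurePreserving
    (measurePreserving_serviceData ρ π a₀ l)

theorem memLp_service_zero {f : Obs → ℝ} (hf : Measurable f)
    (h : MemLp (fun x => f ((initObs a₀).vacation π x)) 2 (vacLaw ρ)) :
    MemLp (fun e => f (service π a₀ 0 e).1) 2 (initLaw ρ) := by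
  have h1 : MemLp f 2 ((initLaw ρ).map fun e => (service π a₀ 0 e).1) := by
    rw [map_service_zero]
    exact (memLp_map_measure_iff hf.aestronglyMeasurable (by fun_prop)).2 h
  exact (memLp_map_measure_iff hf.aestronglyMeasurable
    (measurable_service π a₀ 0).fst.aemeasurable).1 h1

theorem memLp_now_zero : MemLp (fun e => (service π a₀ 0 e).1.now) 2 (initLaw ρ) := by
  refine memLp_service_zero (f := fun s => s.now) ρ a₀ (by fun_prop) ?_
  simp only [initObs_vacation]
  exact (memLp_of_hasMean_sq (by fun_prop) hasMean_vac_fst_sq).add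
    (memLp_of_hasMean_sq (by fun_prop) hasMean_vac_snd_sq)

theorem memLp_wait_zero :
    MemLp (fun e => (service π a₀ 0 e).1.now - (service π a₀ 0 e).1.inService) 2 (initLaw ρ) := by
  refine memLp_service_zero (f := fun s => s.now - s.inService) ρ a₀ (by fun_prop) ?_
  simp only [initObs_vacation]
  have h : MemLp (fun x : ℝ × ℝ × ℝ => min x.2.2 x.2.1) 2 (vacLaw ρ) :=
    memLp_of_hasMean_sq (by fun_prop) (hasMean_vac_min 2)
  refine h.ae_eq (.of_forall fun x => ?_)
  simp

/-- The first two peaks contain the initial age and the first vacations instead of data of earlier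
cycles, and their square integrability is checked directly. -/
theorem memLp_peakAt_zero : MemLp (peakAt π a₀ 0) 2 (initLaw ρ) := by
  refine (((memLp_srv (π := π) ρ a₀ 0).add (memLp_now_zero (π := π) ρ a₀)).add (memLp_const a₀)).ae_eq ?_
  filter_upwards [ae_service_zero_eq ρ π a₀] with e he
  rw [peakAt, gen, he.2.1, compl_succ]
  simp only [Pi.add_apply]
  ring

theorem memLp_peakAt_one : MemLp (peakAt π a₀ 1) 2 (initLaw ρ) := by
  have hk : MemLp (fun e => (serviceData π a₀ 0 e).keep *
      ((service π a₀ 0 e).1.now - (service π a₀ 0 e).1.inService)) 2 (initLaw ρ) := by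
    refine (memLp_wait_zero (π := π) ρ a₀).mono ?_ ?_
    · have h1 : Measurable fun e => (serviceData π a₀ 0 e).keep :=
        (by fun_prop : Measurable fun x : CycleData => x.keep).comp (measurable_serviceData π a₀ 0)
      have h2 : Measurable fun e =>
          (service π a₀ 0 e).1.now - (service π a₀ 0 e).1.inService :=
        (by fun_prop : Measurable fun s : Obs => s.now - s.inService).comp
          (measurable_service π a₀ 0).fst
      exact (h1.mul h2).aestronglyMeasurable
    · filter_upwards [(measurePreserving_serviceData ρ π a₀ 0).quasiMeasurePreserving.ae
        (ae_keep ρ)] with e he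
      rw [norm_mul]
      exact mul_le_of_le_one_left (norm_nonneg _) he
  refine (((memLp_srv (π := π) ρ a₀ 1).add (memLp_vac (π := π) ρ a₀ 0)).add ((memLp_gain (π := π) ρ a₀ 0).add hk)).ae_eq ?_
  filter_upwards [ae_consecutive ρ π a₀] with e he
  rw [peakAt_succ he 0]
  rfl

theorem hasMean_peakAt {a : ℝ} (h : HasMean (windowLaw ρ π) peakOf a) (l : ℕ) :
    HasMean (initLaw ρ) (peakAt π a₀ (l + 2)) a := by
  refine (h.comp (measurePreserving_serviceWindow ρ π a₀ l)).congr ?_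
  filter_upwards [ae_consecutive ρ π a₀] with e he
  rw [peakAt_add_two he]

theorem measurable_peakOf : Measurable peakOf := by unfold peakOf; fun_prop
theorem measurable_gapOf : Measurable gapOf := by unfold gapOf; fun_prop
theorem measurable_areaOf : Measurable areaOf := by
  have := measurable_gapOf
  unfold areaOf; fun_prop

theorem hasPAoI_peakAt {a : ℝ} (h : HasMean (windowLaw ρ π) peakOf a) :
    HasPAoI (initLaw ρ) (peakAt π a₀) a where
  average := by
    filter_upwards [ae_consecutive ρ π a₀, tendsto_average_window (measurable_serviceData π a₀)
      (iIndepFun_serviceData ρ π a₀) (map_serviceData ρ π a₀) measurable_peakOf h] with e he h1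
    exact tendsto_average_of_shift (f := fun l => peakAt π a₀ l e) (peakAt_add_two he) h1
  integrable l := by
    match l with
    | 0 => exact (memLp_peakAt_zero ρ a₀).integrable one_le_two
    | 1 => exact (memLp_peakAt_one ρ a₀).integrable one_le_two
    | l + 2 => exact (hasMean_peakAt ρ a₀ h l).integrable
  mean := by
    refine tendsto_const_nhds.congr' ?_
    filter_upwards [eventually_ge_atTop 2] with l hl
    obtain ⟨k, rfl⟩ := Nat.exists_eq_add_of_le' hl
    rw [(hasMean_peakAt ρ a₀ h k).integral_eq]

/-- From the third peak on all peaks have the same first two moments, so the variance is eventually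
constant. -/
theorem hasPeakVariance_peakAt {a b : ℝ} (h : HasMean (windowLaw ρ π) peakOf a)
    (h2 : HasMean (windowLaw ρ π) (fun w => peakOf w ^ 2) (a ^ 2 + b)) :
    HasPeakVariance (initLaw ρ) (peakAt π a₀) b := by
  have hsq : ∀ l, HasMean (initLaw ρ) (fun e => peakAt π a₀ (l + 2) e ^ 2) (a ^ 2 + b) := fun l => by
    refine (h2.comp (measurePreserving_serviceWindow ρ π a₀ l)).congr ?_
    filter_upwards [ae_consecutive ρ π a₀] with e he
    rw [peakAt_add_two he]
  have hmem : ∀ l, MemLp (peakAt π a₀ l) 2 (initLaw ρ) := fun l => by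
    match l with
    | 0 => exact memLp_peakAt_zero ρ a₀
    | 1 => exact memLp_peakAt_one ρ a₀
    | l + 2 => exact memLp_of_hasMean_sq (by fun_prop) (hsq l)
  refine ⟨hmem, ?_⟩
  refine tendsto_const_nhds.congr' ?_
  filter_upwards [eventually_ge_atTop 2] with l hl
  obtain ⟨k, rfl⟩ := Nat.exists_eq_add_of_le' hl
  rw [variance_eq_sub (hmem _), (hasMean_peakAt ρ a₀ h k).integral_eq]
  have := (hsq k).integral_eq
  simp only [Pi.pow_apply]
  rw [this]
  ring

variable {a₀}

/-- The completion times and the generation times of the completed packets are as they should be,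
and the age has a time average. -/
theorem ae_deliveries (ha₀ : 0 ≤ a₀) {y q : ℝ} (hy : 0 < y)
    (h : HasMean (windowLaw ρ π) gapOf y) (hq : HasMean (windowLaw ρ π) areaOf q) :
    ∀ᵐ e ∂initLaw ρ, Deliveries (compl π a₀ e) (gen π a₀ e) ∧
      Tendsto (fun τ : ℝ => τ⁻¹ * ∫ t in (0 : ℝ)..τ, ageOf (compl π a₀ e) (gen π a₀ e) t) atTop
        (𝓝 (q / y)) := by
  filter_upwards [ae_consecutive ρ π a₀, ae_service_zero_eq ρ π a₀,
    tendsto_average_window (measurable_serviceData π a₀) (iIndepFun_serviceData ρ π a₀)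
      (map_serviceData ρ π a₀) measurable_gapOf h,
    tendsto_average_window (measurable_serviceData π a₀) (iIndepFun_serviceData ρ π a₀)
      (map_serviceData ρ π a₀) measurable_areaOf hq] with e he h0 h1 h2
  have hsum : ∀ n, ∑ l ∈ Finset.range n, (compl π a₀ e (l + 1) - compl π a₀ e l) =
      compl π a₀ e n := fun n => by
    rw [Finset.sum_range_sub]
    simp [compl, h0.1]
  have hC : Tendsto (fun n : ℕ => (n : ℝ)⁻¹ * compl π a₀ e n) atTop (𝓝 y) := by
    have := tendsto_average_of_shift (f := fun l => compl π a₀ e (l + 1) - compl π a₀ e l)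
      gap_eq h1
    simpa only [hsum] using this
  have hnow : ∀ l, (service π a₀ l e).1.lastCompl ≤ (service π a₀ l e).1.now ∧
      (service π a₀ l e).1.lastGen ≤ (service π a₀ l e).1.inService ∧
      gen π a₀ e l ≤ compl π a₀ e l := fun l => by
    cases l with
    | zero =>
      refine ⟨?_, ?_, ?_⟩
      · rw [h0.1]; exact h0.2.2.1.trans h0.2.2.2
      · rw [h0.2.1]; linarith [h0.2.2.1]
      · rw [gen, compl, h0.1, h0.2.1]; linarith
    | succ l => exact ⟨(he l).lastCompl_le, (he l).lastGen_le, (he l).lastGen_le'⟩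
  have hdel : Deliveries (compl π a₀ e) (gen π a₀ e) := {
    zero := h0.1
    mono := monotone_nat_of_le_succ fun l => (hnow l).1.trans (he l).now_le
    mono_gen := monotone_nat_of_le_succ fun l => (hnow l).2.1.trans (he l).le_lastGen
    gen_le := fun l => (hnow l).2.2
    tendsto := by
      -- Completion times grow linearly with the positive slope `y`, hence to infinity.
      have h3 := hC.pos_mul_atTop hy (tendsto_natCast_atTop_atTop (R := ℝ))
      refine h3.congr' ?_
      filter_upwards [eventually_gt_atTop 0] with n hn
      have : (n : ℝ) ≠ 0 := by positivity
      field_simp }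
  exact ⟨hdel, hdel.tendsto_timeAverage hy hC (tendsto_average_of_shift
    (f := fun l => ((compl π a₀ e (l + 1) - gen π a₀ e l) ^ 2 -
      (compl π a₀ e l - gen π a₀ e l) ^ 2) / 2) (area_eq he) h2)⟩

end PeakAge

end VacationQueue

namespace VacationQueue

open Set
open scoped ENNReal

/-! ### The probability that no packet generated after `t₀` is completed by `t₁`. -/

section Survival

variable (π : Policy)

attribute [local simp] Obs.now Obs.inService Obs.inBuffer Obs.lastCompl Obs.lastGen

/-- If the last completion was before `t₁`, then it was that of a packet generated before `t₀`. -/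
def Obs.Stale (t₀ t₁ : ℝ) (s : Obs) : Prop := s.lastCompl ≤ t₁ → s.lastGen ≤ t₀

/-- Every packet completed before `t₁` is generated before `t₀`. -/
def Survives (t₀ t₁ : ℝ) (c : Obs × Clock) : Prop := ∀ j, (path π c j).1.Stale t₀ t₁

variable {π} {t₀ t₁ t₀' t₁' : ℝ}

theorem survives_iff {c : Obs × Clock} :
    Survives π t₀ t₁ c ↔ c.1.Stale t₀ t₁ ∧ Survives π t₀ t₁ (jump π c) :=
  ⟨fun h => ⟨h 0, fun j => h (j + 1)⟩, fun h j => match j with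
    | 0 => h.1
    | j + 1 => h.2 j⟩

theorem Survives.mono {t : ℝ} (ht : t ≤ t₁) {c : Obs × Clock} (h : Survives π t₀ t₁ c) :
    Survives π t₀ t c := fun j hj => h j (hj.trans ht)

theorem measurableSet_stale : MeasurableSet {s : Obs | s.Stale t₀ t₁} := by
  have m1 : Measurable fun s : Obs => s.lastCompl := by fun_prop
  have m2 : Measurable fun s : Obs => s.lastGen := by fun_prop
  have : {s : Obs | s.Stale t₀ t₁} = {s | s.lastCompl ≤ t₁}ᶜ ∪ {s | s.lastGen ≤ t₀} := by
    ext s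
    exact imp_iff_not_or
  rw [this]
  exact (measurableSet_le m1 measurable_const).compl.union (measurableSet_le m2 measurable_const)

theorem measurableSet_survives : MeasurableSet {c : Obs × Clock | Survives π t₀ t₁ c} := by
  have : {c : Obs × Clock | Survives π t₀ t₁ c} =
      ⋂ j, {c | (path π c j).1.Stale t₀ t₁} := by
    ext c
    simp [Survives]
  rw [this]
  exact .iInter fun j => (measurable_path π j).fst measurableSet_stale

/-- The states `s` and `s'` with the thresholds `t₀`, `t₁` and `t₀'`, `t₁'` have the same chance of
survival. -/
structure Alike (π : Policy) (t₀ t₁ t₀' t₁' : ℝ) (s s' : Obs) : Prop where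
  mode : s.1 = s'.1
  past : t₀ - s.now = t₀' - s'.now ∨ t₀ < s.now ∧ t₀' < s'.now
  horizon : t₁ - s.now = t₁' - s'.now
  srv : s.1.busy = 1 → (s.inService ≤ t₀ ↔ s'.inService ≤ t₀')
  buf : s.1 = .loaded ∨ s.1 = .disturbed ∧ π = .brs → (s.inBuffer ≤ t₀ ↔ s'.inBuffer ≤ t₀')
  stale : s.Stale t₀ t₁ ↔ s'.Stale t₀' t₁'

variable {s s' : Obs} {h : ℝ}

/-- Once both current times are past the thresholds they stay so, since `h` is nonnegative;
otherwise the equal distances to the thresholds are preserved. In both cases the new packets fall on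
the same side of the thresholds. -/
theorem Alike.arr (H : Alike π t₀ t₁ t₀' t₁' s s') (hh : 0 ≤ h) :
    Alike π t₀ t₁ t₀' t₁' (s.arr π h) (s'.arr π h) := by
  obtain ⟨m, n, gs, gb, C, r⟩ := s
  obtain ⟨m', n', gs', gb', C', r'⟩ := s'
  obtain ⟨h1, h2, h3, h4, h5, h6⟩ := H
  simp only [Obs.now, Obs.inService, Obs.inBuffer, Obs.Stale, Obs.lastCompl, Obs.lastGen] at *
  subst h1
  have e1 : t₀ - (n + h) = t₀' - (n' + h) ∨ t₀ < n + h ∧ t₀' < n' + h :=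
    h2.imp (by intro; linarith) fun h => ⟨by linarith, by linarith⟩
  have e2 : t₁ - (n + h) = t₁' - (n' + h) := by linarith
  have e3 : n + h ≤ t₀ ↔ n' + h ≤ t₀' := by
    rcases e1 with h | h
    · constructor <;> intro <;> linarith
    · exact iff_of_false (not_le.2 h.1) (not_le.2 h.2)
  cases m <;> cases π <;> constructor <;>
    simp_all [Obs.arr, Obs.Stale, Mode.busy]

theorem Alike.next (H : Alike π t₀ t₁ t₀' t₁' s s') (hh : 0 ≤ h) :
    Alike π t₀ t₁ t₀' t₁' (s.next π h) (s'.next π h) := by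
  obtain ⟨m, n, gs, gb, C, r⟩ := s
  obtain ⟨m', n', gs', gb', C', r'⟩ := s'
  obtain ⟨h1, h2, h3, h4, h5, h6⟩ := H
  simp only [Obs.now, Obs.inService, Obs.inBuffer, Obs.Stale, Obs.lastCompl, Obs.lastGen] at *
  subst h1
  have e1 : t₀ - (n + h) = t₀' - (n' + h) ∨ t₀ < n + h ∧ t₀' < n' + h :=
    h2.imp (by intro; linarith) fun h => ⟨by linarith, by linarith⟩
  have e2 : t₁ - (n + h) = t₁' - (n' + h) := by linarith
  have e3 : n + h ≤ t₁ ↔ n' + h ≤ t₁' := by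
    constructor <;> intro <;> linarith
  cases m <;> cases π <;> constructor <;>
    simp_all [Obs.next, Mode.next, Obs.Stale, Mode.busy]

/-- All the times of the clock are nonnegative. -/
structure Clock.Nonneg (e : Clock) : Prop where
  arr : 0 ≤ e.1
  phase : 0 ≤ e.2.1
  streamT : ∀ k, 0 ≤ e.2.2.1 k
  streamH : ∀ k, 0 ≤ e.2.2.2.1 k
  streamV : ∀ k, 0 ≤ e.2.2.2.2 k

theorem Clock.Nonneg.jump {c : Obs × Clock} (h : c.2.Nonneg) : (jump π c).2.Nonneg := by
  obtain ⟨⟨m, x⟩, a, q, xT, xH, xV⟩ := c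
  obtain ⟨h1, h2, h3, h4, h5⟩ := h
  simp only at h1 h2 h3 h4 h5
  by_cases hlt : a < q
  · have h6 : 0 ≤ q - a := by linarith
    rw [VacationQueue.jump, if_pos hlt]
    cases m <;> cases π <;> constructor <;>
      simp [arrClock, Streams.pullT, Streams.pullH, shift, h3, h4, h5, hlt.le]
  · have h6 : 0 ≤ a - q := by linarith
    rw [VacationQueue.jump, if_neg hlt]
    cases m <;> constructor <;>
      simp [nextClock, Streams.pullV, Streams.pullH, shift, h3, h4, h5, not_lt.1 hlt]

theorem Alike.jump {e : Clock} (H : Alike π t₀ t₁ t₀' t₁' s s') (he : e.Nonneg) :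
    Alike π t₀ t₁ t₀' t₁' (jump π (s, e)).1 (jump π (s', e)).1 ∧
      (jump π (s, e)).2 = (jump π (s', e)).2 := by
  by_cases hlt : e.1 < e.2.1
  · simp only [VacationQueue.jump, hlt, if_true]
    exact ⟨H.arr he.arr, by rw [H.mode]⟩
  · simp only [VacationQueue.jump, hlt, if_false]
    exact ⟨H.next he.phase, by rw [H.mode]⟩

/-- Coupling: two alike states driven by the same clock pass through alike states and keep a common
clock, so they survive together, path by path. -/
theorem Alike.survives {e : Clock} (H : Alike π t₀ t₁ t₀' t₁' s s') (he : e.Nonneg) :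
    Survives π t₀ t₁ (s, e) ↔ Survives π t₀' t₁' (s', e) := by
  refine forall_congr' fun j => ?_
  induction j generalizing s s' e with
  | zero => exact H.stale
  | succ j ih =>
    obtain ⟨h1, h2⟩ := H.jump he
    have h3 := ih h1 (e := (VacationQueue.jump π (s, e)).2) (Clock.Nonneg.jump he)
    rw [path_succ, path_succ]
    rw [show VacationQueue.jump π (s', e) =
      ((VacationQueue.jump π (s', e)).1, (VacationQueue.jump π (s, e)).2) by rw [h2]]
    exact h3

/-- After the horizon every further completion comes too late to matter. -/
theorem survives_of_lt {e : Clock} (ht : t₁ < s.now) (hs : s.Stale t₀ t₁) (he : e.Nonneg) :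
    Survives π t₀ t₁ (s, e) := by
  intro j
  induction j generalizing s e with
  | zero => exact hs
  | succ j ih =>
    rw [path_succ]
    refine ih (s := (jump π (s, e)).1) (e := (jump π (s, e)).2) ?_ ?_ he.jump
    all_goals
      obtain ⟨m, n, gs, gb, C, r⟩ := s
      have h1 := he.arr
      have h2 := he.phase
      simp only [Obs.now] at ht
      have h3 : t₁ < n + e.1 := by linarith
      have h4 : t₁ < n + e.2.1 := by linarith
      by_cases hlt : e.1 < e.2.1
      · rw [jump, if_pos hlt]
        cases m <;> cases π <;> first | exact h3 | exact hs
      · rw [jump, if_neg hlt]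
        cases m <;> first | exact h4 | exact hs | exact fun hc => absurd hc (not_le.2 h4)

variable (ρ : Rates) (π)

theorem ae_expSeq_nonneg (r : ℝ) (hr : 0 < r) : ∀ᵐ x ∂expSeq r, ∀ k, 0 ≤ x k := by
  have := isProbabilityMeasure_expMeasure hr
  refine ae_all_iff.2 fun k => ?_
  have h : MeasurePreserving (fun x : ℕ → ℝ => x k) (expSeq r) (expMeasure r) :=
    measurePreserving_eval_infinitePi (fun _ => expMeasure r) k
  filter_upwards [h.quasiMeasurePreserving.ae (ae_expMeasure_pos r)] with x hx using hx.le

theorem ae_clock_nonneg (m : Mode) : ∀ᵐ e ∂clockLaw ρ m, e.Nonneg := by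
  have h := ae_prod_of_ae (ae_expMeasure_pos ρ.lam) (ae_prod_of_ae (ae_expMeasure_pos (m.rate ρ))
    (ae_prod_of_ae (ae_expSeq_nonneg ρ.lam ρ.lam_pos) (ae_prod_of_ae
      (ae_expSeq_nonneg ρ.mu ρ.mu_pos) (ae_expSeq_nonneg ρ.v ρ.v_pos))))
  filter_upwards [h] with e he
  exact ⟨he.1.le, he.2.1.le, he.2.2.1, he.2.2.2.1, he.2.2.2.2⟩

/-- The probability to survive. -/
noncomputable def surv (t₀ t₁ : ℝ) (s : Obs) : ℝ≥0∞ :=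
  J ρ ({c | Survives π t₀ t₁ c}.indicator 1) s

theorem measurable_surv : Measurable (surv π ρ t₀ t₁) :=
  measurable_J ρ (measurable_one.indicator measurableSet_survives)

theorem surv_eq_measure : surv π ρ t₀ t₁ s = clockLaw ρ s.1 {e | Survives π t₀ t₁ (s, e)} := by
  have h : MeasurableSet {e | Survives π t₀ t₁ (s, e)} :=
    measurable_prodMk_left measurableSet_survives
  rw [← lintegral_indicator_one h]
  rfl

theorem surv_le_one : surv π ρ t₀ t₁ s ≤ 1 := by
  rw [surv_eq_measure]; exact prob_le_one

variable {π}

theorem Alike.surv_eq (H : Alike π t₀ t₁ t₀' t₁' s s') :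
    surv π ρ t₀ t₁ s = surv π ρ t₀' t₁' s' := by
  rw [surv_eq_measure, surv_eq_measure, ← H.mode]
  refine measure_congr ?_
  filter_upwards [ae_clock_nonneg ρ s.1] with e he
  exact propext (H.survives he)

theorem surv_of_lt (ht : t₁ < s.now) (hs : s.Stale t₀ t₁) : surv π ρ t₀ t₁ s = 1 := by
  rw [surv_eq_measure, ← measure_univ (μ := clockLaw ρ s.1)]
  refine measure_congr ?_
  filter_upwards [ae_clock_nonneg ρ s.1] with e he
  exact propext ⟨fun _ => trivial, fun _ => survives_of_lt ht hs he⟩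

theorem surv_of_not_stale (hs : ¬ s.Stale t₀ t₁) : surv π ρ t₀ t₁ s = 0 := by
  rw [surv_eq_measure]
  convert measure_empty (μ := clockLaw ρ s.1)
  ext e
  simp only [mem_ofPred_eq, mem_empty_iff_false, iff_false]
  exact fun h => hs (h 0)

theorem surv_anti {t : ℝ} (ht : t ≤ t₁) : surv π ρ t₀ t₁ s ≤ surv π ρ t₀ t s := by
  rw [surv_eq_measure, surv_eq_measure]
  exact measure_mono fun e he => Survives.mono ht he

/-- From a stale state, survival is survival after the next event, and the Markov property applies.
-/
theorem surv_eq_K (hs : s.Stale t₀ t₁) : surv π ρ t₀ t₁ s = K ρ π (surv π ρ t₀ t₁) s := by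
  have h := J_jump ρ π (f := {c | Survives π t₀ t₁ c}.indicator 1)
    (measurable_one.indicator measurableSet_survives) s
  refine Eq.trans ?_ h
  refine lintegral_congr fun e => ?_
  by_cases hj : Survives π t₀ t₁ (jump π (s, e))
  · have h1 : Survives π t₀ t₁ (s, e) := survives_iff.2 ⟨hs, hj⟩
    simp [h1, hj]
  · have h1 : ¬ Survives π t₀ t₁ (s, e) := fun hc => hj (survives_iff.1 hc).2
    simp [h1, hj]

end Survival

end VacationQueue

namespace VacationQueue

open Set
open scoped ENNReal

/-! ### Integral equations for the survival probabilities. -/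

section RenewalEquations

attribute [local simp] Obs.now Obs.inService Obs.inBuffer Obs.lastCompl Obs.lastGen

/-- The generation time of a packet, which is new if it is positive. -/
noncomputable def mark (b : Bool) : ℝ := if b then 1 else 0

theorem mark_nonpos (b : Bool) : mark b ≤ 0 ↔ b = false := by
  cases b <;> simp [mark]

/-- The state at time `n` in mode `m`, where `fs` and `fb` tell whether the packets in the server
and in the buffer are new. -/
noncomputable def marked (m : Mode) (fs fb : Bool) (n : ℝ) : Obs :=
  (m, n, mark fs, mark fb, 0, 0)

/-- The marks after the arrival of a new packet. -/
def arrMarks (π : Policy) (m : Mode) (fs fb : Bool) : Bool × Bool :=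
  match m, π with
  | .idle, _ | .loaded, _ => (false, true)
  | .serving, .cbs | .disturbed, .cbs => (fs, fb)
  | .serving, .brs | .disturbed, .brs => (fs, true)
  | .serving, .cbsp | .disturbed, .cbsp => (true, fb)

/-- The marks after the end of a phase. -/
def nextMarks (π : Policy) (m : Mode) (fb : Bool) : Bool × Bool :=
  match m, π with
  | .idle, _ | .serving, _ | .disturbed, .cbs | .disturbed, .cbsp => (false, false)
  | .loaded, _ => (fb, false)
  | .disturbed, .brs => (false, fb)

variable (ρ : Rates) (π : Policy)

/-- The probability that a time `y` from now no new packet has been completed, if all the packets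
that are still to come are new. -/
noncomputable def fresh (m : Mode) (fs fb : Bool) (y : ℝ) : ℝ≥0∞ :=
  surv π ρ 0 (y + 1) (marked m fs fb 1)

/-- The probability that a time `τ + x` from now no packet has been completed that is generated
after time `τ` from now. -/
noncomputable def delayed (x : ℝ) (m : Mode) (τ : ℝ) : ℝ≥0∞ :=
  surv π ρ 0 x (marked m false false (-τ))

variable {ρ π} {m : Mode} {fs fb : Bool} {h x y τ : ℝ}

theorem marked_stale {n t : ℝ} : (marked m fs fb n).Stale 0 t := fun _ => le_rfl

/-- With current time `1` and threshold `0` every future packet is new. So the times may be reset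
after each event, and only the mode, the marks and the remaining horizon `y - h` are kept. -/
theorem alike_marked_arr (hh : 0 ≤ h) : Alike π 0 (y + 1) 0 (y - h + 1)
    ((marked m fs fb 1).arr π h)
    (marked m.arr (arrMarks π m fs fb).1 (arrMarks π m fs fb).2 1) := by
  have e1 : y + 1 - (1 + h) = y - h + 1 - 1 := by ring
  have e2 : 0 < 1 + h := by linarith
  cases m <;> cases π <;> constructor <;>
    simp [marked, mark_nonpos, arrMarks, Obs.arr, Obs.Stale, Mode.arr, Mode.busy, e1, e2]

theorem alike_marked_next (hh : 0 ≤ h) (hk : ¬ (m.busy = 1 ∧ fs = true)) :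
    Alike π 0 (y + 1) 0 (y - h + 1) ((marked m fs fb 1).next π h)
      (marked (m.next π) (nextMarks π m fb).1 (nextMarks π m fb).2 1) := by
  have e1 : y + 1 - (1 + h) = y - h + 1 - 1 := by ring
  have e2 : 0 < 1 + h := by linarith
  have e3 : m.busy = 1 → fs = false := fun hm => by simpa [hm] using hk
  clear hk
  cases m <;> cases π <;> constructor <;>
    simp_all [marked, mark_nonpos, nextMarks, Obs.next, Obs.Stale, Mode.next, Mode.busy]

/-- A new packet is completed within the horizon, which ends survival. -/
theorem surv_marked_next_of_busy (hh : h ≤ y) (hk : m.busy = 1 ∧ fs = true) :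
    surv π ρ 0 (y + 1) ((marked m fs fb 1).next π h) = 0 := by
  refine surv_of_not_stale ρ fun hs => ?_
  obtain ⟨hm, rfl⟩ := hk
  have h1 : 1 + h ≤ y + 1 := by linarith
  cases m <;> simp [Mode.busy] at hm <;>
    exact absurd (hs h1) (by simp [marked, mark, Obs.next])

theorem surv_marked_arr_of_lt (hh : y < h) :
    surv π ρ 0 (y + 1) ((marked m fs fb 1).arr π h) = 1 := by
  have h1 : y + 1 < 1 + h := by linarith
  refine surv_of_lt ρ ?_ ?_
  · cases m <;> cases π <;> exact h1
  · cases m <;> cases π <;> exact fun _ => le_rfl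

theorem surv_marked_next_of_lt (hh : y < h) :
    surv π ρ 0 (y + 1) ((marked m fs fb 1).next π h) = 1 := by
  have h1 : y + 1 < 1 + h := by linarith
  refine surv_of_lt ρ ?_ ?_
  · cases m <;> exact h1
  · cases m
    · exact fun _ => le_rfl
    · exact fun _ => le_rfl
    · exact fun hc => absurd hc (not_le.2 h1)
    · exact fun hc => absurd hc (not_le.2 h1)

/-- A packet that arrives before the delay is over is an old one, so the marks stay `false` and only
the remaining delay decreases. -/
theorem alike_delayed_arr (hh : h ≤ τ) : Alike π 0 x 0 x ((marked m false false (-τ)).arr π h)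
    (marked m.arr false false (-(τ - h))) := by
  have e1 : -τ + h = -(τ - h) := by ring
  have e2 : h - τ ≤ 0 := by linarith
  cases m <;> cases π <;> constructor <;>
    simp [marked, mark_nonpos, Obs.arr, Obs.Stale, Mode.arr, e1, hh]

theorem alike_delayed_next : Alike π 0 x 0 x ((marked m false false (-τ)).next π h)
    (marked (m.next π) false false (-(τ - h))) := by
  have e1 : -τ + h = -(τ - h) := by ring
  cases m <;> cases π <;> constructor <;>
    simp [marked, mark_nonpos, Obs.next, Obs.Stale, Mode.next, e1]

/-- If the first event comes a time `h` after the end of the delay, everything happens as if the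
chain had been started at that end in the same mode without marks. -/
theorem alike_fresh_arr (hh : 0 < h) : Alike π 0 x 0 (x + 1)
    ((marked m false false (-τ)).arr π (τ + h)) ((marked m false false 1).arr π h) := by
  have e1 : -τ + (τ + h) = h := by ring
  have e2 : x - h = x + 1 - (1 + h) := by ring
  have e3 : 0 < 1 + h := by linarith
  cases m <;> cases π <;> constructor <;>
    simp [marked, mark_nonpos, Obs.arr, Obs.Stale, e1, e2, e3, hh, not_le.2]

theorem alike_fresh_next (hh : 0 < h) : Alike π 0 x 0 (x + 1)
    ((marked m false false (-τ)).next π (τ + h)) ((marked m false false 1).next π h) := by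
  have e1 : -τ + (τ + h) = h := by ring
  have e2 : x - h = x + 1 - (1 + h) := by ring
  have e3 : 0 < 1 + h := by linarith
  cases m <;> cases π <;> constructor <;>
    simp [marked, mark_nonpos, Obs.next, Obs.Stale, Mode.next, e1, e2, e3, hh]

/-- The expectation over the first event is split at `τ`: events before `τ` give an ordinary
integral, and the tail contributes its probability times the constant `c`. -/
theorem toReal_lintegral_expMeasure {q τ : ℝ} (hq : 0 < q) (hτ : 0 ≤ τ) {F : ℝ → ℝ≥0∞}
    (hF : Measurable F) {f : ℝ → ℝ} (hf : Measurable f) (hf0 : ∀ h, 0 ≤ f h) (hf1 : ∀ h, f h ≤ 1)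
    (hFf : ∀ h, 0 < h → h ≤ τ → F h = ENNReal.ofReal (f h)) {c : ℝ≥0∞} (hc : c ≠ ⊤)
    (htail : ∫⁻ h, (Ioi τ).indicator F h ∂expMeasure q =
      ENNReal.ofReal (Real.exp (-(q * τ))) * c) :
    (∫⁻ h, F h ∂expMeasure q).toReal =
      Real.exp (-(q * τ)) * c.toReal + ∫ h in (0 : ℝ)..τ, q * Real.exp (-(q * h)) * f h := by
  have h1 : ∫⁻ h, F h ∂expMeasure q = ∫⁻ h, (Iic τ).indicator F h ∂expMeasure q +
      ∫⁻ h, (Ioi τ).indicator F h ∂expMeasure q := by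
    rw [← lintegral_add_left (hF.indicator measurableSet_Iic)]
    refine lintegral_congr fun h => ?_
    by_cases hh : h ≤ τ
    · simp [hh, not_lt.2 hh]
    · simp [hh, not_le.1 hh]
  have hint : IntegrableOn (fun h => q * Real.exp (-(q * h)) * f h) (Ioc 0 τ) := by
    refine Measure.integrableOn_of_bounded (M := q) (by simp) (by fun_prop) ?_
    filter_upwards [ae_restrict_mem measurableSet_Ioc] with h hh
    rw [Real.norm_of_nonneg (mul_nonneg (by positivity) (hf0 h))]
    have h2 : Real.exp (-(q * h)) ≤ 1 := Real.exp_le_one_iff.2 (by nlinarith [hh.1])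
    calc q * Real.exp (-(q * h)) * f h ≤ q * 1 * 1 := by
          gcongr
          · exact hf0 h
          · exact hf1 h
      _ = q := by ring
  have h2 : ∫⁻ h, (Iic τ).indicator F h ∂expMeasure q =
      ENNReal.ofReal (∫ h in (0 : ℝ)..τ, q * Real.exp (-(q * h)) * f h) := by
    rw [lintegral_expMeasure q (hF.indicator measurableSet_Iic),
      intervalIntegral.integral_of_le hτ, ofReal_integral_eq_lintegral_ofReal hint]
    · have : ∀ h, ENNReal.ofReal (q * Real.exp (-(q * h))) * (Iic τ).indicator F h =
          (Iic τ).indicator (fun h => ENNReal.ofReal (q * Real.exp (-(q * h))) * F h) h := fun h => by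
        by_cases hh : h ≤ τ <;> simp [hh]
      simp only [this]
      rw [setLIntegral_indicator measurableSet_Iic, inter_comm, Ioi_inter_Iic]
      refine setLIntegral_congr_fun measurableSet_Ioc fun h hh => ?_
      rw [hFf h hh.1 hh.2, ← ENNReal.ofReal_mul (by positivity)]
    · filter_upwards with h using mul_nonneg (by positivity) (hf0 h)
  rw [h1, h2, htail, ENNReal.toReal_add ENNReal.ofReal_ne_top
    (ENNReal.mul_ne_top ENNReal.ofReal_ne_top hc), ENNReal.toReal_mul,
    ENNReal.toReal_ofReal (Real.exp_nonneg _), ENNReal.toReal_ofReal, add_comm]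
  exact intervalIntegral.integral_nonneg hτ fun h _ => mul_nonneg (by positivity) (hf0 h)

theorem lintegral_expMeasure_tail' {r x : ℝ} (hx : 0 ≤ x) {f : ℝ → ℝ≥0∞} (hf : Measurable f) :
    ∫⁻ y, (Ioi x).indicator f y ∂expMeasure r =
      ENNReal.ofReal (Real.exp (-(r * x))) * ∫⁻ y, f (x + y) ∂expMeasure r := by
  rcases hx.eq_or_lt with rfl | hx
  · simp only [mul_zero, neg_zero, Real.exp_zero, ENNReal.ofReal_one, one_mul, zero_add]
    refine lintegral_congr_ae ?_
    filter_upwards [ae_expMeasure_pos r] with y hy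
    exact indicator_of_mem (mem_Ioi.2 hy) f
  · exact lintegral_expMeasure_tail hx hf

/-- The function `φ` relaxes from `c` towards `ψ₁` at rate `a` and towards `ψ₂` at rate `b`. -/
structure Relaxes (a b c : ℝ) (φ ψ₁ ψ₂ : ℝ → ℝ) : Prop where
  eq : ∀ τ, 0 ≤ τ → φ τ = Real.exp (-((a + b) * τ)) * c +
    ∫ h in (0 : ℝ)..τ, Real.exp (-((a + b) * h)) * (a * ψ₁ (τ - h) + b * ψ₂ (τ - h))

variable (ρ π)

/-- The real value of `fresh`. -/
noncomputable def freshR (m : Mode) (fs fb : Bool) (y : ℝ) : ℝ := (fresh ρ π m fs fb y).toReal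

/-- The real value of `delayed`. -/
noncomputable def delayedR (x : ℝ) (m : Mode) (τ : ℝ) : ℝ := (delayed ρ π x m τ).toReal

theorem fresh_anti (m : Mode) (fs fb : Bool) : Antitone (fresh ρ π m fs fb) := fun _ _ h =>
  surv_anti ρ (by linarith)

theorem fresh_le_one (m : Mode) (fs fb : Bool) (y : ℝ) : fresh ρ π m fs fb y ≤ 1 := surv_le_one π ρ

theorem delayed_le_one (x : ℝ) (m : Mode) (τ : ℝ) : delayed ρ π x m τ ≤ 1 := surv_le_one π ρ

theorem fresh_ne_top (m : Mode) (fs fb : Bool) (y : ℝ) : fresh ρ π m fs fb y ≠ ⊤ :=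
  ne_top_of_le_ne_top ENNReal.one_ne_top (fresh_le_one ρ π m fs fb y)

theorem delayed_ne_top (x : ℝ) (m : Mode) (τ : ℝ) : delayed ρ π x m τ ≠ ⊤ :=
  ne_top_of_le_ne_top ENNReal.one_ne_top (delayed_le_one ρ π x m τ)

theorem ofReal_freshR (m : Mode) (fs fb : Bool) (y : ℝ) :
    ENNReal.ofReal (freshR ρ π m fs fb y) = fresh ρ π m fs fb y :=
  ENNReal.ofReal_toReal (fresh_ne_top ρ π m fs fb y)

theorem ofReal_delayedR (x : ℝ) (m : Mode) (τ : ℝ) :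
    ENNReal.ofReal (delayedR ρ π x m τ) = delayed ρ π x m τ :=
  ENNReal.ofReal_toReal (delayed_ne_top ρ π x m τ)

theorem measurable_delayed (x : ℝ) (m : Mode) : Measurable (delayed ρ π x m) :=
  (measurable_surv π ρ).comp (by unfold marked; fun_prop)

@[fun_prop]
theorem measurable_delayedR (x : ℝ) (m : Mode) : Measurable (delayedR ρ π x m) :=
  (measurable_delayed ρ π x m).ennreal_toReal

theorem freshR_anti (m : Mode) (fs fb : Bool) : Antitone (freshR ρ π m fs fb) := fun _ _ h =>
  ENNReal.toReal_mono (fresh_ne_top ρ π m fs fb _) (fresh_anti ρ π m fs fb h)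

@[fun_prop]
theorem measurable_freshR (m : Mode) (fs fb : Bool) : Measurable (freshR ρ π m fs fb) :=
  (freshR_anti ρ π m fs fb).measurable

theorem freshR_nonneg (m : Mode) (fs fb : Bool) (y : ℝ) : 0 ≤ freshR ρ π m fs fb y :=
  ENNReal.toReal_nonneg

theorem freshR_le_one (m : Mode) (fs fb : Bool) (y : ℝ) : freshR ρ π m fs fb y ≤ 1 :=
  ENNReal.toReal_le_of_le_ofReal zero_le_one (by simpa using fresh_le_one ρ π m fs fb y)

theorem delayedR_nonneg (x : ℝ) (m : Mode) (τ : ℝ) : 0 ≤ delayedR ρ π x m τ :=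
  ENNReal.toReal_nonneg

theorem delayedR_le_one (x : ℝ) (m : Mode) (τ : ℝ) : delayedR ρ π x m τ ≤ 1 :=
  ENNReal.toReal_le_of_le_ofReal zero_le_one (by simpa using delayed_le_one ρ π x m τ)

/-- The integrand of the operator `K` for the survival probability. -/
theorem measurable_K_integrand (t₁ : ℝ) (s : Obs) (p q : ℝ≥0∞) : Measurable fun h =>
    p * surv π ρ 0 t₁ (s.arr π h) + q * surv π ρ 0 t₁ (s.next π h) := by
  have h1 := (measurable_surv π ρ (t₀ := 0) (t₁ := t₁)).comp
    (by fun_prop : Measurable fun h => s.arr π h)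
  have h2 := (measurable_surv π ρ (t₀ := 0) (t₁ := t₁)).comp
    (by fun_prop : Measurable fun h => s.next π h)
  exact (h1.const_mul p).add (h2.const_mul q)

theorem ofReal_convex {a b A B : ℝ} (ha : 0 < a) (hb : 0 < b) (hA : 0 ≤ A) (hB : 0 ≤ B) :
    ENNReal.ofReal (a / (a + b)) * ENNReal.ofReal A + ENNReal.ofReal (b / (a + b)) *
      ENNReal.ofReal B = ENNReal.ofReal ((a * A + b * B) / (a + b)) := by
  rw [← ENNReal.ofReal_mul (by positivity), ← ENNReal.ofReal_mul (by positivity),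
    ← ENNReal.ofReal_add (by positivity) (by positivity)]
  congr 1
  ring

theorem convex_le_one {a b A B : ℝ} (ha : 0 < a) (hb : 0 < b) (hA : A ≤ 1) (hB : B ≤ 1) :
    (a * A + b * B) / (a + b) ≤ 1 := by
  rw [div_le_one (by positivity)]
  nlinarith

/-- Conditioning on the first event. If it falls within the delay, the delayed problem continues in
the next mode; if not, by memorylessness the fresh problem starts in the same mode, which gives the
initial value `freshR`. -/
theorem relaxes_delayedR (x : ℝ) (m : Mode) : Relaxes ρ.lam (m.rate ρ)
    (freshR ρ π m false false x) (delayedR ρ π x m) (delayedR ρ π x m.arr)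
    (delayedR ρ π x (m.next π)) where
  eq τ hτ := by
    have hq := m.add_rate_pos ρ
    have hl := ρ.lam_pos
    have hr := m.rate_pos ρ
    have hm1 : (marked m false false (-τ)).1 = m := rfl
    have hm2 : (marked m false false 1).1 = m := rfl
    have hF := measurable_K_integrand ρ π x (marked m false false (-τ))
      (ENNReal.ofReal (ρ.lam / (ρ.lam + m.rate ρ))) (ENNReal.ofReal (m.rate ρ / (ρ.lam + m.rate ρ)))
    have h := toReal_lintegral_expMeasure hq hτ hF
      (f := fun h => (ρ.lam * delayedR ρ π x m.arr (τ - h) +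
        m.rate ρ * delayedR ρ π x (m.next π) (τ - h)) / (ρ.lam + m.rate ρ))
      (by fun_prop)
      (fun h => div_nonneg (add_nonneg (mul_nonneg hl.le (delayedR_nonneg ..))
        (mul_nonneg hr.le (delayedR_nonneg ..))) hq.le)
      (fun h => convex_le_one hl hr (delayedR_le_one ..) (delayedR_le_one ..))
      (fun h _ hh => by
        rw [(alike_delayed_arr hh).surv_eq ρ, alike_delayed_next.surv_eq ρ,
          ← ofReal_convex hl hr (delayedR_nonneg ..) (delayedR_nonneg ..), ofReal_delayedR,
          ofReal_delayedR]
        rfl)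
      (c := fresh ρ π m false false x) (fresh_ne_top ρ π m false false x) (by
        rw [lintegral_expMeasure_tail' hτ hF, fresh, surv_eq_K ρ marked_stale, K, hm2]
        congr 1
        refine lintegral_congr_ae ?_
        filter_upwards [ae_expMeasure_pos (ρ.lam + m.rate ρ)] with h hh
        rw [(alike_fresh_arr hh).surv_eq ρ, (alike_fresh_next hh).surv_eq ρ])
    rw [delayedR, delayed, surv_eq_K ρ marked_stale, K, hm1, h, freshR]
    congr 1
    refine intervalIntegral.integral_congr fun h _ => ?_
    field_simp

/-- If no event occurs within `y`, survival is certain, which gives the initial value `1`. The zero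
function stands for the completion of a new packet. -/
theorem relaxes_freshR (m : Mode) (fs fb : Bool) : Relaxes ρ.lam (m.rate ρ) 1
    (freshR ρ π m fs fb) (freshR ρ π m.arr (arrMarks π m fs fb).1 (arrMarks π m fs fb).2)
    (if m.busy = 1 ∧ fs = true then fun _ => 0 else
      freshR ρ π (m.next π) (nextMarks π m fb).1 (nextMarks π m fb).2) where
  eq y hy := by
    have hq := m.add_rate_pos ρ
    have hl := ρ.lam_pos
    have hr := m.rate_pos ρ
    have hm : (marked m fs fb 1).1 = m := rfl
    have hF := measurable_K_integrand ρ π (y + 1) (marked m fs fb 1)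
      (ENNReal.ofReal (ρ.lam / (ρ.lam + m.rate ρ))) (ENNReal.ofReal (m.rate ρ / (ρ.lam + m.rate ρ)))
    set ψ : ℝ → ℝ := if m.busy = 1 ∧ fs = true then fun _ => 0 else
      freshR ρ π (m.next π) (nextMarks π m fb).1 (nextMarks π m fb).2 with hψ
    have hψm : Measurable ψ := by rw [hψ]; split_ifs <;> fun_prop
    have hψ0 : ∀ t, 0 ≤ ψ t := fun t => by
      rw [hψ]; split_ifs
      · exact le_rfl
      · exact freshR_nonneg ..
    have hψ1 : ∀ t, ψ t ≤ 1 := fun t => by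
      rw [hψ]; split_ifs
      · exact zero_le_one
      · exact freshR_le_one ..
    have h := toReal_lintegral_expMeasure hq hy hF
      (f := fun h => (ρ.lam * freshR ρ π m.arr (arrMarks π m fs fb).1 (arrMarks π m fs fb).2 (y - h) +
        m.rate ρ * ψ (y - h)) / (ρ.lam + m.rate ρ))
      (by fun_prop)
      (fun h => div_nonneg (add_nonneg (mul_nonneg hl.le (freshR_nonneg ..))
        (mul_nonneg hr.le (hψ0 _))) hq.le)
      (fun h => convex_le_one hl hr (freshR_le_one ..) (hψ1 _))
      (fun h hh0 hh => by
        rw [(alike_marked_arr hh0.le).surv_eq ρ, ← ofReal_convex hl hr (freshR_nonneg ..) (hψ0 _),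
          ofReal_freshR]
        congr 2
        rw [hψ]
        split_ifs with hk
        · rw [surv_marked_next_of_busy hh hk, ENNReal.ofReal_zero]
        · rw [(alike_marked_next hh0.le hk).surv_eq ρ, ofReal_freshR]
          rfl)
      (c := 1) ENNReal.one_ne_top (by
        rw [lintegral_expMeasure_tail' hy hF]
        congr 1
        rw [← measure_univ (μ := expMeasure (ρ.lam + m.rate ρ)), ← lintegral_one]
        refine lintegral_congr_ae ?_
        filter_upwards [ae_expMeasure_pos (ρ.lam + m.rate ρ)] with h hh
        have hyh : y < y + h := by linarith
        rw [surv_marked_arr_of_lt hyh, surv_marked_next_of_lt hyh, mul_one, mul_one]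
        exact ofReal_race_add hl hr)
    rw [freshR, fresh, surv_eq_K ρ marked_stale, K, hm, h, ENNReal.toReal_one]
    congr 1
    refine intervalIntegral.integral_congr fun h _ => ?_
    field_simp

end RenewalEquations

end VacationQueue

namespace VacationQueue

open Set
open scoped ENNReal

/-! ### Linear differential equations, integrals and decay. -/

section Relaxation

/-- A measurable function with values in the unit interval. -/
structure UnitValued (φ : ℝ → ℝ) : Prop where
  measurable : Measurable φ
  nonneg : ∀ t, 0 ≤ φ t
  le_one : ∀ t, φ t ≤ 1

theorem UnitValued.zero : UnitValued fun _ => 0 := ⟨measurable_const, fun _ => le_rfl, fun _ => zero_le_one⟩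

variable {a b c : ℝ} {φ ψ₁ ψ₂ : ℝ → ℝ}

theorem UnitValued.intervalIntegrable (h1 : UnitValued ψ₁) (h2 : UnitValued ψ₂) (q : ℝ) (s t : ℝ) :
    IntervalIntegrable (fun s => Real.exp (q * s) * (a * ψ₁ s + b * ψ₂ s)) volume s t := by
  have hm : AEStronglyMeasurable (fun s => a * ψ₁ s + b * ψ₂ s) (volume.restrict (uIoc s t)) :=
    ((h1.measurable.const_mul a).add (h2.measurable.const_mul b)).aestronglyMeasurable
  have hi : IntervalIntegrable (fun s => a * ψ₁ s + b * ψ₂ s) volume s t := by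
    refine (intervalIntegrable_const (c := |a| + |b|)).mono_fun hm (.of_forall fun s => ?_)
    simp only [Real.norm_eq_abs]
    rw [abs_of_nonneg (by positivity : 0 ≤ |a| + |b|)]
    refine (abs_add_le _ _).trans ?_
    rw [abs_mul, abs_mul, abs_of_nonneg (h1.nonneg s), abs_of_nonneg (h2.nonneg s)]
    exact add_le_add (mul_le_of_le_one_right (abs_nonneg _) (h1.le_one s))
      (mul_le_of_le_one_right (abs_nonneg _) (h2.le_one s))
  exact hi.continuousOn_mul (by fun_prop)

namespace Relaxes

/-- Reversing the variable moves `τ` out of the integrand, so that the right side can be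
differentiated by the fundamental theorem of calculus. -/
theorem eq_exp_mul (h : Relaxes a b c φ ψ₁ ψ₂) {τ : ℝ} (hτ : 0 ≤ τ) :
    φ τ = Real.exp (-((a + b) * τ)) *
      (c + ∫ s in (0 : ℝ)..τ, Real.exp ((a + b) * s) * (a * ψ₁ s + b * ψ₂ s)) := by
  have e := intervalIntegral.integral_comp_sub_left (a := 0) (b := τ)
    (fun s => Real.exp (-((a + b) * (τ - s))) * (a * ψ₁ s + b * ψ₂ s)) τ
  simp only [sub_sub_cancel, sub_self, sub_zero] at e
  rw [h.eq τ hτ, e, mul_add, ← intervalIntegral.integral_const_mul]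
  congr 1
  refine intervalIntegral.integral_congr fun s _ => ?_
  rw [← mul_assoc, ← Real.exp_add]
  congr 2
  ring

theorem zero (h : Relaxes a b c φ ψ₁ ψ₂) : φ 0 = c := by simp [h.eq 0 le_rfl]

theorem continuousOn (h : Relaxes a b c φ ψ₁ ψ₂) (h1 : UnitValued ψ₁) (h2 : UnitValued ψ₂) :
    ContinuousOn φ (Ici 0) := by
  have hc : Continuous fun τ : ℝ => Real.exp (-((a + b) * τ)) *
      (c + ∫ s in (0 : ℝ)..τ, Real.exp ((a + b) * s) * (a * ψ₁ s + b * ψ₂ s)) :=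
    (by fun_prop : Continuous fun τ : ℝ => Real.exp (-((a + b) * τ))).mul (continuous_const.add
      (intervalIntegral.continuous_primitive (fun s t => h1.intervalIntegrable h2 _ s t) 0))
  exact hc.continuousOn.congr fun τ hτ => h.eq_exp_mul hτ

theorem hasDerivAt (h : Relaxes a b c φ ψ₁ ψ₂) (h1 : UnitValued ψ₁) (h2 : UnitValued ψ₂)
    (hc1 : ContinuousOn ψ₁ (Ici 0)) (hc2 : ContinuousOn ψ₂ (Ici 0)) {τ : ℝ} (hτ : 0 < τ) :
    HasDerivAt φ (a * (ψ₁ τ - φ τ) + b * (ψ₂ τ - φ τ)) τ := by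
  have hn : Ici (0 : ℝ) ∈ 𝓝 τ := Ici_mem_nhds hτ
  have hm : Measurable fun s => Real.exp ((a + b) * s) * (a * ψ₁ s + b * ψ₂ s) :=
    (by fun_prop : Measurable fun s : ℝ => Real.exp ((a + b) * s)).mul
      ((h1.measurable.const_mul a).add (h2.measurable.const_mul b))
  have hca : ContinuousAt (fun s => Real.exp ((a + b) * s) * (a * ψ₁ s + b * ψ₂ s)) τ :=
    (by fun_prop : ContinuousAt (fun s : ℝ => Real.exp ((a + b) * s)) τ).mul
      (((hc1.continuousAt hn).const_mul a).add ((hc2.continuousAt hn).const_mul b))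
  have hd1 := intervalIntegral.integral_hasDerivAt_right
    (h1.intervalIntegrable (a := a) (b := b) h2 (a + b) 0 τ)
    (hm.stronglyMeasurable.stronglyMeasurableAtFilter) hca
  have hd2 : HasDerivAt (fun τ : ℝ => Real.exp (-((a + b) * τ)))
      (Real.exp (-((a + b) * τ)) * -((a + b) * 1)) τ :=
    (((hasDerivAt_id τ).const_mul (a + b)).neg).exp
  have hd := hd2.mul (hd1.const_add c)
  have heq : φ =ᶠ[𝓝 τ] fun τ : ℝ => Real.exp (-((a + b) * τ)) *
      (c + ∫ s in (0 : ℝ)..τ, Real.exp ((a + b) * s) * (a * ψ₁ s + b * ψ₂ s)) := by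
    filter_upwards [hn] with t ht using h.eq_exp_mul ht
  refine (hd.congr_of_eventuallyEq heq).congr_deriv ?_
  rw [h.eq_exp_mul hτ.le]
  have e : Real.exp (-((a + b) * τ)) * Real.exp ((a + b) * τ) = 1 := by
    rw [← Real.exp_add]; simp
  linear_combination (a * ψ₁ τ + b * ψ₂ τ) * e

end Relaxes

/-- By monotonicity `y * φ y` is at most the integral up to `y`, hence `φ y ≤ M / y`. -/
theorem tendsto_zero_of_integral_le {φ : ℝ → ℝ} (ha : Antitone φ) (h0 : ∀ t, 0 ≤ φ t)
    {M : ℝ} (hM : ∀ y, 0 ≤ y → ∫ t in (0 : ℝ)..y, φ t ≤ M) : Tendsto φ atTop (𝓝 0) := by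
  have h1 : Tendsto (fun y : ℝ => M / y) atTop (𝓝 0) := tendsto_const_nhds.div_atTop tendsto_id
  refine tendsto_of_tendsto_of_tendsto_of_le_of_le' tendsto_const_nhds h1 (.of_forall h0) ?_
  filter_upwards [eventually_gt_atTop 0] with y hy
  rw [le_div_iff₀ hy]
  refine le_trans ?_ (hM y hy.le)
  have h2 : ∫ t in (0 : ℝ)..y, φ y ≤ ∫ t in (0 : ℝ)..y, φ t :=
    intervalIntegral.integral_mono_on hy.le intervalIntegrable_const ha.intervalIntegrable
      fun t ht => ha ht.2
  rw [intervalIntegral.integral_const, smul_eq_mul, sub_zero] at h2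
  linarith

/-- The integral of a function that relaxes from `1`. -/
theorem hasMean_of_hasDerivAt {φ ψ₁ ψ₂ : ℝ → ℝ} {a b Ψ₁ Ψ₂ : ℝ} (ha : 0 ≤ a) (hb : 0 ≤ b)
    (hab : 0 < a + b) (hanti : Antitone φ) (h0 : ∀ t, 0 ≤ φ t) (hφ : φ 0 = 1)
    (hc : ContinuousOn φ (Ici 0))
    (hd : ∀ t, 0 < t → HasDerivAt φ (a * (ψ₁ t - φ t) + b * (ψ₂ t - φ t)) t)
    (hψ₁ : ∀ t, 0 ≤ ψ₁ t) (hψ₂ : ∀ t, 0 ≤ ψ₂ t)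
    (h1 : HasMean (volume.restrict (Ioi 0)) ψ₁ Ψ₁) (h2 : HasMean (volume.restrict (Ioi 0)) ψ₂ Ψ₂) :
    HasMean (volume.restrict (Ioi 0)) φ ((1 + a * Ψ₁ + b * Ψ₂) / (a + b)) := by
  have i1 : ∀ y, 0 ≤ y → IntervalIntegrable ψ₁ volume 0 y := fun y hy =>
    (intervalIntegrable_iff_integrableOn_Ioc_of_le hy).2
      (IntegrableOn.mono_set h1.integrable Ioc_subset_Ioi_self)
  have i2 : ∀ y, 0 ≤ y → IntervalIntegrable ψ₂ volume 0 y := fun y hy =>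
    (intervalIntegrable_iff_integrableOn_Ioc_of_le hy).2
      (IntegrableOn.mono_set h2.integrable Ioc_subset_Ioi_self)
  have i0 : ∀ y, IntervalIntegrable φ volume 0 y := fun y => hanti.intervalIntegrable
  -- The differential equation integrated from `0` to `y`. It bounds the integral of `φ`, which
  -- forces `φ` to vanish at infinity, and in the limit it yields the value.
  have key : ∀ y, 0 ≤ y → (a + b) * ∫ t in (0 : ℝ)..y, φ t =
      1 - φ y + a * (∫ t in (0 : ℝ)..y, ψ₁ t) + b * ∫ t in (0 : ℝ)..y, ψ₂ t := fun y hy => by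
    have h := intervalIntegral.integral_eq_sub_of_hasDerivAt_of_le hy
      (hc.mono Icc_subset_Ici_self) (fun t ht => hd t ht.1)
      ((((i1 y hy).sub (i0 y)).const_mul a).add (((i2 y hy).sub (i0 y)).const_mul b))
    rw [intervalIntegral.integral_add (((i1 y hy).sub (i0 y)).const_mul a)
      (((i2 y hy).sub (i0 y)).const_mul b), intervalIntegral.integral_const_mul,
      intervalIntegral.integral_const_mul, intervalIntegral.integral_sub (i1 y hy) (i0 y),
      intervalIntegral.integral_sub (i2 y hy) (i0 y), hφ] at h
    linarith
  have le1 : ∀ y, 0 ≤ y → ∫ t in (0 : ℝ)..y, ψ₁ t ≤ Ψ₁ := fun y hy => by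
    rw [intervalIntegral.integral_of_le hy, ← h1.integral_eq]
    exact setIntegral_mono_set h1.integrable (.of_forall hψ₁)
      (LE.le.eventuallyLE Ioc_subset_Ioi_self)
  have le2 : ∀ y, 0 ≤ y → ∫ t in (0 : ℝ)..y, ψ₂ t ≤ Ψ₂ := fun y hy => by
    rw [intervalIntegral.integral_of_le hy, ← h2.integral_eq]
    exact setIntegral_mono_set h2.integrable (.of_forall hψ₂)
      (LE.le.eventuallyLE Ioc_subset_Ioi_self)
  have bound : ∀ y, 0 ≤ y → ∫ t in (0 : ℝ)..y, φ t ≤ (1 + a * Ψ₁ + b * Ψ₂) / (a + b) := fun y hy => by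
    rw [le_div_iff₀ hab, mul_comm, key y hy]
    nlinarith [h0 y, mul_le_mul_of_nonneg_left (le1 y hy) ha, mul_le_mul_of_nonneg_left (le2 y hy) hb]
  have hint : IntegrableOn φ (Ioi 0) := by
    refine integrableOn_Ioi_of_intervalIntegral_norm_bounded ((1 + a * Ψ₁ + b * Ψ₂) / (a + b)) 0
      (l := atTop) (b := id) (fun y => ?_) tendsto_id ?_
    · rcases le_total 0 y with hy | hy
      · exact (intervalIntegrable_iff_integrableOn_Ioc_of_le hy).1 (i0 y)
      · simp [Ioc_eq_empty (not_lt.2 hy)]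
    · filter_upwards [eventually_ge_atTop 0] with y hy
      simpa only [id, Real.norm_of_nonneg (h0 _)] using bound y hy
  refine ⟨hint, ?_⟩
  have l0 := intervalIntegral_tendsto_integral_Ioi 0 hint tendsto_id
  have l1 := intervalIntegral_tendsto_integral_Ioi 0 h1.integrable tendsto_id
  have l2 := intervalIntegral_tendsto_integral_Ioi 0 h2.integrable tendsto_id
  have lφ := tendsto_zero_of_integral_le hanti h0 bound
  have l3 := ((lφ.const_sub 1).add (l1.const_mul a)).add (l2.const_mul b)
  have l4 : Tendsto (fun y : ℝ => (a + b) * ∫ t in (0 : ℝ)..id y, φ t) atTop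
      (𝓝 (1 - 0 + a * (∫ t in Ioi 0, ψ₁ t) + b * ∫ t in Ioi 0, ψ₂ t)) := by
    refine l3.congr' ?_
    filter_upwards [eventually_ge_atTop 0] with y hy
    exact (key y hy).symm
  have := tendsto_nhds_unique (l0.const_mul (a + b)) l4
  rw [h1.integral_eq, h2.integral_eq, sub_zero] at this
  rw [eq_div_iff hab.ne', mul_comm]
  exact this

/-- Exponential decay. -/
theorem tendsto_zero_of_deriv_le {V V' : ℝ → ℝ} {κ : ℝ} (hκ : 0 < κ) (hc : ContinuousOn V (Ici 0))
    (h0 : ∀ t, 0 ≤ V t) (hd : ∀ t, 0 < t → HasDerivAt V (V' t) t)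
    (hle : ∀ t, 0 < t → V' t ≤ -(κ * V t)) : Tendsto V atTop (𝓝 0) := by
  have hd' : ∀ t, 0 < t → HasDerivAt (fun t => Real.exp (κ * t) * V t)
      (Real.exp (κ * t) * (κ * 1) * V t + Real.exp (κ * t) * V' t) t := fun t ht =>
    (((hasDerivAt_id t).const_mul κ).exp).mul (hd t ht)
  -- Grönwall's argument: the product with `exp (κ * t)` has a nonpositive derivative.
  have hanti : AntitoneOn (fun t => Real.exp (κ * t) * V t) (Ici 0) := by
    refine antitoneOn_of_deriv_nonpos (convex_Ici 0) (ContinuousOn.mul (by fun_prop) hc) ?_ ?_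
    · rw [interior_Ici]
      exact fun t ht => (hd' t ht).differentiableAt.differentiableWithinAt
    · rw [interior_Ici]
      intro t ht
      rw [(hd' t ht).deriv]
      have := mul_le_mul_of_nonneg_left (hle t ht) (Real.exp_pos (κ * t)).le
      nlinarith
  have hlim : Tendsto (fun t : ℝ => Real.exp (-(κ * t)) * V 0) atTop (𝓝 (0 * V 0)) :=
    (Real.tendsto_exp_neg_atTop_nhds_zero.comp (tendsto_id.const_mul_atTop hκ)).mul_const _
  rw [zero_mul] at hlim
  refine tendsto_of_tendsto_of_tendsto_of_le_of_le' tendsto_const_nhds hlim (.of_forall h0) ?_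
  filter_upwards [eventually_ge_atTop 0] with t ht
  have h := hanti (mem_Ici.2 le_rfl) (mem_Ici.2 ht) ht
  simp only [mul_zero, Real.exp_zero, one_mul] at h
  have e : Real.exp (-(κ * t)) * Real.exp (κ * t) = 1 := by rw [← Real.exp_add]; simp
  calc V t = Real.exp (-(κ * t)) * (Real.exp (κ * t) * V t) := by rw [← mul_assoc, e, one_mul]
    _ ≤ _ := by gcongr

end Relaxation

end VacationQueue

namespace VacationQueue

open Set
open scoped ENNReal

/-! ### Mean times to the completion of a new packet. -/

section Fresh

variable (ρ : Rates) (π : Policy)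

theorem unitValued_freshR (m : Mode) (fs fb : Bool) : UnitValued (freshR ρ π m fs fb) :=
  ⟨measurable_freshR ρ π m fs fb, freshR_nonneg ρ π m fs fb, freshR_le_one ρ π m fs fb⟩

theorem unitValued_delayedR (x : ℝ) (m : Mode) : UnitValued (delayedR ρ π x m) :=
  ⟨measurable_delayedR ρ π x m, delayedR_nonneg ρ π x m, delayedR_le_one ρ π x m⟩

theorem continuousOn_freshR (m : Mode) (fs fb : Bool) :
    ContinuousOn (freshR ρ π m fs fb) (Ici 0) := by
  refine (relaxes_freshR ρ π m fs fb).continuousOn (unitValued_freshR ..) ?_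
  split_ifs
  · exact UnitValued.zero
  · exact unitValued_freshR ..

theorem continuousOn_delayedR (x : ℝ) (m : Mode) : ContinuousOn (delayedR ρ π x m) (Ici 0) :=
  (relaxes_delayedR ρ π x m).continuousOn (unitValued_delayedR ..) (unitValued_delayedR ..)

theorem hasDerivAt_delayedR (x : ℝ) (m : Mode) {τ : ℝ} (hτ : 0 < τ) :
    HasDerivAt (delayedR ρ π x m) (ρ.lam * (delayedR ρ π x m.arr τ - delayedR ρ π x m τ) +
      m.rate ρ * (delayedR ρ π x (m.next π) τ - delayedR ρ π x m τ)) τ :=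
  (relaxes_delayedR ρ π x m).hasDerivAt (unitValued_delayedR ..) (unitValued_delayedR ..)
    (continuousOn_delayedR ρ π x _) (continuousOn_delayedR ρ π x _) hτ

theorem hasDerivAt_freshR (m : Mode) (fs fb : Bool) {τ : ℝ} (hτ : 0 < τ) :
    HasDerivAt (freshR ρ π m fs fb)
      (ρ.lam * (freshR ρ π m.arr (arrMarks π m fs fb).1 (arrMarks π m fs fb).2 τ -
        freshR ρ π m fs fb τ) +
      m.rate ρ * ((if m.busy = 1 ∧ fs = true then fun _ => 0 else
        freshR ρ π (m.next π) (nextMarks π m fb).1 (nextMarks π m fb).2) τ -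
          freshR ρ π m fs fb τ)) τ := by
  refine (relaxes_freshR ρ π m fs fb).hasDerivAt (unitValued_freshR ..) ?_
    (continuousOn_freshR ρ π _ _ _) ?_ hτ
  · split_ifs
    · exact UnitValued.zero
    · exact unitValued_freshR ..
  · split_ifs
    · exact continuousOn_const
    · exact continuousOn_freshR ρ π _ _ _

/-- The measure on the positive half-line. -/
noncomputable abbrev halfLine : Measure ℝ := volume.restrict (Ioi 0)

theorem hasMean_zero : HasMean halfLine (fun _ => 0) 0 := ⟨integrable_zero _ _ _, by simp⟩

variable {ρ π}

/-- The condition `heq` leaves `a` and `b` free, so that transitions which do not change the state,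
whose terms vanish, can be dropped. The means then follow backwards from the states in which a new
packet is in service. -/
theorem hasMean_freshR {m : Mode} {fs fb : Bool} {ψ₁ ψ₂ : ℝ → ℝ} {a b Ψ₁ Ψ₂ : ℝ} (ha : 0 ≤ a)
    (hb : 0 ≤ b) (hab : 0 < a + b) (hψ₁ : UnitValued ψ₁) (hψ₂ : UnitValued ψ₂)
    (h1 : HasMean halfLine ψ₁ Ψ₁) (h2 : HasMean halfLine ψ₂ Ψ₂)
    (heq : ∀ t, ρ.lam * (freshR ρ π m.arr (arrMarks π m fs fb).1 (arrMarks π m fs fb).2 t -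
        freshR ρ π m fs fb t) +
      m.rate ρ * ((if m.busy = 1 ∧ fs = true then fun _ => 0 else
        freshR ρ π (m.next π) (nextMarks π m fb).1 (nextMarks π m fb).2) t -
          freshR ρ π m fs fb t) =
      a * (ψ₁ t - freshR ρ π m fs fb t) + b * (ψ₂ t - freshR ρ π m fs fb t)) :
    HasMean halfLine (freshR ρ π m fs fb) ((1 + a * Ψ₁ + b * Ψ₂) / (a + b)) :=
  hasMean_of_hasDerivAt ha hb hab (freshR_anti ρ π m fs fb) (freshR_nonneg ρ π m fs fb)
    (relaxes_freshR ρ π m fs fb).zero (continuousOn_freshR ρ π m fs fb)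
    (fun t ht => heq t ▸ hasDerivAt_freshR ρ π m fs fb ht) hψ₁.nonneg hψ₂.nonneg h1 h2

variable (ρ π)

/-- A new packet or, with preemption, a still newer one is completed after an exponential time of
rate `mu`; what an arrival does to the buffer is irrelevant. -/
theorem hasMean_fresh_serving_new : HasMean halfLine (freshR ρ π .serving true false) (1 / ρ.mu) := by
  have hl := ρ.lam_pos
  have hm := ρ.mu_pos
  obtain ⟨fb, h⟩ : ∃ fb, arrMarks π .disturbed true fb = (true, fb) ∧
      arrMarks π .serving true false = (true, fb) := by
    cases π
    · exact ⟨false, rfl, rfl⟩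
    · exact ⟨true, rfl, rfl⟩
    · exact ⟨false, rfl, rfl⟩
  have hd : HasMean halfLine (freshR ρ π .disturbed true fb) (1 / ρ.mu) :=
    (hasMean_freshR (ψ₁ := fun _ => 0) (ψ₂ := fun _ => 0) le_rfl hm.le (by linarith) .zero .zero
      hasMean_zero hasMean_zero fun t => by
        simp [h.1, Mode.arr, Mode.rate, Mode.busy]).congr_mean (by ring)
  refine (hasMean_freshR (ψ₂ := fun _ => 0) hl.le hm.le (by linarith)
    (unitValued_freshR ρ π .disturbed true fb) .zero hd hasMean_zero fun t => by
      simp [h.2, Mode.arr, Mode.rate, Mode.busy]).congr_mean ?_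
  field_simp
  ring

theorem hasMean_fresh_loaded_new :
    HasMean halfLine (freshR ρ π .loaded false true) (1 / ρ.v + 1 / ρ.mu) := by
  have hv := ρ.v_pos
  have hm := ρ.mu_pos
  refine (hasMean_freshR (ψ₁ := fun _ => 0) le_rfl hv.le (by linarith) .zero
    (unitValued_freshR ρ π .serving true false) hasMean_zero (hasMean_fresh_serving_new ρ π)
    fun t => by simp [arrMarks, nextMarks, Mode.arr, Mode.next, Mode.rate]).congr_mean ?_
  field_simp
  ring

/-- The mean time to the completion of a new packet, if the system is idle. -/
theorem hasMean_fresh_idle :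
    HasMean halfLine (freshR ρ π .idle false false) (1 / ρ.lam + 1 / ρ.v + 1 / ρ.mu) := by
  have hv := ρ.v_pos
  have hm := ρ.mu_pos
  have hl := ρ.lam_pos
  refine (hasMean_freshR (ψ₂ := fun _ => 0) hl.le le_rfl (by linarith)
    (unitValued_freshR ρ π .loaded false true) .zero (hasMean_fresh_loaded_new ρ π) hasMean_zero
    fun t => by simp [arrMarks, nextMarks, Mode.arr, Mode.next, Mode.rate, Mode.busy]).congr_mean ?_
  field_simp
  ring

/-- The mean time to the completion of a new packet, if a service has started and an arrival takes
the server to a disturbed state of known mean. -/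
theorem hasMean_fresh_serving_old {fs fb : Bool} {d : ℝ}
    (h : arrMarks π .serving false false = (fs, fb))
    (hd : HasMean halfLine (freshR ρ π .disturbed fs fb) d) :
    HasMean halfLine (freshR ρ π .serving false false)
      ((1 + ρ.lam * d + ρ.mu * (1 / ρ.lam + 1 / ρ.v + 1 / ρ.mu)) / (ρ.lam + ρ.mu)) :=
  hasMean_freshR ρ.lam_pos.le ρ.mu_pos.le (add_pos ρ.lam_pos ρ.mu_pos)
    (unitValued_freshR ρ π .disturbed fs fb) (unitValued_freshR ρ π .idle false false) hd
    (hasMean_fresh_idle ρ π) fun t => by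
      simp [h, nextMarks, Mode.arr, Mode.next, Mode.rate]

theorem hasMean_fresh_loaded_old {s : ℝ}
    (hs : HasMean halfLine (freshR ρ π .serving false false) s) :
    HasMean halfLine (freshR ρ π .loaded false false)
      ((1 + ρ.lam * (1 / ρ.v + 1 / ρ.mu) + ρ.v * s) / (ρ.lam + ρ.v)) :=
  hasMean_freshR ρ.lam_pos.le ρ.v_pos.le (add_pos ρ.lam_pos ρ.v_pos)
    (unitValued_freshR ρ π .loaded false true) (unitValued_freshR ρ π .serving false false)
    (hasMean_fresh_loaded_new ρ π) hs fun t => by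
      simp [arrMarks, nextMarks, Mode.arr, Mode.next, Mode.rate]

theorem hasMean_fresh_disturbed_cbs : HasMean halfLine (freshR ρ .cbs .disturbed false false)
    (1 / ρ.mu + (1 / ρ.lam + 1 / ρ.v + 1 / ρ.mu)) := by
  have hm := ρ.mu_pos
  refine (hasMean_freshR (ψ₁ := fun _ => 0) le_rfl hm.le (by linarith) .zero
    (unitValued_freshR ρ .cbs .idle false false) hasMean_zero (hasMean_fresh_idle ρ .cbs)
    fun t => by simp [arrMarks, nextMarks, Mode.arr, Mode.next, Mode.rate]).congr_mean ?_
  field_simp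
  ring

theorem hasMean_fresh_disturbed_brs : HasMean halfLine (freshR ρ .brs .disturbed false true)
    (1 / ρ.mu + (1 / ρ.v + 1 / ρ.mu)) := by
  have hm := ρ.mu_pos
  refine (hasMean_freshR (ψ₁ := fun _ => 0) le_rfl hm.le (by linarith) .zero
    (unitValued_freshR ρ .brs .loaded false true) hasMean_zero (hasMean_fresh_loaded_new ρ .brs)
    fun t => by simp [arrMarks, nextMarks, Mode.arr, Mode.next, Mode.rate]).congr_mean ?_
  field_simp
  ring

theorem hasMean_fresh_disturbed_brs_old {f : ℝ}
    (hf : HasMean halfLine (freshR ρ .brs .loaded false false) f) :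
    HasMean halfLine (freshR ρ .brs .disturbed false false)
    ((1 + ρ.lam * (1 / ρ.mu + (1 / ρ.v + 1 / ρ.mu)) + ρ.mu * f) / (ρ.lam + ρ.mu)) :=
  hasMean_freshR ρ.lam_pos.le ρ.mu_pos.le (add_pos ρ.lam_pos ρ.mu_pos)
    (unitValued_freshR ρ .brs .disturbed false true) (unitValued_freshR ρ .brs .loaded false false)
    (hasMean_fresh_disturbed_brs ρ) hf
    fun t => by simp [arrMarks, nextMarks, Mode.arr, Mode.next, Mode.rate]

theorem hasMean_fresh_disturbed_new_cbsp :
    HasMean halfLine (freshR ρ .cbsp .disturbed true false) (1 / ρ.mu) := by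
  have hm := ρ.mu_pos
  exact (hasMean_freshR (ψ₁ := fun _ => 0) (ψ₂ := fun _ => 0) le_rfl hm.le (by linarith) .zero .zero
    hasMean_zero hasMean_zero fun t => by
      simp [arrMarks, Mode.arr, Mode.rate, Mode.busy]).congr_mean (by ring)

theorem hasMean_fresh_disturbed_cbsp : HasMean halfLine (freshR ρ .cbsp .disturbed false false)
    ((1 + ρ.lam * (1 / ρ.mu) + ρ.mu * (1 / ρ.lam + 1 / ρ.v + 1 / ρ.mu)) / (ρ.lam + ρ.mu)) :=
  hasMean_freshR ρ.lam_pos.le ρ.mu_pos.le (add_pos ρ.lam_pos ρ.mu_pos)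
    (unitValued_freshR ρ .cbsp .disturbed true false) (unitValued_freshR ρ .cbsp .idle false false)
    (hasMean_fresh_disturbed_new_cbsp ρ) (hasMean_fresh_idle ρ .cbsp)
    fun t => by simp [arrMarks, nextMarks, Mode.arr, Mode.next, Mode.rate]

end Fresh

/-! ### The stationary law of the modes and convergence to it. -/

section Stationary

variable (ρ : Rates) (π : Policy)

/-- The mean time spent in a mode between consecutive starts of a service. -/
noncomputable def weight : Mode → ℝ
  | .idle => match π with
    | .brs => ρ.mu / (ρ.lam * (ρ.lam + ρ.mu))
    | _ => 1 / ρ.lam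
  | .loaded => 1 / ρ.v
  | .serving => 1 / (ρ.lam + ρ.mu)
  | .disturbed => ρ.lam / (ρ.mu * (ρ.lam + ρ.mu))

theorem weight_pos (m : Mode) : 0 < weight ρ π m := by
  have := ρ.lam_pos
  have := ρ.mu_pos
  have := ρ.v_pos
  cases m <;> cases π <;> simp only [weight] <;> positivity

/-- The sum over the modes with the weights of the stationary law. -/
noncomputable def modeSum (f : Mode → ℝ) : ℝ :=
  weight ρ π .idle * f .idle + weight ρ π .loaded * f .loaded + weight ρ π .serving * f .serving +
    weight ρ π .disturbed * f .disturbed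

/-- The generator of the modes. -/
noncomputable def generator (f : Mode → ℝ) (m : Mode) : ℝ :=
  ρ.lam * (f m.arr - f m) + m.rate ρ * (f (m.next π) - f m)

/-- The balance equations of the four-state chain, tested against an arbitrary function. -/
theorem modeSum_generator (f : Mode → ℝ) : modeSum ρ π (generator ρ π f) = 0 := by
  have := ρ.lam_pos
  have := ρ.mu_pos
  have := ρ.v_pos
  cases π <;> simp only [modeSum, generator, weight, Mode.arr, Mode.next, Mode.rate] <;>
    field_simp <;> ring

/-- By stationarity the quadratic form of the generator is minus the sum of squared increments over
all transitions, weighted by their flows. The transitions kept here already connect the four modes.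
-/
theorem modeSum_mul_generator_le (f : Mode → ℝ) :
    2 * modeSum ρ π (fun m => f m * generator ρ π f m) ≤
      -(ρ.mu / (ρ.lam + ρ.mu) * (f .loaded - f .idle) ^ 2 + (f .serving - f .loaded) ^ 2 +
        ρ.lam / (ρ.lam + ρ.mu) * (f .disturbed - f .serving) ^ 2) := by
  have := ρ.lam_pos
  have := ρ.mu_pos
  have := ρ.v_pos
  set p := ρ.lam / (ρ.lam + ρ.mu) with hp
  have hp0 : 0 ≤ p := by positivity
  have hp1 : ρ.mu / (ρ.lam + ρ.mu) = 1 - p := by rw [hp]; field_simp; ring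
  have hp2 : 0 ≤ 1 - p := by rw [← hp1]; positivity
  have key : 2 * modeSum ρ π (fun m => f m * generator ρ π f m) =
      -((match π with | .brs => 1 - p | _ => 1) * (f .loaded - f .idle) ^ 2 +
        (f .serving - f .loaded) ^ 2 + p * (f .disturbed - f .serving) ^ 2 +
        (1 - p) * (f .idle - f .serving) ^ 2 +
        p * (f (Mode.disturbed.next π) - f .disturbed) ^ 2) := by
    rw [← hp1, hp]
    cases π <;> simp only [modeSum, generator, weight, Mode.arr, Mode.next, Mode.rate] <;>
      field_simp <;> ring
  rw [key, hp1]
  have h1 := mul_nonneg hp2 (sq_nonneg (f .idle - f .serving))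
  have h2 := mul_nonneg hp0 (sq_nonneg (f (Mode.disturbed.next π) - f .disturbed))
  have h3 := mul_nonneg hp0 (sq_nonneg (f .loaded - f .idle))
  cases π <;> simp only <;> linarith

/-- The spectral gap of the modes. -/
theorem exists_gap : ∃ κ, 0 < κ ∧ ∀ f : Mode → ℝ, modeSum ρ π f = 0 →
    2 * modeSum ρ π (fun m => f m * generator ρ π f m) ≤ -(κ * modeSum ρ π (fun m => f m ^ 2)) := by
  have hl := ρ.lam_pos
  have hm := ρ.mu_pos
  have wI := weight_pos ρ π .idle
  have wF := weight_pos ρ π .loaded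
  have wS := weight_pos ρ π .serving
  have wD := weight_pos ρ π .disturbed
  have h1p : 0 < ρ.mu / (ρ.lam + ρ.mu) := by positivity
  have hp : 0 < ρ.lam / (ρ.lam + ρ.mu) := by positivity
  have hle := modeSum_mul_generator_le ρ π
  simp only [modeSum] at *
  set wI' := weight ρ π .idle
  set wF' := weight ρ π .loaded
  set wS' := weight ρ π .serving
  set wD' := weight ρ π .disturbed
  set p := ρ.lam / (ρ.lam + ρ.mu)
  set p' := ρ.mu / (ρ.lam + ρ.mu)
  -- The three summands are large enough for the coefficients `wI'`, `wS' + 2 * wD'` and `2 * wD'`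
  -- that arise below from bounding the variance by the squared increments.
  set M := wI' / p' + (wS' + 2 * wD') + 2 * wD' / p with hM
  have hM0 : 0 < M := by positivity
  have e1 : wI' ≤ M * p' := by
    have : wI' / p' * p' = wI' := by field_simp
    rw [hM]
    nlinarith [mul_pos (by positivity : 0 < (wS' + 2 * wD') + 2 * wD' / p) h1p]
  have e2 : wS' + 2 * wD' ≤ M := by
    have : 0 < wI' / p' := by positivity
    have : 0 < 2 * wD' / p := by positivity
    linarith
  have e3 : 2 * wD' ≤ M * p := by
    have : 2 * wD' / p * p = 2 * wD' := by field_simp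
    rw [hM]
    nlinarith [mul_pos (by positivity : 0 < wI' / p' + (wS' + 2 * wD')) hp]
  refine ⟨1 / M, by positivity, fun f hf => (hle f).trans (neg_le_neg ?_)⟩
  set I := f .idle
  set F := f .loaded
  set S := f .serving
  set D := f .disturbed
  rw [one_div_mul_eq_div, div_le_iff₀ hM0]
  have h1 : wI' * I ^ 2 + wF' * F ^ 2 + wS' * S ^ 2 + wD' * D ^ 2 ≤
      wI' * (F - I) ^ 2 + wS' * (S - F) ^ 2 + wD' * (D - F) ^ 2 := by
    -- For a function of mean zero, the second moment is at most the second moment about any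
    -- constant, here about the value `F` at `loaded`.
    have h0 : F * (wI' * I + wF' * F + wS' * S + wD' * D) = 0 := by rw [hf, mul_zero]
    linarith [mul_nonneg (by positivity : 0 ≤ wI' + wF' + wS' + wD') (sq_nonneg F)]
  have h2 : (D - F) ^ 2 ≤ 2 * (D - S) ^ 2 + 2 * (S - F) ^ 2 := by
    nlinarith [sq_nonneg ((D - S) - (S - F))]
  have h3 := mul_le_mul_of_nonneg_left h2 wD.le
  have h4 := mul_le_mul_of_nonneg_right e1 (sq_nonneg (F - I))
  have h5 := mul_le_mul_of_nonneg_right e2 (sq_nonneg (S - F))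
  have h6 := mul_le_mul_of_nonneg_right e3 (sq_nonneg (D - S))
  nlinarith

/-- The value of `modeSum` at the initial time is the value at any time. -/
theorem modeSum_delayedR (x : ℝ) {τ : ℝ} (hτ : 0 ≤ τ) :
    modeSum ρ π (fun m => delayedR ρ π x m τ) = modeSum ρ π (fun m => freshR ρ π m false false x) := by
  have hd : ∀ t, 0 < t → HasDerivAt (fun t => modeSum ρ π (fun m => delayedR ρ π x m t)) 0 t :=
    fun t ht => by
      rw [← modeSum_generator ρ π fun m => delayedR ρ π x m t]
      exact ((((hasDerivAt_delayedR ρ π x .idle ht).const_mul _).add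
        ((hasDerivAt_delayedR ρ π x .loaded ht).const_mul _)).add
        ((hasDerivAt_delayedR ρ π x .serving ht).const_mul _)).add
        ((hasDerivAt_delayedR ρ π x .disturbed ht).const_mul _)
  have hc : ContinuousOn (fun t => modeSum ρ π (fun m => delayedR ρ π x m t)) (Ici 0) :=
    ((((continuousOn_delayedR ρ π x .idle).const_mul _).add
      ((continuousOn_delayedR ρ π x .loaded).const_mul _)).add
      ((continuousOn_delayedR ρ π x .serving).const_mul _)).add
      ((continuousOn_delayedR ρ π x .disturbed).const_mul _)
  have h0 : modeSum ρ π (fun m => delayedR ρ π x m 0) =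
      modeSum ρ π (fun m => freshR ρ π m false false x) := by
    simp only [modeSum, (relaxes_delayedR ρ π x _).zero]
  rw [← h0]
  have := intervalIntegral.integral_eq_sub_of_hasDerivAt_of_le hτ
    (hc.mono Icc_subset_Ici_self) (fun t ht => hd t ht.1) intervalIntegrable_const
  simp only [intervalIntegral.integral_zero] at this
  linarith

/-- The stationary mean. -/
noncomputable def modeMean (f : Mode → ℝ) : ℝ := modeSum ρ π f / modeSum ρ π fun _ => 1

theorem modeSum_one_pos : 0 < modeSum ρ π fun _ => 1 := by
  have wI := weight_pos ρ π .idle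
  have wF := weight_pos ρ π .loaded
  have wS := weight_pos ρ π .serving
  have wD := weight_pos ρ π .disturbed
  simp only [modeSum, mul_one]
  positivity

/-- The centred solution stays centred, because the stationary sum is conserved, and the spectral
gap makes its weighted square sum decay exponentially. The positive weight of `idle` gives
convergence of that component. -/
theorem tendsto_delayedR (x : ℝ) : Tendsto (delayedR ρ π x .idle) atTop
    (𝓝 (modeMean ρ π fun m => freshR ρ π m false false x)) := by
  obtain ⟨κ, hκ, hgap⟩ := exists_gap ρ π
  set u := modeMean ρ π fun m => freshR ρ π m false false x with hu
  let e : Mode → ℝ → ℝ := fun m t => delayedR ρ π x m t - u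
  have hsum : ∀ t, 0 ≤ t → modeSum ρ π (fun m => e m t) = 0 := fun t ht => by
    have h1 : modeSum ρ π (fun m => e m t) =
        modeSum ρ π (fun m => delayedR ρ π x m t) - u * modeSum ρ π fun _ => 1 := by
      simp only [modeSum, e]; ring
    rw [h1, modeSum_delayedR ρ π x ht, hu, modeMean, div_mul_cancel₀ _ (modeSum_one_pos ρ π).ne',
      sub_self]
  have hde : ∀ m t, 0 < t → HasDerivAt (e m) (generator ρ π (fun m => e m t) m) t := fun m t ht => by
    refine ((hasDerivAt_delayedR ρ π x m ht).sub_const u).congr_deriv ?_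
    simp only [generator, e]; ring
  have hce : ∀ m, ContinuousOn (e m) (Ici 0) := fun m =>
    (continuousOn_delayedR ρ π x m).sub continuousOn_const
  have hV : Tendsto (fun t => modeSum ρ π (fun m => e m t ^ 2)) atTop (𝓝 0) := by
    refine tendsto_zero_of_deriv_le hκ (V' := fun t =>
      2 * modeSum ρ π (fun m => e m t * generator ρ π (fun m => e m t) m)) ?_ ?_ ?_ ?_
    · exact (((((hce .idle).pow 2).const_mul _).add (((hce .loaded).pow 2).const_mul _)).add
        (((hce .serving).pow 2).const_mul _)).add (((hce .disturbed).pow 2).const_mul _)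
    · intro t
      have wI := weight_pos ρ π .idle
      have wF := weight_pos ρ π .loaded
      have wS := weight_pos ρ π .serving
      have wD := weight_pos ρ π .disturbed
      simp only [modeSum]
      positivity
    · intro t ht
      refine ((((((hde .idle t ht).pow 2).const_mul _).add
        (((hde .loaded t ht).pow 2).const_mul _)).add
        (((hde .serving t ht).pow 2).const_mul _)).add
        (((hde .disturbed t ht).pow 2).const_mul _)).congr_deriv ?_
      simp only [modeSum, Nat.cast_ofNat, Nat.add_one_sub_one, pow_one]
      ring
    · intro t ht
      exact hgap _ (hsum t ht.le)
  have hsq : Tendsto (fun t => e .idle t ^ 2) atTop (𝓝 0) := by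
    have h1 := hV.const_mul (1 / weight ρ π .idle)
    rw [mul_zero] at h1
    refine tendsto_of_tendsto_of_tendsto_of_le_of_le tendsto_const_nhds h1
      (fun t => sq_nonneg _) fun t => ?_
    have wI := weight_pos ρ π .idle
    have wF := weight_pos ρ π .loaded
    have wS := weight_pos ρ π .serving
    have wD := weight_pos ρ π .disturbed
    have h2 : 0 ≤ weight ρ π .loaded * e .loaded t ^ 2 + weight ρ π .serving * e .serving t ^ 2 +
        weight ρ π .disturbed * e .disturbed t ^ 2 := by positivity
    simp only [modeSum]
    rw [one_div_mul_eq_div, le_div_iff₀ wI]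
    linarith
  have h1 : Tendsto (e .idle) atTop (𝓝 0) := by
    rw [tendsto_zero_iff_abs_tendsto_zero]
    have := hsq.sqrt
    simpa [Real.sqrt_sq_eq_abs, Function.comp_def] using this
  have h2 := h1.add_const u
  simpa [e] using h2

/-- The conserved stationary sum bounds its `idle` term uniformly in the delay. The bound is
integrable in `x` and serves as majorant for dominated convergence. -/
theorem delayedR_idle_le (x : ℝ) {τ : ℝ} (hτ : 0 ≤ τ) : delayedR ρ π x .idle τ ≤
    1 / weight ρ π .idle * modeSum ρ π fun m => freshR ρ π m false false x := by
  rw [← modeSum_delayedR ρ π x hτ, one_div_mul_eq_div, le_div_iff₀ (weight_pos ρ π .idle), modeSum]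
  have h : ∀ m, 0 ≤ weight ρ π m * delayedR ρ π x m τ := fun m =>
    mul_nonneg (weight_pos ρ π m).le (delayedR_nonneg ρ π x m τ)
  linarith [h .loaded, h .serving, h .disturbed]

end Stationary

end VacationQueue

namespace VacationQueue

open Set
open scoped ENNReal

/-! ### Convergence of the expected age. -/

section MeanAge

variable (ρ : Rates) (π : Policy) (a₀ : ℝ)

/-- The age, in terms of the initial clock. -/
noncomputable def ageAt (t : ℝ) (e : Clock) : ℝ := ageOf (compl π a₀ e) (gen π a₀ e) t

/-- The supremum over a fixed index set makes measurability visible. Packets not yet completed are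
replaced by `r 0`, which is always admissible since `C 0 = 0`. -/
theorem ageOf_eq_iSup {C r : ℕ → ℝ} (hC : C 0 = 0) {t : ℝ} (ht : 0 ≤ t) :
    ageOf C r t = t - ⨆ l, if C l ≤ t then r l else r 0 := by
  rw [ageOf, iSup]
  congr 2
  ext x
  constructor
  · rintro ⟨l, hl, rfl⟩
    exact ⟨l, if_pos hl⟩
  · rintro ⟨l, rfl⟩
    by_cases hl : C l ≤ t
    · exact ⟨l, hl, if_pos hl⟩
    · exact ⟨0, hC.trans_le ht, if_neg hl⟩

theorem initClock_surjective (e : Clock) : ∃ T H V, initClock T H V = e :=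
  ⟨fun n => Nat.casesOn n e.1 e.2.2.1, e.2.2.2.1, fun n => Nat.casesOn n e.2.1 e.2.2.2.2, rfl⟩

variable {π a₀} in
theorem Recurrent.survives_iff {e : Clock} (h : Recurrent π (initObs a₀, e)) (t₀ t₁ : ℝ) :
    Survives π t₀ t₁ (initObs a₀, e) ↔ ∀ l, compl π a₀ e l ≤ t₁ → gen π a₀ e l ≤ t₀ := by
  obtain ⟨T, H, V, rfl⟩ := initClock_surjective e
  refine (h.forall_path_iff fun C r => C ≤ t₁ → r ≤ t₀).trans (forall_congr' fun l => ?_)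
  rw [h.complTime_eq, h.informGenTime_eq]
  rfl

variable {π a₀} (ha₀ : 0 ≤ a₀)

include ha₀

theorem exists_ae_deliveries : ∀ᵐ e ∂initLaw ρ, Deliveries (compl π a₀ e) (gen π a₀ e) := by
  obtain ⟨em, ga, ke, wa, gaem, keem, h⟩ := exists_srvMeans ρ π
  have hem : 0 ≤ em := by
    rw [← h.emptied.integral_eq]
    refine integral_nonneg fun p => ?_
    cases π <;> simp only [emptied, Pi.zero_apply, zero_le_one]
    split_ifs <;> simp
  have hl := ρ.lam_pos
  have hm := ρ.mu_pos
  have hv := ρ.v_pos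
  have hy : 0 < 1 / ρ.mu + (em * (1 / ρ.lam) + 1 / ρ.v) := by positivity
  filter_upwards [ae_deliveries ρ ha₀ hy h.hasMean_gap (h.hasMean_area rfl rfl)] with e he using he.1

theorem measure_le_ageAt {t : ℝ} (ht : 0 ≤ t) (x : ℝ) :
    initLaw ρ {e | x ≤ ageAt π a₀ t e} = surv π ρ (t - x) t (initObs a₀) := by
  rw [surv_eq_measure]
  refine measure_congr ?_
  filter_upwards [exists_ae_deliveries ρ (π := π) ha₀, ae_recurrent ρ π a₀] with e he hr
  exact propext ((he.le_ageOf_iff ht).trans (hr.survives_iff _ _).symm)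

/-- For `x ≤ t` there is a delay `t - x`. For `t < x ≤ t + a₀` every generated packet counts from
the beginning while the initial one does not. For larger `x` the initial packet itself violates the
condition. -/
theorem surv_initObs {t x : ℝ} (ht : 0 ≤ t) : (surv π ρ (t - x) t (initObs a₀)).toReal =
    (Iic t).indicator (fun x => delayedR ρ π x .idle (t - x)) x +
      (Ioc t (t + a₀)).indicator (fun _ => freshR ρ π .idle false false t) x := by
  rcases le_or_gt x t with h1 | h1
  · have H : Alike π (t - x) t 0 x (initObs a₀) (marked .idle false false (-(t - x))) := by
      have e1 : -a₀ ≤ t - x := by linarith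
      constructor <;> simp [initObs, marked, Mode.busy, Obs.Stale, Obs.now, Obs.inService, Obs.inBuffer,
        Obs.lastCompl, Obs.lastGen, e1]
    simp only [mem_Iic, h1, indicator_of_mem, mem_Ioc, not_lt.2 h1, false_and, not_false_eq_true,
      indicator_of_notMem, add_zero]
    rw [H.surv_eq ρ]
    rfl
  · rcases le_or_gt x (t + a₀) with h2 | h2
    · have H : Alike π (t - x) t 0 (t + 1) (initObs a₀) (marked .idle false false 1) := by
        have e1 : -a₀ ≤ t - x := by linarith
        constructor <;> simp [initObs, marked, Mode.busy, Obs.Stale, Obs.now, Obs.inService, Obs.inBuffer,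
          Obs.lastCompl, Obs.lastGen, e1, h1]
      simp only [mem_Iic, not_le.2 h1, indicator_of_mem, mem_Ioc, h1, h2, and_self,
        not_false_eq_true, indicator_of_notMem, zero_add]
      rw [H.surv_eq ρ]
      rfl
    · have H : ¬ (initObs a₀).Stale (t - x) t := fun hs => by
        have := hs ht
        simp only [initObs, Obs.lastGen] at this
        linarith
      simp only [mem_Iic, not_le.2 h1, mem_Ioc, not_le.2 h2, and_false,
        not_false_eq_true, indicator_of_notMem, zero_add]
      rw [surv_of_not_stale ρ H, ENNReal.toReal_zero]

/-- The initial packet, generated at `-a₀` and completed at time `0`, bounds the age at `t` by `t +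
a₀`. -/
theorem integrable_ageAt {t : ℝ} (ht : 0 ≤ t) : Integrable (ageAt π a₀ t) (initLaw ρ) := by
  have hm : Measurable fun e => t - ⨆ l, if compl π a₀ e l ≤ t then gen π a₀ e l else gen π a₀ e 0 := by
    refine measurable_const.sub (Measurable.iSup fun l => ?_)
    exact Measurable.ite (measurableSet_le (by fun_prop) measurable_const) (by fun_prop) (by fun_prop)
  have hae : AEStronglyMeasurable (ageAt π a₀ t) (initLaw ρ) := by
    refine ⟨_, hm.stronglyMeasurable, ?_⟩
    filter_upwards [exists_ae_deliveries ρ (π := π) ha₀] with e he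
    exact ageOf_eq_iSup he.zero ht
  refine (integrable_const (t + a₀)).mono hae ?_
  filter_upwards [exists_ae_deliveries ρ (π := π) ha₀, ae_service_zero_eq ρ π a₀] with e he h0
  rw [ageAt, Real.norm_of_nonneg (he.ageOf_nonneg ht), Real.norm_of_nonneg (by positivity)]
  by_contra! hc
  have h1 := (he.le_ageOf_iff ht).1 hc.le
  have h2 : ∀ l, compl π a₀ e l ≤ t → gen π a₀ e l ≤ -a₀ := fun l hl => by
    linarith [h1 l hl]
  have h3 := (he.le_ageOf_iff (x := ageOf (compl π a₀ e) (gen π a₀ e) t) ht).1 le_rfl 0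
    (he.zero.trans_le ht)
  rw [show gen π a₀ e 0 = -a₀ from h0.2.1] at h3
  linarith

/-- The mean of a nonnegative variable is the integral of its tail; the range `t < x ≤ t + a₀` has
length `a₀` and a constant tail. -/
theorem integral_ageAt {t : ℝ} (ht : 0 ≤ t) : ∫ e, ageAt π a₀ t e ∂initLaw ρ =
    (∫ x in Ioi 0, (Iic t).indicator (fun x => delayedR ρ π x .idle (t - x)) x) +
      a₀ * freshR ρ π .idle false false t ∧
    AEStronglyMeasurable ((Iic t).indicator fun x => delayedR ρ π x .idle (t - x)) halfLine := by
  have h0 : 0 ≤ᵐ[initLaw ρ] ageAt π a₀ t := by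
    filter_upwards [exists_ae_deliveries ρ (π := π) ha₀] with e he using he.ageOf_nonneg ht
  have hq : ∀ x, (initLaw ρ).real {e | x ≤ ageAt π a₀ t e} =
      (Iic t).indicator (fun x => delayedR ρ π x .idle (t - x)) x +
      (Ioc t (t + a₀)).indicator (fun _ => freshR ρ π .idle false false t) x := fun x => by
    rw [Measure.real, measure_le_ageAt ρ ha₀ ht, surv_initObs ρ ha₀ ht]
  have hanti : Antitone fun x => (initLaw ρ).real {e | x ≤ ageAt π a₀ t e} := fun x y hxy =>
    measureReal_mono fun e he => hxy.trans he
  -- Joint dependence on `x` through both arguments is no obstacle: on `Iic t` the function is a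
  -- tail probability, hence monotone.
  have hm : Measurable ((Iic t).indicator fun x => delayedR ρ π x .idle (t - x)) := by
    have : ((Iic t).indicator fun x => delayedR ρ π x .idle (t - x)) =
        (Iic t).indicator fun x => (initLaw ρ).real {e | x ≤ ageAt π a₀ t e} := by
      ext x
      by_cases hx : x ≤ t
      · simp only [mem_Iic, hx, indicator_of_mem]
        rw [hq]
        simp [hx, not_lt.2 hx]
      · simp [hx]
    rw [this]
    exact hanti.measurable.indicator measurableSet_Iic
  have hi1 : Integrable ((Iic t).indicator fun x => delayedR ρ π x .idle (t - x)) halfLine := by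
    have hi : Integrable ((Iic t).indicator fun _ => (1 : ℝ)) halfLine := by
      rw [integrable_indicator_iff measurableSet_Iic]
      exact integrableOn_const (by
        rw [Measure.restrict_apply measurableSet_Iic, inter_comm, Ioi_inter_Iic]
        simp)
    refine hi.mono hm.aestronglyMeasurable (.of_forall fun x => ?_)
    by_cases hx : x ≤ t
    · simp only [mem_Iic, hx, indicator_of_mem]
      rw [Real.norm_of_nonneg (delayedR_nonneg ..), norm_one]
      exact delayedR_le_one ..
    · simp [hx]
  have hi2 : Integrable ((Ioc t (t + a₀)).indicator fun _ => freshR ρ π .idle false false t)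
      halfLine := by
    rw [integrable_indicator_iff measurableSet_Ioc]
    exact integrableOn_const (by
      rw [Measure.restrict_apply measurableSet_Ioc]
      exact ne_top_of_le_ne_top (by simp) (measure_mono inter_subset_left))
  have hsub : Ioc t (t + a₀) ∩ Ioi 0 = Ioc t (t + a₀) :=
    inter_eq_left.2 fun x hx => lt_of_le_of_lt ht hx.1
  refine ⟨?_, hm.aestronglyMeasurable⟩
  rw [(integrable_ageAt ρ ha₀ ht).integral_eq_integral_meas_le h0]
  simp only [hq]
  rw [integral_add hi1 hi2, integral_indicator measurableSet_Ioc, Measure.restrict_restrict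
    measurableSet_Ioc, hsub, setIntegral_const]
  simp [Measure.real, ha₀]

/-- For fixed `x` the delay `t - x` tends to infinity, so the integrand tends to the stationary
mean; integration over `x` replaces each `freshR` by its integral `Φ`. The contribution of the
initial age vanishes because `freshR` does. -/
theorem tendsto_integral_ageAt {Φ : Mode → ℝ}
    (hΦ : ∀ m, HasMean halfLine (freshR ρ π m false false) (Φ m)) :
    Tendsto (fun t => ∫ e, ageAt π a₀ t e ∂initLaw ρ) atTop (𝓝 (modeMean ρ π Φ)) := by
  have hsum : HasMean halfLine (fun x => modeSum ρ π fun m => freshR ρ π m false false x)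
      (modeSum ρ π Φ) :=
    ((((hΦ .idle).const_mul _).add ((hΦ .loaded).const_mul _)).add
      ((hΦ .serving).const_mul _)).add ((hΦ .disturbed).const_mul _)
  have hmean : HasMean halfLine (fun x => modeMean ρ π fun m => freshR ρ π m false false x)
      (modeMean ρ π Φ) :=
    ((hsum.const_mul (modeSum ρ π fun _ => 1)⁻¹).congr_mean (by rw [modeMean]; ring)).congr
      (.of_forall fun x => by rw [modeMean]; ring)
  have h1 : Tendsto (fun t : ℝ => ∫ x in Ioi 0,
      (Iic t).indicator (fun x => delayedR ρ π x .idle (t - x)) x) atTop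
      (𝓝 (modeMean ρ π Φ)) := by
    rw [← hmean.integral_eq]
    refine tendsto_integral_filter_of_dominated_convergence
      (fun x => 1 / weight ρ π .idle * modeSum ρ π fun m => freshR ρ π m false false x) ?_ ?_ ?_ ?_
    · filter_upwards [eventually_ge_atTop 0] with t ht using (integral_ageAt ρ ha₀ ht).2
    · filter_upwards with t
      filter_upwards with x
      by_cases hx : x ≤ t
      · simp only [mem_Iic, hx, indicator_of_mem]
        rw [Real.norm_of_nonneg (delayedR_nonneg ..)]
        exact delayedR_idle_le ρ π x (by linarith)
      · simp only [mem_Iic, hx, not_false_eq_true, indicator_of_notMem, norm_zero]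
        refine mul_nonneg (by have := weight_pos ρ π .idle; positivity) ?_
        have h : ∀ m, 0 ≤ weight ρ π m * freshR ρ π m false false x := fun m =>
          mul_nonneg (weight_pos ρ π m).le (freshR_nonneg ..)
        exact add_nonneg (add_nonneg (add_nonneg (h _) (h _)) (h _)) (h _)
    · exact hsum.integrable.const_mul _
    · filter_upwards with x
      have h2 : Tendsto (fun t : ℝ => t - x) atTop atTop :=
        tendsto_atTop_add_const_right _ (-x) tendsto_id
      refine ((tendsto_delayedR ρ π x).comp h2).congr' ?_
      filter_upwards [eventually_ge_atTop x] with t ht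
      simp [ht]
  have h2 : Tendsto (fun t => a₀ * freshR ρ π .idle false false t) atTop (𝓝 (a₀ * 0)) := by
    refine Tendsto.const_mul _ (tendsto_zero_of_integral_le (freshR_anti ρ π _ _ _)
      (freshR_nonneg ρ π _ _ _) (M := Φ .idle) fun y hy => ?_)
    rw [intervalIntegral.integral_of_le hy, ← (hΦ .idle).integral_eq]
    exact setIntegral_mono_set (hΦ .idle).integrable (.of_forall (freshR_nonneg ρ π _ _ _))
      (LE.le.eventuallyLE Ioc_subset_Ioi_self)
  have h3 := h1.add h2
  rw [mul_zero, add_zero] at h3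
  refine h3.congr' ?_
  filter_upwards [eventually_ge_atTop 0] with t ht using (integral_ageAt ρ ha₀ ht).1.symm

theorem hasAoI_ageAt {y q : ℝ} (hy : 0 < y) (hgap : HasMean (windowLaw ρ π) gapOf y)
    (harea : HasMean (windowLaw ρ π) areaOf q) {Φ : Mode → ℝ}
    (hΦ : ∀ m, HasMean halfLine (freshR ρ π m false false) (Φ m))
    (heq : modeMean ρ π Φ = q / y) : HasAoI (initLaw ρ) (ageAt π a₀) (q / y) where
  path_integrable := by
    filter_upwards [exists_ae_deliveries ρ (π := π) ha₀] with e he τ hτ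
    exact he.intervalIntegrable le_rfl hτ
  timeAverage := by
    filter_upwards [ae_deliveries ρ ha₀ hy hgap harea] with e he using he.2
  integrable t ht := integrable_ageAt ρ ha₀ ht
  mean := heq ▸ tendsto_integral_ageAt ρ ha₀ hΦ

end MeanAge

end VacationQueue

namespace VacationQueue

open Set
open scoped ENNReal

/-! ### The closed formulas. -/

section Values

variable (ρ : Rates) {π : Policy} {a₀ : ℝ} (ha₀ : 0 ≤ a₀)

include ha₀ in
-- Both routes to the age meet here: `hx` says that the stationary mean is `x`, and `hq` that mean
-- area over mean gap is `x`. Denominators are cleared so that each becomes a polynomial identity.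
theorem hasAoI_of_modes {y q x f s d : ℝ} (hy : 0 < y) (hgap : HasMean (windowLaw ρ π) gapOf y)
    (harea : HasMean (windowLaw ρ π) areaOf q)
    (hf : HasMean halfLine (freshR ρ π .loaded false false) f)
    (hs : HasMean halfLine (freshR ρ π .serving false false) s)
    (hd : HasMean halfLine (freshR ρ π .disturbed false false) d)
    (hx : weight ρ π .idle * (1 / ρ.lam + 1 / ρ.v + 1 / ρ.mu) + 1 / ρ.v * f +
      1 / (ρ.lam + ρ.mu) * s + ρ.lam / (ρ.mu * (ρ.lam + ρ.mu)) * d =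
      x * (weight ρ π .idle + 1 / ρ.v + 1 / (ρ.lam + ρ.mu) + ρ.lam / (ρ.mu * (ρ.lam + ρ.mu))))
    (hq : q = x * y) : HasAoI (initLaw ρ) (ageAt π a₀) x := by
  have hxq : x = q / y := by rw [hq, mul_div_cancel_right₀ _ hy.ne']
  let Φ : Mode → ℝ := fun m => match m with
    | .idle => 1 / ρ.lam + 1 / ρ.v + 1 / ρ.mu
    | .loaded => f
    | .serving => s
    | .disturbed => d
  have hΦ : ∀ m, HasMean halfLine (freshR ρ π m false false) (Φ m) := fun m => by
    cases m
    · exact hasMean_fresh_idle ρ π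
    · exact hf
    · exact hs
    · exact hd
  rw [hxq]
  refine hasAoI_ageAt ρ ha₀ hy hgap harea hΦ ?_
  rw [← hxq, modeMean, div_eq_iff (modeSum_one_pos ρ π).ne']
  simp only [modeSum, mul_one]
  exact hx

include ha₀ in
theorem hasAoI_cbs : HasAoI (initLaw ρ) (ageAt .cbs a₀)
    (1 / ρ.lam + 1 / ρ.v - (ρ.lam + ρ.v + ρ.mu) / (ρ.v * ρ.lam + ρ.mu * ρ.lam + ρ.mu * ρ.v) +
      1 / (ρ.v + ρ.lam) + 2 / ρ.mu) := by
  have hl := ρ.lam_pos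
  have hm := ρ.mu_pos
  have hv := ρ.v_pos
  have h := srvMeans_cbs ρ
  have hd := hasMean_fresh_disturbed_cbs ρ
  have hs := hasMean_fresh_serving_old ρ .cbs (fs := false) (fb := false) rfl hd
  refine hasAoI_of_modes ρ ha₀ (by positivity) h.hasMean_gap (h.hasMean_area rfl rfl)
    (hasMean_fresh_loaded_old ρ .cbs hs) hs hd ?_ ?_
  · simp only [weight]
    field_simp
    ring
  · field_simp
    ring

include ha₀ in
theorem hasAoI_brs : HasAoI (initLaw ρ) (ageAt .brs a₀)
    ((1 / ρ.v ^ 2 + 1 / (ρ.v * ρ.mu) + 1 / ρ.mu ^ 2 + ρ.mu / (ρ.lam * ρ.v * (ρ.lam + ρ.mu)) +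
        ρ.mu / (ρ.lam ^ 2 * (ρ.lam + ρ.mu)) + ρ.mu / (ρ.lam * (ρ.lam + ρ.mu) ^ 2)) /
        (1 / ρ.v + 1 / ρ.mu + ρ.mu / (ρ.lam * (ρ.lam + ρ.mu))) +
      1 / (ρ.lam + ρ.v) + ρ.lam * ρ.v / ((ρ.lam + ρ.mu) ^ 2 * (ρ.lam + ρ.v)) + 1 / ρ.mu) := by
  have hl := ρ.lam_pos
  have hm := ρ.mu_pos
  have hv := ρ.v_pos
  have h := srvMeans_brs ρ
  have hs := hasMean_fresh_serving_old ρ .brs (fs := false) (fb := true) rfl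
    (hasMean_fresh_disturbed_brs ρ)
  have hf := hasMean_fresh_loaded_old ρ .brs hs
  refine hasAoI_of_modes ρ ha₀ (by positivity) h.hasMean_gap (h.hasMean_area rfl rfl)
    hf hs (hasMean_fresh_disturbed_brs_old ρ hf) ?_ ?_
  · simp only [weight]
    field_simp
    ring
  · field_simp
    ring

include ha₀ in
theorem hasAoI_cbsp : HasAoI (initLaw ρ) (ageAt .cbsp a₀)
    (1 / ρ.v + 1 / ρ.lam + 1 / ρ.mu - (ρ.mu + ρ.v + ρ.lam) /
        (ρ.lam * ρ.mu + ρ.v * ρ.mu + ρ.lam * ρ.v) +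
      (ρ.v + ρ.mu + ρ.lam) / ((ρ.mu + ρ.lam) * (ρ.v + ρ.lam))) := by
  have hl := ρ.lam_pos
  have hm := ρ.mu_pos
  have hv := ρ.v_pos
  have h := srvMeans_cbsp ρ
  have hs := hasMean_fresh_serving_old ρ .cbsp (fs := true) (fb := false) rfl
    (hasMean_fresh_disturbed_new_cbsp ρ)
  refine hasAoI_of_modes ρ ha₀ (by positivity) h.hasMean_gap (h.hasMean_area rfl rfl)
    (hasMean_fresh_loaded_old ρ .cbsp hs) hs (hasMean_fresh_disturbed_cbsp ρ) ?_ ?_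
  · simp only [weight]
    field_simp
    ring
  · field_simp
    ring

theorem hasMean_peak_cbs : HasMean (windowLaw ρ .cbs) peakOf
    (1 / ρ.lam + 1 / ρ.v + 1 / (ρ.v + ρ.lam) + 2 / ρ.mu) :=
  (srvMeans_cbs ρ).hasMean_peak.congr_mean (by ring)

theorem hasMean_peak_brs : HasMean (windowLaw ρ .brs) peakOf
    ((ρ.mu ^ 2 - ρ.mu * ρ.v + ρ.lam * ρ.mu) / ((ρ.lam + ρ.mu) ^ 2 * (ρ.lam + ρ.v)) +
      1 / ρ.v + 2 / ρ.mu + 1 / ρ.lam) := by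
  have hl := ρ.lam_pos
  have hm := ρ.mu_pos
  have hv := ρ.v_pos
  refine (srvMeans_brs ρ).hasMean_peak.congr_mean ?_
  field_simp
  ring

theorem hasMean_peak_cbsp : HasMean (windowLaw ρ .cbsp) peakOf
    (1 / ρ.lam + 1 / ρ.mu + 1 / ρ.v +
      (ρ.lam + ρ.mu + ρ.v) / ((ρ.lam + ρ.mu) * (ρ.lam + ρ.v))) := by
  have hl := ρ.lam_pos
  have hm := ρ.mu_pos
  have hv := ρ.v_pos
  refine (srvMeans_cbsp ρ).hasMean_peak.congr_mean ?_
  field_simp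
  ring

theorem hasPeakVariance_cbs : HasPeakVariance (initLaw ρ) (peakAt .cbs a₀)
    (1 / (ρ.lam + ρ.v) ^ 2 + 1 / ρ.lam ^ 2 + 1 / ρ.v ^ 2 + 2 / ρ.mu ^ 2) :=
  hasPeakVariance_peakAt ρ a₀ (srvMeans_cbs ρ).hasMean_peak hasMean_peak_sq_cbs

end Values

end VacationQueue

namespace VacationQueue

open Set
open scoped ENNReal

/-! ### From the canonical clock to an arbitrary probability space. -/

section Transfer

/-- On a finite-dimensional box the product over the disjoint union of indices splits into the
products over the two kinds of indices. -/
theorem measurePreserving_sumElim {ι κ : Type*} (μ : ι → Measure ℝ) (ν : κ → Measure ℝ)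
    [∀ i, IsProbabilityMeasure (μ i)] [∀ i, IsProbabilityMeasure (ν i)] :
    MeasurePreserving (fun p : (ι → ℝ) × (κ → ℝ) => (Sum.elim p.1 p.2 : ι ⊕ κ → ℝ))
      ((Measure.infinitePi μ).prod (Measure.infinitePi ν)) (Measure.infinitePi (Sum.elim μ ν)) := by
  have : ∀ i, IsProbabilityMeasure (Sum.elim μ ν i) := fun i => by
    cases i <;> simp only [Sum.elim_inl, Sum.elim_inr] <;> infer_instance
  have hm : Measurable fun p : (ι → ℝ) × (κ → ℝ) => (Sum.elim p.1 p.2 : ι ⊕ κ → ℝ) :=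
    measurable_pi_lambda _ fun i => by
      cases i <;> simp only [Sum.elim_inl, Sum.elim_inr] <;> fun_prop
  refine ⟨hm, Measure.eq_infinitePi _ fun s t ht => ?_⟩
  have hpre : (fun p : (ι → ℝ) × (κ → ℝ) => (Sum.elim p.1 p.2 : ι ⊕ κ → ℝ)) ⁻¹' (s : Set _).pi t =
      ((s.toLeft : Set ι).pi fun i => t (.inl i)) ×ˢ
        ((s.toRight : Set κ).pi fun i => t (.inr i)) := by
    ext p
    simp [Set.mem_pi]
  rw [Measure.map_apply hm (.pi s.countable_toSet fun i _ => ht i), hpre, Measure.prod_prod,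
    Measure.infinitePi_pi _ fun i _ => ht _, Measure.infinitePi_pi _ fun i _ => ht _]
  conv_rhs => rw [← Finset.toLeft_disjSum_toRight (u := s), Finset.prod_disjSum]
  rfl

theorem measurePreserving_split {ι κ : Type*} (μ : ι → Measure ℝ) (ν : κ → Measure ℝ)
    [∀ i, IsProbabilityMeasure (μ i)] [∀ i, IsProbabilityMeasure (ν i)] :
    MeasurePreserving (fun x : ι ⊕ κ → ℝ => ((fun i => x (.inl i)), fun i => x (.inr i)))
      (Measure.infinitePi (Sum.elim μ ν)) ((Measure.infinitePi μ).prod (Measure.infinitePi ν)) := by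
  have hm : Measurable fun x : ι ⊕ κ → ℝ => ((fun i => x (.inl i)), fun i => x (.inr i)) := by
    fun_prop
  refine ⟨hm, ?_⟩
  rw [← (measurePreserving_sumElim μ ν).map_eq,
    Measure.map_map hm (measurePreserving_sumElim μ ν).measurable]
  exact Measure.map_id

variable {Ω : Type*} [MeasurableSpace Ω] {P : Measure Ω} (ρ : Rates) {T H V : ℕ → Ω → ℝ}

/-- The initial clock of the random system. -/
def randomClock (T H V : ℕ → Ω → ℝ) (ω : Ω) : Clock :=
  initClock (fun n => T n ω) (fun n => H n ω) fun n => V n ω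

theorem measurePreserving_initClock :
    MeasurePreserving (fun x : Streams => initClock x.1 x.2.1 x.2.2) (streamLaw ρ) (initLaw ρ) :=
  ((MeasurePreserving.id _).prod (measurePreserving_pullV ρ)).comp (measurePreserving_pullT ρ)

variable {ρ} in
-- Independence makes the joint law of all primitives an infinite product over the sum of the index
-- sets. It splits into the three streams, whose first interarrival and vacation times become the
-- initial residual times.
theorem ExpPrimitives.hasLaw_randomClock (h : ExpPrimitives P ρ.lam ρ.mu ρ.v T H V) :
    HasLaw (randomClock T H V) (initLaw ρ) P := by
  have hlaw : ∀ i, HasLaw (Sum.elim T (Sum.elim H V) i) (Sum.elim (fun _ : ℕ => expMeasure ρ.lam)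
      (Sum.elim (fun _ : ℕ => expMeasure ρ.mu) fun _ : ℕ => expMeasure ρ.v) i) P := by
    rintro (n | n | n)
    exacts [h.law_T n, h.law_H n, h.law_V n]
  have : ∀ i, IsProbabilityMeasure (Sum.elim (fun _ : ℕ => expMeasure ρ.mu)
      (fun _ : ℕ => expMeasure ρ.v) i) := by
    rintro (n | n) <;> simp only [Sum.elim_inl, Sum.elim_inr] <;> infer_instance
  have h2 : HasLaw (fun ω i => Sum.elim T (Sum.elim H V) i ω)
      (Measure.infinitePi (Sum.elim (fun _ : ℕ => expMeasure ρ.lam)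
        (Sum.elim (fun _ : ℕ => expMeasure ρ.mu) fun _ : ℕ => expMeasure ρ.v))) P :=
    h.indep.hasLaw_infinitePi hlaw (aemeasurable_pi_iff.2 fun i => (hlaw i).aemeasurable)
  have hsplit := ((MeasurePreserving.id (expSeq ρ.lam)).prod (measurePreserving_split
    (fun _ : ℕ => expMeasure ρ.mu) fun _ : ℕ => expMeasure ρ.v)).comp
    (measurePreserving_split (fun _ : ℕ => expMeasure ρ.lam) _)
  have hmp := (measurePreserving_initClock ρ).comp hsplit
  exact ⟨hmp.measurable.comp_aemeasurable h2.aemeasurable, by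
    rw [← hmp.map_eq, ← h2.map_eq,
      AEMeasurable.map_map_of_aemeasurable hmp.measurable.aemeasurable h2.aemeasurable]
    rfl⟩

variable {Ψ : Ω → Clock} {ρ}

theorem HasAoI.comp {Δ : ℝ → Clock → ℝ} {Δ' : ℝ → Ω → ℝ} {a : ℝ} (h : HasAoI (initLaw ρ) Δ a)
    (hΨ : HasLaw Ψ (initLaw ρ) P) (he : ∀ᵐ ω ∂P, ∀ t, Δ' t ω = Δ t (Ψ ω)) : HasAoI P Δ' a := by
  have hae : ∀ {p : Clock → Prop}, (∀ᵐ e ∂initLaw ρ, p e) → ∀ᵐ ω ∂P, p (Ψ ω) := fun hp =>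
    ae_of_ae_map hΨ.aemeasurable (hΨ.map_eq.symm ▸ hp)
  have heq : ∀ t, Δ' t =ᵐ[P] Δ t ∘ Ψ := fun t => he.mono fun ω hω => hω t
  have hint : ∀ t, 0 ≤ t → Integrable (Δ t) (P.map Ψ) := fun t ht =>
    hΨ.map_eq.symm ▸ h.integrable t ht
  refine ⟨?_, ?_, fun t ht => ((hint t ht).comp_aemeasurable hΨ.aemeasurable).congr (heq t).symm, ?_⟩
  · filter_upwards [he, hae h.path_integrable] with ω h1 h2
    simpa only [h1] using h2
  · filter_upwards [he, hae h.timeAverage] with ω h1 h2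
    simpa only [h1] using h2
  · refine h.mean.congr' ?_
    filter_upwards [eventually_ge_atTop 0] with t ht
    rw [integral_congr_ae (heq t), ← hΨ.map_eq,
      integral_map hΨ.aemeasurable (hint t ht).aestronglyMeasurable]
    rfl

theorem HasPAoI.comp {A : ℕ → Clock → ℝ} {A' : ℕ → Ω → ℝ} {a : ℝ} (h : HasPAoI (initLaw ρ) A a)
    (hΨ : HasLaw Ψ (initLaw ρ) P) (he : ∀ᵐ ω ∂P, ∀ l, A' l ω = A l (Ψ ω)) : HasPAoI P A' a := by
  have heq : ∀ l, A' l =ᵐ[P] A l ∘ Ψ := fun l => he.mono fun ω hω => hω l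
  have hint : ∀ l, Integrable (A l) (P.map Ψ) := fun l => hΨ.map_eq.symm ▸ h.integrable l
  refine ⟨?_, fun l => ((hint l).comp_aemeasurable hΨ.aemeasurable).congr (heq l).symm, ?_⟩
  · filter_upwards [he, ae_of_ae_map hΨ.aemeasurable (hΨ.map_eq.symm ▸ h.average)] with ω h1 h2
    simpa only [h1] using h2
  · refine h.mean.congr fun l => ?_
    rw [integral_congr_ae (heq l), ← hΨ.map_eq,
      integral_map hΨ.aemeasurable (hint l).aestronglyMeasurable]
    rfl

theorem HasPeakVariance.comp {A : ℕ → Clock → ℝ} {A' : ℕ → Ω → ℝ} {a : ℝ}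
    (h : HasPeakVariance (initLaw ρ) A a) (hΨ : HasLaw Ψ (initLaw ρ) P)
    (he : ∀ᵐ ω ∂P, ∀ l, A' l ω = A l (Ψ ω)) : HasPeakVariance P A' a := by
  have heq : ∀ l, A' l =ᵐ[P] A l ∘ Ψ := fun l => he.mono fun ω hω => hω l
  have hmem : ∀ l, MemLp (A l) 2 (P.map Ψ) := fun l => hΨ.map_eq.symm ▸ h.memLp l
  refine ⟨fun l => ((hmem l).comp_of_map hΨ.aemeasurable).ae_eq (heq l).symm, ?_⟩
  refine h.variance.congr fun l => ?_
  rw [variance_congr (heq l), ← hΨ.map_eq,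
    variance_map (hmem l).aestronglyMeasurable.aemeasurable hΨ.aemeasurable]

variable (π : Policy) (a₀ : ℝ)

theorem ExpPrimitives.ae_recurrent (h : ExpPrimitives P ρ.lam ρ.mu ρ.v T H V) :
    ∀ᵐ ω ∂P, Recurrent π (initObs a₀, randomClock T H V ω) :=
  ae_of_ae_map h.hasLaw_randomClock.aemeasurable
    (h.hasLaw_randomClock.map_eq.symm ▸ VacationQueue.ae_recurrent ρ π a₀)

/-- On the almost sure event of recurrence the completion and generation times of the system are the
labels of the chain, simultaneously for all `t`. -/
theorem ExpPrimitives.ageProc_eq (h : ExpPrimitives P ρ.lam ρ.mu ρ.v T H V) :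
    ∀ᵐ ω ∂P, ∀ t, ageProc π a₀ T H V t ω = ageAt π a₀ t (randomClock T H V ω) := by
  filter_upwards [h.ae_recurrent π a₀] with ω hω t
  have h1 := funext hω.complTime_eq
  have h2 := funext hω.informGenTime_eq
  simp only [ageProc, age, h1, h2]
  rfl

theorem ExpPrimitives.peakProc_eq (h : ExpPrimitives P ρ.lam ρ.mu ρ.v T H V) :
    ∀ᵐ ω ∂P, ∀ l, peakProc π a₀ T H V l ω = peakAt π a₀ l (randomClock T H V ω) := by
  filter_upwards [h.ae_recurrent π a₀] with ω hω l
  rw [peakProc, peak, hω.complTime_eq, hω.informGenTime_eq]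
  rfl

variable {π a₀}

theorem ExpPrimitives.hasAoI (h : ExpPrimitives P ρ.lam ρ.mu ρ.v T H V) {a : ℝ}
    (ha : HasAoI (initLaw ρ) (ageAt π a₀) a) : HasAoI P (ageProc π a₀ T H V) a :=
  ha.comp h.hasLaw_randomClock (h.ageProc_eq π a₀)

theorem ExpPrimitives.hasPAoI (h : ExpPrimitives P ρ.lam ρ.mu ρ.v T H V) {a : ℝ}
    (ha : HasMean (windowLaw ρ π) peakOf a) : HasPAoI P (peakProc π a₀ T H V) a :=
  (hasPAoI_peakAt ρ a₀ ha).comp h.hasLaw_randomClock (h.peakProc_eq π a₀)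

end Transfer

end VacationQueue

theorem mainTheorem9 {Ω : Type*} [MeasurableSpace Ω] (P : Measure Ω) [IsProbabilityMeasure P]
    (lam mu v : ℝ) (hlam : 0 < lam) (hmu : 0 < mu) (hv : 0 < v)
    (T H V : ℕ → Ω → ℝ) (hprim : VacationQueue.ExpPrimitives P lam mu v T H V)
    (a₀ : ℝ) (ha₀ : 0 ≤ a₀) :
    (VacationQueue.HasAoI P (VacationQueue.ageProc .cbs a₀ T H V)
        (1 / lam + 1 / v - (lam + v + mu) / (v * lam + mu * lam + mu * v)
          + 1 / (v + lam) + 2 / mu) ∧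
      VacationQueue.HasPAoI P (VacationQueue.peakProc .cbs a₀ T H V)
        (1 / lam + 1 / v + 1 / (v + lam) + 2 / mu) ∧
      VacationQueue.HasPeakVariance P (VacationQueue.peakProc .cbs a₀ T H V)
        (1 / (lam + v) ^ 2 + 1 / lam ^ 2 + 1 / v ^ 2 + 2 / mu ^ 2)) ∧
    (VacationQueue.HasAoI P (VacationQueue.ageProc .brs a₀ T H V)
        ((1 / v ^ 2 + 1 / (v * mu) + 1 / mu ^ 2 + mu / (lam * v * (lam + mu))
            + mu / (lam ^ 2 * (lam + mu)) + mu / (lam * (lam + mu) ^ 2))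
          / (1 / v + 1 / mu + mu / (lam * (lam + mu)))
          + 1 / (lam + v) + lam * v / ((lam + mu) ^ 2 * (lam + v)) + 1 / mu) ∧
      VacationQueue.HasPAoI P (VacationQueue.peakProc .brs a₀ T H V)
        ((mu ^ 2 - mu * v + lam * mu) / ((lam + mu) ^ 2 * (lam + v))
          + 1 / v + 2 / mu + 1 / lam)) ∧
    (VacationQueue.HasPAoI P (VacationQueue.peakProc .cbsp a₀ T H V)
        (1 / lam + 1 / mu + 1 / v + (lam + mu + v) / ((lam + mu) * (lam + v))) ∧
      VacationQueue.HasAoI P (VacationQueue.ageProc .cbsp a₀ T H V)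
        (1 / v + 1 / lam + 1 / mu - (mu + v + lam) / (lam * mu + v * mu + lam * v)
          + (v + mu + lam) / ((mu + lam) * (v + lam)))) := by
  let ρ : VacationQueue.Rates := ⟨lam, mu, v, hlam, hmu, hv⟩
  have h : VacationQueue.ExpPrimitives P ρ.lam ρ.mu ρ.v T H V := hprim
  exact ⟨⟨h.hasAoI (VacationQueue.hasAoI_cbs ρ ha₀), h.hasPAoI (VacationQueue.hasMean_peak_cbs ρ),
      (VacationQueue.hasPeakVariance_cbs ρ).comp h.hasLaw_randomClock (h.peakProc_eq .cbs a₀)⟩,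
    ⟨h.hasAoI (VacationQueue.hasAoI_brs ρ ha₀), h.hasPAoI (VacationQueue.hasMean_peak_brs ρ)⟩,
    h.hasPAoI (VacationQueue.hasMean_peak_cbsp ρ), h.hasAoI (VacationQueue.hasAoI_cbsp ρ ha₀)⟩
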